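/- Let $n, N\ge 1$ be integers and let $B$ be an $n\times n$ integer matrix in systematic normal form (SysNF) with $\det B=N$: $B_{1,1}=N$, $B_{i,i}=1$ for $i>1$, $B_{i,j}=0$ for $i>1$, $j\ne i$, and $\sum_{i>1}B_{1,i}^2+1$ is coprime to $N$. Let $L=L(B)\subseteq\mathbb{Z}^n$ be the lattice of all integer combinations of the columns of $B$, and let $L_N=L\cap\{0,\dots,N-1\}^n$, regarded as a subgroup of $\mathbb{Z}_N^n$ with entrywise addition modulo $N$. Let $\mathcal{F}_{L,N}$ be the linear map on $\mathbb{C}^{L_N}$ given by $$\mathcal{F}_{L,N}|x\rangle=\frac{1}{\sqrt{N^{n-1}}}\sum_{z\in L_N}e^{-2\pi i\langle x,z\rangle/N}\,|z\rangle\qquad(x\in L_N).$$ Then: 1. $\mathcal{F}_{L,N}$ is unitary. 2. $\mathcal{F}_{L,N}$ is implemented by a quantum circuit of polynomial size: there is a polynomial $p$, independent of $n$, $N$ and $B$, such that for every such $n,N,B$ there is a sequence of at most $p(n+\ell)$ elementary gates (arbitrary unitaries on one or two qubits), where $\ell=\lfloor\log_2 N\rfloor+1$ is the bit length of $N$, acting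 on $n\ell$ qubits and at most $p(n+\ell)$ ancilla qubits, which maps $|x\rangle|0\rangle$ exactly to $(\mathcal{F}_{L,N}|x\rangle)|0\rangle$ for every $x\in L_N$, each of the $n$ coordinates being written in binary on $\ell$ qubits. In particular, the size is $\mathrm{poly}(n)$ whenever $\log N=\mathrm{poly}(n)$. 3. $L$ has a lattice DFT: the functions $\chi_x(z)=e^{-2\pi i\langle x,z\rangle/N}$, $x\in L_N$, are characters of the finite abelian group $L_N$ and form a Fourier transform of it, that is, a complete set of pairwise inequivalent irreducible complex representations of $L_N$. -/

import Mathlib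

namespace LatticeDFT

/-! ### Lattices in systematic normal form and the finite group `L_N` -/

/-- Systematic normal form: row `0` is `(N, b₂, …, bₙ)`, the other rows are those of the identity
matrix, and `b₂² + ⋯ + bₙ² + 1` is coprime to `N`, the top left entry. -/
structure IsSysNF {n : ℕ} [NeZero n] (B : Matrix (Fin n) (Fin n) ℤ) : Prop where
  diag : ∀ i, i ≠ 0 → B i i = 1
  offDiag : ∀ i j, i ≠ 0 → i ≠ j → B i j = 0
  coprime : IsCoprime (∑ i ∈ Finset.univ.erase 0, B 0 i ^ 2 + 1) (B 0 0)

/-- The integer lattice `L(B)`: all integer combinations of the columns of `B`. -/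
def lattice {n : ℕ} (B : Matrix (Fin n) (Fin n) ℤ) : Submodule ℤ (Fin n → ℤ) :=
  Submodule.span ℤ (Set.range fun j => B.col j)

/-- The group `L_N`: the lattice `L(B)` reduced modulo `N`, as a subgroup of `(ℤ/N)ⁿ`. -/
def latticeMod {n : ℕ} (B : Matrix (Fin n) (Fin n) ℤ) (N : ℕ) : AddSubgroup (Fin n → ZMod N) :=
  (lattice B).toAddSubgroup.map ((Int.castAddHom (ZMod N)).compLeft (Fin n))

/-- When `det B = N`, the lattice is periodic modulo `N`, so that `L_N` consists of the lattice
points in the cube `{0, …, N - 1}ⁿ`. -/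
theorem mem_latticeMod_iff {n N : ℕ} [NeZero N] {B : Matrix (Fin n) (Fin n) ℤ}
    (hdet : B.det = N) (x : Fin n → ZMod N) :
    x ∈ latticeMod B N ↔ (fun i => ((x i).val : ℤ)) ∈ lattice B := by
  have key : ∀ v : Fin n → ℤ, (N : ℤ) • v ∈ lattice B := by
    intro v
    have h1 : (N : ℤ) • v = B.mulVecLin (B.adjugate.mulVec v) := by
      rw [Matrix.mulVecLin_apply, Matrix.mulVec_mulVec, Matrix.mul_adjugate, hdet,
        Matrix.smul_mulVec, Matrix.one_mulVec]
    have h2 : lattice B = LinearMap.range B.mulVecLin := (Matrix.range_mulVecLin B).symm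
    rw [h1, h2]
    exact LinearMap.mem_range_self _ _
  constructor
  · rintro ⟨v, hv, rfl⟩
    have h3 : (fun i => ((((Int.castAddHom (ZMod N)).compLeft (Fin n) v) i).val : ℤ))
        = v - (N : ℤ) • (fun i => v i / (N : ℤ)) := by
      funext i
      have h4 : (((v i : ℤ) : ZMod N).val : ℤ) = v i % N := ZMod.val_intCast (v i)
      have h5 := Int.emod_add_mul_ediv (v i) N
      simp only [AddMonoidHom.compLeft_apply, Function.comp_apply, Int.coe_castAddHom,
        Pi.sub_apply, Pi.smul_apply, smul_eq_mul]
      rw [h4]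
      linarith
    rw [h3]
    exact (lattice B).sub_mem hv (key _)
  · intro h
    refine ⟨_, h, ?_⟩
    funext i
    simp

noncomputable instance {n : ℕ} (B : Matrix (Fin n) (Fin n) ℤ) (N : ℕ) [NeZero N] :
    Fintype (latticeMod B N) :=
  Fintype.ofFinite _

/-- `e^{-2πi⟨x,z⟩/N}`, with `⟨x,z⟩` the integer inner product of the representatives of `x` and
`z` in `{0, …, N - 1}ⁿ`. -/
noncomputable def phase {n N : ℕ} (x z : Fin n → ZMod N) : ℂ :=
  Complex.exp (-(2 * Real.pi * Complex.I * ((∑ i, (x i).val * (z i).val : ℕ) : ℂ) / (N : ℂ)))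

/-- The matrix of `|x⟩ ↦ N^{-(n-1)/2} ∑_{z ∈ L_N} e^{-2πi⟨x,z⟩/N} |z⟩`; column `x` is the image of
`|x⟩`. -/
noncomputable def qft {n : ℕ} (B : Matrix (Fin n) (Fin n) ℤ) (N : ℕ) :
    Matrix (latticeMod B N) (latticeMod B N) ℂ :=
  Matrix.of fun z x => (1 / (Real.sqrt ((N : ℝ) ^ (n - 1)) : ℂ)) * phase x.1 z.1

/-! ### Fourier transforms of finite abelian groups and lattice DFTs -/

/-- A character, as a one-dimensional complex representation. -/
noncomputable def charRep {G : Type*} [AddCommGroup G] (ψ : AddChar G ℂ) :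
    Representation ℂ (Multiplicative G) ℂ where
  toFun g := ψ g.toAdd • LinearMap.id
  map_one' := by
    ext
    simp
  map_mul' g h := by
    ext
    simp [AddChar.map_add_eq_mul, mul_comm]

/-- The family of characters `χ` is a Fourier transform of the finite abelian group `G`: it is a
complete set of pairwise inequivalent irreducible complex representations of `G`. -/
structure IsFourierTransform {G ι : Type*} [AddCommGroup G] (χ : ι → AddChar G ℂ) : Prop where
  irreducible : ∀ i, (charRep (χ i)).IsIrreducible
  inequivalent : ∀ i j, Nonempty ((charRep (χ i)).Equiv (charRep (χ j))) → i = j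
  complete : ∀ (V : Type) [AddCommGroup V] [Module ℂ V] [FiniteDimensional ℂ V]
    (ρ : Representation ℂ (Multiplicative G) V), ρ.IsIrreducible →
      ∃ i, Nonempty (ρ.Equiv (charRep (χ i)))

/-- The functions `χ_x(z) = e^{-2πi⟨x,z⟩/N}` (for `x, z ∈ L_N`) are characters of `L_N`, and form a
Fourier transform of `L_N`. -/
def HasLatticeDFT {n : ℕ} (B : Matrix (Fin n) (Fin n) ℤ) (N : ℕ) : Prop :=
  ∃ χ : latticeMod B N → AddChar (latticeMod B N) ℂ,
    IsFourierTransform χ ∧ ∀ x z : latticeMod B N, χ x z = phase x.1 z.1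

/-! ### Quantum circuits on qubits -/

/-- An elementary gate on qubits labelled by `W`: an arbitrary unitary on one qubit, or on an
ordered pair of distinct qubits. -/
inductive Gate (W : Type) : Type
  | one (i : W) (U : Matrix.unitaryGroup Bool ℂ) : Gate W
  | two (i j : W) (hij : i ≠ j) (U : Matrix.unitaryGroup (Bool × Bool) ℂ) : Gate W

open Classical in
/-- The operator of a gate on `(ℂ²)^{⊗W}`, in the computational basis: the given unitary on the
qubits of the gate, and the identity on all the others. -/
noncomputable def Gate.toMatrix {W : Type} : Gate W → Matrix (W → Bool) (W → Bool) ℂ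
  | .one i U => Matrix.of fun y x => if ∀ k, k ≠ i → y k = x k then U.1 (y i) (x i) else 0
  | .two i j _ U => Matrix.of fun y x =>
      if ∀ k, k ≠ i → k ≠ j → y k = x k then U.1 (y i, y j) (x i, x j) else 0

/-- A quantum circuit is a finite sequence of gates; its size is the length of the sequence. -/
abbrev Circuit (W : Type) : Type := List (Gate W)

/-- The operator of a circuit, whose gates are applied from left to right. -/
noncomputable def Circuit.toMatrix {W : Type} [Fintype W] [DecidableEq W] :
    Circuit W → Matrix (W → Bool) (W → Bool) ℂ
  | [] => 1
  | g :: C => Circuit.toMatrix C * g.toMatrix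

/-- The qubits: one binary register of `Nat.size N` (the bit length of `N`) qubits for each of the
`n` coordinates, and `a` ancillas. -/
abbrev Wires (n N a : ℕ) : Type := (Fin n × Fin (Nat.size N)) ⊕ Fin a

/-- The computational basis state that encodes `x`: each coordinate, an integer in
`{0, …, N - 1}`, is written in binary, and all ancillas are `0`. -/
def encode {n N : ℕ} (a : ℕ) (x : Fin n → ZMod N) : Wires n N a → Bool :=
  Sum.elim (fun p => (x p.1).val.testBit p.2) (fun _ => false)

/-- The circuit maps `|x⟩|0⟩` to `(F_{L,N}|x⟩)|0⟩`, exactly, for every `x ∈ L_N`; on other basis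
states nothing is required. -/
def Implements {n N a : ℕ} [NeZero N] (Q : Circuit (Wires n N a))
    (B : Matrix (Fin n) (Fin n) ℤ) : Prop :=
  ∀ x : latticeMod B N,
    (Circuit.toMatrix Q).mulVec (Pi.single (encode a x.1) 1)
      = ∑ z : latticeMod B N,
          qft B N z x • (Pi.single (encode a z.1) 1 : (Wires n N a → Bool) → ℂ)

end LatticeDFT

open LatticeDFT

/-! Write `b` for the tail of the first row of `B`. Modulo `N` the lattice is the graph `x 0 = ∑ b j
* x j`, so a point of `L_N` is given freely by its tail. On `L_N` the pairing becomes `⟨x, z⟩ = ∑ h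
i * z i` over `i ≠ 0`, with `h i = x i + b i * x 0` (`dotProduct_latticePoint`). Since `∑ b i * h i
= (∑ b i ^ 2 + 1) * x 0`, the coprimality condition recovers `x 0` from `h`, and then all of `x`
(`dualCoordInv_dualCoord`). Hence the pairing is nondegenerate on `L_N`: the characters are
distinct, counting shows that they are all the characters, and orthogonality makes the transform
unitary.

The same formula says that, with input coordinates `h` and output coordinates the tail of `z`, the
transform is a tensor product of `n - 1` inverse Fourier transforms of order `N`. The change of
coordinates can be done reversibly because `h` determines `x`. It is linear modulo `N`, hence made
of modular additions, which are diagonal in the Fourier basis of order `N`. Everything thus rests on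
an exact circuit for the Fourier transform of order `N`, where `N` need not be a power of two
(`run_fourierCircuit`).

Replacing `v` by an integer `k` near `v * 2 ^ (ℓ + 4) / N` and applying the exact transform of order
`2 ^ (ℓ + 4)` only approximates the transform of order `N`. The error is made harmless by
superposing over shifts `v` of the input and `u` of the output with compensating phases: as `x (y +
u) - (x + v) u = x y - u v`, the amplitude from `x` to `y` is exactly `e^{2πixy/N}` times a number
that does not depend on `x` and `y` (`toMatrix_blockCircuit`). Its normalised size is at least `1 /
32` for every `N` (`norm_attenuation_ge`). A rotation of one ancilla lowers it to exactly `sin (π /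
106)`, and `26` rounds of amplitude amplification turn the angle into `53 π / 106 = π / 2`
(`amplification`), with no error left. -/

namespace LatticeDFT

open Matrix

set_option linter.unusedSectionVars false

/-! ### Gates as operators in the computational basis -/

section Gates

variable {W : Type}

/-- A column of a one-qubit gate is supported on the two basis states that agree with `x` off its
wire, so sums over all basis states in matrix products collapse to one bit. -/
theorem sum_agree_one [Fintype W] [DecidableEq W] (i : W) (x : W → Bool)
    (F G : (W → Bool) → ℂ) (hF : ∀ z, (∀ k, k ≠ i → z k = x k) → F z = G z)
    (hF' : ∀ z, (¬ ∀ k, k ≠ i → z k = x k) → F z = 0) :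
    ∑ z, F z = ∑ b, G (Function.update x i b) := by
  symm
  apply Finset.sum_of_injOn (fun b => Function.update x i b)
  · intro a _ b _ h
    simpa using congrFun h i
  · intro a _
    simp
  · intro z _ hz
    apply hF'
    intro h
    apply hz
    refine ⟨z i, by simp, ?_⟩
    funext k
    by_cases hk : k = i
    · subst hk; simp
    · simp [hk, h k hk]
  · intro b _
    rw [hF]
    intro k hk
    simp [hk]

theorem sum_agree_two [Fintype W] [DecidableEq W] (i j : W) (hij : i ≠ j) (x : W → Bool)
    (F G : (W → Bool) → ℂ) (hF : ∀ z, (∀ k, k ≠ i → k ≠ j → z k = x k) → F z = G z)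
    (hF' : ∀ z, (¬ ∀ k, k ≠ i → k ≠ j → z k = x k) → F z = 0) :
    ∑ z, F z =
      ∑ b : Bool × Bool, G (Function.update (Function.update x i b.1) j b.2) := by
  symm
  apply Finset.sum_of_injOn (fun b : Bool × Bool =>
    Function.update (Function.update x i b.1) j b.2)
  · intro a _ b _ h
    have h1 := congrFun h i
    have h2 := congrFun h j
    simp [hij] at h1 h2
    exact Prod.ext h1 h2
  · intro a _
    simp
  · intro z _ hz
    apply hF'
    intro h
    apply hz
    refine ⟨(z i, z j), by simp, ?_⟩
    funext k
    by_cases hk : k = i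
    · subst hk; simp [hij]
    · by_cases hk' : k = j
      · subst hk'; simp
      · simp [hk, hk', h k hk hk']
  · intro b _
    rw [hF]
    intro k hk hk'
    simp [hk, hk']

theorem Gate.toMatrix_one {i : W} (U : Matrix.unitaryGroup Bool ℂ) {y x : W → Bool}
    (h : ∀ k, k ≠ i → y k = x k) : (Gate.one i U).toMatrix y x = U.1 (y i) (x i) := by
  simp only [Gate.toMatrix, Matrix.of_apply]
  rw [if_pos h]

theorem Gate.toMatrix_one_eq_zero {i : W} (U : Matrix.unitaryGroup Bool ℂ) {y x : W → Bool}
    (h : ¬ ∀ k, k ≠ i → y k = x k) : (Gate.one i U).toMatrix y x = 0 := by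
  simp only [Gate.toMatrix, Matrix.of_apply]
  rw [if_neg h]

theorem Gate.toMatrix_two {i j : W} {hij : i ≠ j} (U : Matrix.unitaryGroup (Bool × Bool) ℂ)
    {y x : W → Bool} (h : ∀ k, k ≠ i → k ≠ j → y k = x k) :
    (Gate.two i j hij U).toMatrix y x = U.1 (y i, y j) (x i, x j) := by
  simp only [Gate.toMatrix, Matrix.of_apply]
  rw [if_pos h]

theorem Gate.toMatrix_two_eq_zero {i j : W} {hij : i ≠ j}
    (U : Matrix.unitaryGroup (Bool × Bool) ℂ) {y x : W → Bool}
    (h : ¬ ∀ k, k ≠ i → k ≠ j → y k = x k) : (Gate.two i j hij U).toMatrix y x = 0 := by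
  simp only [Gate.toMatrix, Matrix.of_apply]
  rw [if_neg h]

/-- The inverse gate. -/
noncomputable def Gate.inv : Gate W → Gate W
  | .one i U => .one i U⁻¹
  | .two i j h U => .two i j h U⁻¹

theorem Gate.toMatrix_inv (g : Gate W) : g.inv.toMatrix = g.toMatrixᴴ := by
  cases g with
  | one i U =>
    ext y x
    simp only [Gate.inv, Gate.toMatrix, Matrix.of_apply, Matrix.conjTranspose_apply]
    have : (∀ k, k ≠ i → y k = x k) ↔ (∀ k, k ≠ i → x k = y k) :=
      ⟨fun h k hk => (h k hk).symm, fun h k hk => (h k hk).symm⟩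
    by_cases h : ∀ k, k ≠ i → x k = y k
    · rw [if_pos h, if_pos (this.2 h)]
      rfl
    · rw [if_neg h, if_neg (fun h' => h (this.1 h'))]
      simp
  | two i j hij U =>
    ext y x
    simp only [Gate.inv, Gate.toMatrix, Matrix.of_apply, Matrix.conjTranspose_apply]
    have : (∀ k, k ≠ i → k ≠ j → y k = x k) ↔ (∀ k, k ≠ i → k ≠ j → x k = y k) :=
      ⟨fun h k hk hk' => (h k hk hk').symm, fun h k hk hk' => (h k hk hk').symm⟩
    by_cases h : ∀ k, k ≠ i → k ≠ j → x k = y k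
    · rw [if_pos h, if_pos (this.2 h)]
      rfl
    · rw [if_neg h, if_neg (fun h' => h (this.1 h'))]
      simp

variable [Fintype W] [DecidableEq W]

theorem Gate.conjTranspose_mul_self (g : Gate W) : g.toMatrixᴴ * g.toMatrix = 1 := by
  cases g with
  | one i U =>
    ext y x
    rw [Matrix.mul_apply]
    simp only [Matrix.conjTranspose_apply]
    by_cases h : ∀ k, k ≠ i → y k = x k
    · rw [sum_agree_one i x _ (fun z => star (U.1 (z i) (y i)) * U.1 (z i) (x i))
        (fun z hz => by
          rw [Gate.toMatrix_one U hz,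
            Gate.toMatrix_one U (fun k hk => (hz k hk).trans (h k hk).symm)])
        (fun z hz => by rw [Gate.toMatrix_one_eq_zero U hz, mul_zero])]
      have hU := congrFun (congrFun (Matrix.mem_unitaryGroup_iff'.1 U.2) (y i)) (x i)
      rw [Matrix.mul_apply] at hU
      simp only [Function.update_self]
      refine Eq.trans ?_ (hU.trans ?_)
      · rfl
      · by_cases hyx : y = x
        · subst hyx; exact (Matrix.one_apply_eq _).trans (Matrix.one_apply_eq _).symm
        · rw [Matrix.one_apply_ne hyx, Matrix.one_apply_ne]
          intro h'
          apply hyx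
          funext k
          by_cases hk : k = i
          · rw [hk, h']
          · exact h k hk
    · rw [Matrix.one_apply_ne (fun h' => h (fun k _ => by rw [h']))]
      apply Finset.sum_eq_zero
      intro z _
      by_cases hz : ∀ k, k ≠ i → z k = x k
      · rw [Gate.toMatrix_one_eq_zero (y := z) (x := y) U
          (fun hz' => h (fun k hk => (hz' k hk).symm.trans (hz k hk)))]
        simp
      · rw [Gate.toMatrix_one_eq_zero (y := z) (x := x) U hz, mul_zero]
  | two i j hij U =>
    ext y x
    rw [Matrix.mul_apply]
    simp only [Matrix.conjTranspose_apply]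
    by_cases h : ∀ k, k ≠ i → k ≠ j → y k = x k
    · rw [sum_agree_two i j hij x _ (fun z => star (U.1 (z i, z j) (y i, y j)) *
          U.1 (z i, z j) (x i, x j))
        (fun z hz => by
          rw [Gate.toMatrix_two U hz,
            Gate.toMatrix_two U (fun k hk hk' => (hz k hk hk').trans (h k hk hk').symm)])
        (fun z hz => by rw [Gate.toMatrix_two_eq_zero U hz, mul_zero])]
      have hU := congrFun (congrFun (Matrix.mem_unitaryGroup_iff'.1 U.2) (y i, y j)) (x i, x j)
      rw [Matrix.mul_apply] at hU
      simp only [Function.update_self, ne_eq, hij, not_false_eq_true, Function.update_of_ne]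
      refine Eq.trans ?_ (hU.trans ?_)
      · rfl
      · by_cases hyx : y = x
        · subst hyx; exact (Matrix.one_apply_eq _).trans (Matrix.one_apply_eq _).symm
        · rw [Matrix.one_apply_ne hyx, Matrix.one_apply_ne]
          intro h'
          rw [Prod.mk.injEq] at h'
          apply hyx
          funext k
          by_cases hk : k = i
          · rw [hk, h'.1]
          · by_cases hk' : k = j
            · rw [hk', h'.2]
            · exact h k hk hk'
    · rw [Matrix.one_apply_ne (fun h' => h (fun k _ _ => by rw [h']))]
      apply Finset.sum_eq_zero
      intro z _
      by_cases hz : ∀ k, k ≠ i → k ≠ j → z k = x k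
      · rw [Gate.toMatrix_two_eq_zero (y := z) (x := y) U
          (fun hz' => h (fun k hk hk' => (hz' k hk hk').symm.trans (hz k hk hk')))]
        simp
      · rw [Gate.toMatrix_two_eq_zero (y := z) (x := x) U hz, mul_zero]

/-! ### Circuits -/

theorem Circuit.toMatrix_append (C D : Circuit W) :
    Circuit.toMatrix (C ++ D) = Circuit.toMatrix D * Circuit.toMatrix C := by
  induction C with
  | nil => simp [Circuit.toMatrix]
  | cons g C ih => simp only [List.cons_append, Circuit.toMatrix, ih, Matrix.mul_assoc]

theorem Circuit.toMatrix_singleton (g : Gate W) : Circuit.toMatrix [g] = g.toMatrix := by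
  simp [Circuit.toMatrix]

theorem Circuit.conjTranspose_mul_self (C : Circuit W) :
    (Circuit.toMatrix C)ᴴ * Circuit.toMatrix C = 1 := by
  induction C with
  | nil => simp [Circuit.toMatrix]
  | cons g C ih =>
    simp only [Circuit.toMatrix, Matrix.conjTranspose_mul]
    rw [Matrix.mul_assoc, ← Matrix.mul_assoc _ (Circuit.toMatrix C), ih, Matrix.one_mul,
      g.conjTranspose_mul_self]

/-- The inverse circuit. -/
noncomputable def Circuit.inv (C : Circuit W) : Circuit W := (C.map Gate.inv).reverse

theorem Circuit.length_inv {W : Type} (C : Circuit W) : C.inv.length = C.length := by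
  simp [Circuit.inv]

theorem Circuit.toMatrix_inv (C : Circuit W) :
    Circuit.toMatrix C.inv = (Circuit.toMatrix C)ᴴ := by
  induction C with
  | nil => simp [Circuit.toMatrix, Circuit.inv]
  | cons g C ih =>
    have : Circuit.inv (g :: C) = Circuit.inv C ++ [g.inv] := by simp [Circuit.inv]
    rw [this, Circuit.toMatrix_append, ih, Circuit.toMatrix_singleton, Gate.toMatrix_inv]
    simp only [Circuit.toMatrix, Matrix.conjTranspose_mul]

/-- The computational basis state `|x⟩`. -/
def ket (x : W → Bool) : (W → Bool) → ℂ := Pi.single x 1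

theorem ket_apply (x y : W → Bool) : ket x y = if y = x then 1 else 0 := by
  simp [ket, Pi.single_apply]

/-- The action of a circuit on a state vector. -/
noncomputable def run (C : Circuit W) (v : (W → Bool) → ℂ) : (W → Bool) → ℂ :=
  (Circuit.toMatrix C).mulVec v

theorem run_append (C D : Circuit W) (v : (W → Bool) → ℂ) : run (C ++ D) v = run D (run C v) := by
  simp [run, Circuit.toMatrix_append, Matrix.mulVec_mulVec]

/-- The principle of uncomputation: to erase the result of a computation it is enough to know its
forward run. -/
theorem run_inv_run (C : Circuit W) (v : (W → Bool) → ℂ) : run C.inv (run C v) = v := by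
  simp [run, Circuit.toMatrix_inv, Matrix.mulVec_mulVec, Circuit.conjTranspose_mul_self]

theorem run_nil (v : (W → Bool) → ℂ) : run [] v = v := by
  simp [run, Circuit.toMatrix]

theorem run_smul (C : Circuit W) (c : ℂ) (v : (W → Bool) → ℂ) : run C (c • v) = c • run C v := by
  simp [run, Matrix.mulVec_smul]

theorem run_sum {ι : Type*} (C : Circuit W) (s : Finset ι) (v : ι → (W → Bool) → ℂ) :
    run C (∑ i ∈ s, v i) = ∑ i ∈ s, run C (v i) := by
  simp only [run]
  exact map_sum (Matrix.mulVecLin (Circuit.toMatrix C)) v s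

theorem run_ket_apply (C : Circuit W) (x y : W → Bool) :
    run C (ket x) y = Circuit.toMatrix C y x := by
  simp [run, ket]

/-! ### Relabelling the wires -/

/-- The gate on the image wires of an injection. -/
def Gate.map {V : Type} (f : V ↪ W) : Gate V → Gate W
  | .one i U => .one (f i) U
  | .two i j h U => .two (f i) (f j) (f.injective.ne h) U

/-- The circuit on the image wires of an injection. -/
def Circuit.map {V : Type} (f : V ↪ W) (C : Circuit V) : Circuit W := List.map (Gate.map f) C

theorem Circuit.length_map {V W : Type} (f : V ↪ W) (C : Circuit V) :
    (C.map f).length = C.length := by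
  simp [Circuit.map]

variable {V : Type}

theorem agree_off_range_iff_one (f : V ↪ W) (i : V) (y x : W → Bool) :
    (∀ k, k ≠ f i → y k = x k) ↔ (∀ k, k ∉ Set.range f → y k = x k) ∧
      ∀ k, k ≠ i → (y ∘ f) k = (x ∘ f) k := by
  constructor
  · intro h
    exact ⟨fun k hk => h k (fun h' => hk ⟨i, h'.symm⟩), fun k hk => h _ (f.injective.ne hk)⟩
  · rintro ⟨h1, h2⟩ k hk
    by_cases hr : k ∈ Set.range f
    · obtain ⟨k', rfl⟩ := hr
      exact h2 k' (fun h' => hk (by rw [h']))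
    · exact h1 k hr

theorem agree_off_range_iff_two (f : V ↪ W) (i j : V) (y x : W → Bool) :
    (∀ k, k ≠ f i → k ≠ f j → y k = x k) ↔ (∀ k, k ∉ Set.range f → y k = x k) ∧
      ∀ k, k ≠ i → k ≠ j → (y ∘ f) k = (x ∘ f) k := by
  constructor
  · intro h
    exact ⟨fun k hk => h k (fun h' => hk ⟨i, h'.symm⟩) (fun h' => hk ⟨j, h'.symm⟩),
      fun k hk hk' => h _ (f.injective.ne hk) (f.injective.ne hk')⟩
  · rintro ⟨h1, h2⟩ k hk hk'
    by_cases hr : k ∈ Set.range f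
    · obtain ⟨k', rfl⟩ := hr
      exact h2 k' (fun h' => hk (by rw [h'])) (fun h' => hk' (by rw [h']))
    · exact h1 k hr

/-- With `Gate.toMatrix_map_eq_zero`: the relabelled gate is the original one tensored with the
identity on the wires outside the range of `f`. -/
theorem Gate.toMatrix_map (f : V ↪ W) (g : Gate V) {y x : W → Bool}
    (h : ∀ k, k ∉ Set.range f → y k = x k) :
    (g.map f).toMatrix y x = g.toMatrix (y ∘ f) (x ∘ f) := by
  cases g with
  | one i U =>
    by_cases h' : ∀ k, k ≠ i → (y ∘ f) k = (x ∘ f) k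
    · rw [Gate.map, Gate.toMatrix_one U h',
        Gate.toMatrix_one U ((agree_off_range_iff_one f i y x).2 ⟨h, h'⟩)]
      rfl
    · rw [Gate.map, Gate.toMatrix_one_eq_zero U h', Gate.toMatrix_one_eq_zero U
        (fun h2 => h' ((agree_off_range_iff_one f i y x).1 h2).2)]
  | two i j hij U =>
    by_cases h' : ∀ k, k ≠ i → k ≠ j → (y ∘ f) k = (x ∘ f) k
    · rw [Gate.map, Gate.toMatrix_two U h',
        Gate.toMatrix_two U ((agree_off_range_iff_two f i j y x).2 ⟨h, h'⟩)]
      rfl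
    · rw [Gate.map, Gate.toMatrix_two_eq_zero U h', Gate.toMatrix_two_eq_zero U
        (fun h2 => h' ((agree_off_range_iff_two f i j y x).1 h2).2)]

theorem Gate.toMatrix_map_eq_zero (f : V ↪ W) (g : Gate V) {y x : W → Bool}
    (h : ¬ ∀ k, k ∉ Set.range f → y k = x k) : (g.map f).toMatrix y x = 0 := by
  cases g with
  | one i U =>
    exact Gate.toMatrix_one_eq_zero U (fun h2 => h ((agree_off_range_iff_one f i y x).1 h2).1)
  | two i j hij U =>
    exact Gate.toMatrix_two_eq_zero U (fun h2 => h ((agree_off_range_iff_two f i j y x).1 h2).1)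

theorem sum_agree_range [Fintype V] [DecidableEq V] (f : V ↪ W) (x : W → Bool)
    (F : (W → Bool) → ℂ) (G : (V → Bool) → ℂ)
    (hF : ∀ z, (∀ k, k ∉ Set.range f → z k = x k) → F z = G (z ∘ f))
    (hF' : ∀ z, (¬ ∀ k, k ∉ Set.range f → z k = x k) → F z = 0) :
    ∑ z, F z = ∑ b : V → Bool, G b := by
  symm
  apply Finset.sum_of_injOn (fun b : V → Bool => Function.extend f b x)
  · intro a _ b _ h
    funext k
    have := congrFun h (f k)
    simpa [f.injective.extend_apply] using this
  · intro a _
    simp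
  · intro z _ hz
    apply hF'
    intro h
    apply hz
    refine ⟨z ∘ f, by simp, ?_⟩
    funext k
    by_cases hk : k ∈ Set.range f
    · obtain ⟨k', rfl⟩ := hk
      simp [f.injective.extend_apply]
    · simp only
      rw [Function.extend_apply' _ _ _ hk, h k hk]
  · intro b _
    rw [hF]
    · congr 1
      funext k
      simp [f.injective.extend_apply]
    · intro k hk
      rw [Function.extend_apply' _ _ _ hk]

theorem Circuit.toMatrix_map_eq_zero (f : V ↪ W) (C : Circuit V) {y x : W → Bool}
    (h : ¬ ∀ k, k ∉ Set.range f → y k = x k) : Circuit.toMatrix (C.map f) y x = 0 := by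
  induction C generalizing y x with
  | nil =>
    exact Matrix.one_apply_ne (fun h' => h (fun k _ => by rw [h']))
  | cons g C ih =>
    change (Circuit.toMatrix (Circuit.map f C) * (g.map f).toMatrix) y x = 0
    rw [Matrix.mul_apply]
    apply Finset.sum_eq_zero
    intro z _
    by_cases hz : ∀ k, k ∉ Set.range f → z k = x k
    · rw [ih (fun hz' => h (fun k hk => (hz' k hk).trans (hz k hk))), zero_mul]
    · rw [Gate.toMatrix_map_eq_zero f g hz, mul_zero]

theorem Circuit.toMatrix_map [Fintype V] [DecidableEq V] (f : V ↪ W) (C : Circuit V)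
    {y x : W → Bool} (h : ∀ k, k ∉ Set.range f → y k = x k) :
    Circuit.toMatrix (C.map f) y x = Circuit.toMatrix C (y ∘ f) (x ∘ f) := by
  induction C generalizing y x with
  | nil =>
    change (1 : Matrix _ _ ℂ) y x = (1 : Matrix _ _ ℂ) (y ∘ f) (x ∘ f)
    by_cases hyx : y = x
    · subst hyx; simp
    · rw [Matrix.one_apply_ne hyx, Matrix.one_apply_ne]
      intro h2
      apply hyx
      funext k
      by_cases hk : k ∈ Set.range f
      · obtain ⟨k', rfl⟩ := hk
        exact congrFun h2 k'
      · exact h k hk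
  | cons g C ih =>
    change (Circuit.toMatrix (Circuit.map f C) * (g.map f).toMatrix) y x =
      (Circuit.toMatrix C * g.toMatrix) (y ∘ f) (x ∘ f)
    rw [Matrix.mul_apply, Matrix.mul_apply]
    apply sum_agree_range f x
    · intro z hz
      rw [ih (fun k hk => (h k hk).trans (hz k hk).symm), Gate.toMatrix_map f g hz]
    · intro z hz
      rw [Gate.toMatrix_map_eq_zero f g hz, mul_zero]

end Gates

/-! ### Unit complex numbers -/

/-- The unit complex number with argument `θ`. -/
noncomputable def cis (θ : ℝ) : ℂ := Complex.exp (θ * Complex.I)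

theorem cis_zero : cis 0 = 1 := by simp [cis]

theorem cis_add (a b : ℝ) : cis (a + b) = cis a * cis b := by
  simp [cis, add_mul, Complex.exp_add]

theorem star_cis (a : ℝ) : star (cis a) = cis (-a) := by
  simp [cis, ← Complex.exp_conj]

theorem star_cis_mul_cis (a : ℝ) : star (cis a) * cis a = 1 := by
  rw [star_cis, ← cis_add]; simp [cis_zero]

theorem cis_two_pi_int (k : ℤ) : cis (2 * Real.pi * k) = 1 := by
  rw [cis, Complex.exp_eq_one_iff]
  exact ⟨k, by push_cast; ring⟩

theorem cis_eq_of_sub_eq {a b : ℝ} (k : ℤ) (h : a - b = 2 * Real.pi * k) : cis a = cis b := by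
  have : a = b + 2 * Real.pi * k := by linarith
  rw [this, cis_add, cis_two_pi_int, mul_one]

theorem cis_re (a : ℝ) : (cis a).re = Real.cos a := by
  rw [cis, Complex.exp_ofReal_mul_I_re]

/-! ### Registers -/

section Registers

variable {W : Type}

/-- The number written in binary on the list of wires `l`, least significant bit first. -/
def val : List W → (W → Bool) → ℕ
  | [], _ => 0
  | w :: l, x => (x w).toNat + 2 * val l x

theorem val_lt (l : List W) (x : W → Bool) : val l x < 2 ^ l.length := by
  induction l with
  | nil => simp [val]
  | cons w l ih =>
    have : (x w).toNat ≤ 1 := Bool.toNat_le _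
    simp only [val, List.length_cons, pow_succ]
    omega

theorem val_append (l l' : List W) (x : W → Bool) :
    val (l ++ l') x = val l x + 2 ^ l.length * val l' x := by
  induction l with
  | nil => simp [val]
  | cons w l ih =>
    simp only [val, List.cons_append, ih, List.length_cons, pow_succ]
    ring

theorem val_singleton (w : W) (x : W → Bool) : val [w] x = (x w).toNat := by
  simp [val]

theorem val_congr {l : List W} {x y : W → Bool} (h : ∀ w ∈ l, x w = y w) : val l x = val l y := by
  induction l with
  | nil => rfl
  | cons w l ih =>
    simp only [val]
    rw [h w (by simp), ih (fun w' hw' => h w' (by simp [hw']))]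

theorem val_of_testBit {l : List W} {x : W → Bool} {v : ℕ}
    (h : ∀ i (hi : i < l.length), x l[i] = v.testBit i) : val l x = v % 2 ^ l.length := by
  induction l generalizing v with
  | nil => simp [val, Nat.mod_one]
  | cons w l ih =>
    have h0 := h 0 (by simp)
    have h1 := ih (v := v / 2) (fun i hi => by
      have := h (i + 1) (by simp [hi])
      rw [Nat.testBit_succ] at this
      simpa using this)
    simp only [List.getElem_cons_zero] at h0
    simp only [val, List.length_cons, h0, h1, pow_succ]
    rw [mul_comm (2 ^ l.length) 2, Nat.mod_mul, Nat.testBit_zero]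
    rcases Nat.mod_two_eq_zero_or_one v with h2 | h2 <;> simp [h2]

theorem eq_of_val_eq {l : List W} {x y : W → Bool} (h : val l x = val l y) :
    ∀ w ∈ l, x w = y w := by
  induction l with
  | nil => simp
  | cons w l ih =>
    simp only [val] at h
    have h1 : (x w).toNat ≤ 1 := Bool.toNat_le _
    have h2 : (y w).toNat ≤ 1 := Bool.toNat_le _
    intro w' hw'
    rcases List.mem_cons.1 hw' with rfl | hw'
    · have h3 : (x w').toNat = (y w').toNat := by omega
      revert h3
      cases x w' <;> cases y w' <;> simp
    · exact ih (by omega) w' hw'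

theorem val_eq_zero_iff {l : List W} {x : W → Bool} : val l x = 0 ↔ ∀ w ∈ l, x w = false := by
  induction l with
  | nil => simp [val]
  | cons w l ih => simp [val, ih]

theorem exists_val_eq [DecidableEq W] {l : List W} (hl : l.Nodup) (x : W → Bool) {v : ℕ}
    (hv : v < 2 ^ l.length) : ∃ z : W → Bool, (∀ k, k ∉ l → z k = x k) ∧ val l z = v := by
  refine ⟨fun k => if k ∈ l then v.testBit (l.idxOf k) else x k, fun k hk => by simp [hk], ?_⟩
  rw [val_of_testBit (v := v), Nat.mod_eq_of_lt hv]
  intro i hi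
  simp [hl.idxOf_getElem]

/-! ### Diagonal circuits -/

/-- The single-qubit phase gate. -/
noncomputable def phaseGate (w : W) (θ : ℝ) : Gate W :=
  .one w ⟨Matrix.diagonal fun b => cis (θ * b.toNat), by
    rw [Matrix.mem_unitaryGroup_iff', Matrix.star_eq_conjTranspose,
      Matrix.diagonal_conjTranspose, Matrix.diagonal_mul_diagonal, ← Matrix.diagonal_one]
    congr 1
    funext b
    exact star_cis_mul_cis _⟩

open Classical in
/-- The controlled phase gate on two distinct qubits. -/
noncomputable def cphase (w v : W) (θ : ℝ) : Circuit W :=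
  if h : w ≠ v then [.two w v h ⟨Matrix.diagonal fun b => cis (θ * (b.1.toNat * b.2.toNat)), by
    rw [Matrix.mem_unitaryGroup_iff', Matrix.star_eq_conjTranspose,
      Matrix.diagonal_conjTranspose, Matrix.diagonal_mul_diagonal, ← Matrix.diagonal_one]
    congr 1
    funext b
    exact star_cis_mul_cis _⟩] else []

/-- The phase `θ · x_w · val l x`. -/
noncomputable def phaseRow (w : W) : ℝ → List W → Circuit W
  | _, [] => []
  | θ, v :: l => cphase w v θ ++ phaseRow w (2 * θ) l

/-- The phase `θ · val l x · val l' x`. -/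
noncomputable def bphase : ℝ → List W → List W → Circuit W
  | _, [], _ => []
  | θ, w :: l, l' => phaseRow w θ l' ++ bphase (2 * θ) l l'

/-- The phase `θ · val l x`. -/
noncomputable def lphase : ℝ → List W → Circuit W
  | _, [] => []
  | θ, w :: l => phaseGate w θ :: lphase (2 * θ) l

theorem length_cphase_le (w v : W) (θ : ℝ) : (cphase w v θ).length ≤ 1 := by
  unfold cphase
  split_ifs <;> simp

theorem length_phaseRow_le (w : W) (θ : ℝ) (l : List W) :
    (phaseRow w θ l).length ≤ l.length := by
  induction l generalizing θ with
  | nil => simp [phaseRow]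
  | cons v l ih =>
    have h1 := ih (2 * θ)
    have h2 := length_cphase_le w v θ
    simp only [phaseRow, List.length_append, List.length_cons]
    omega

theorem length_bphase_le (θ : ℝ) (l l' : List W) :
    (bphase θ l l').length ≤ l.length * l'.length := by
  induction l generalizing θ with
  | nil => simp [bphase]
  | cons w l ih =>
    have h1 := ih (2 * θ)
    have h2 := length_phaseRow_le w θ l'
    simp only [bphase, List.length_append, List.length_cons, add_mul, one_mul]
    omega

theorem length_lphase (θ : ℝ) (l : List W) : (lphase θ l).length = l.length := by
  induction l generalizing θ with
  | nil => simp [lphase]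
  | cons w l ih => simp [lphase, ih]

variable [Fintype W] [DecidableEq W]

theorem toMatrix_phaseGate (w : W) (θ : ℝ) :
    (phaseGate w θ).toMatrix = Matrix.diagonal fun x => cis (θ * (x w).toNat) := by
  ext y x
  by_cases h : ∀ k, k ≠ w → y k = x k
  · rw [phaseGate, Gate.toMatrix_one _ h]
    by_cases hyx : y = x
    · subst hyx; simp
    · have : y w ≠ x w := by
        intro h'
        apply hyx
        funext k
        by_cases hk : k = w
        · rw [hk, h']
        · exact h k hk
      simp [Matrix.diagonal_apply_ne _ hyx, Matrix.diagonal_apply_ne _ this]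
  · rw [phaseGate, Gate.toMatrix_one_eq_zero _ h, Matrix.diagonal_apply_ne]
    rintro rfl
    exact h fun _ _ => rfl

theorem toMatrix_cphase {w v : W} (hwv : w ≠ v) (θ : ℝ) :
    Circuit.toMatrix (cphase w v θ) =
      Matrix.diagonal fun x => cis (θ * ((x w).toNat * (x v).toNat)) := by
  rw [cphase, dif_pos hwv, Circuit.toMatrix_singleton]
  ext y x
  by_cases h : ∀ k, k ≠ w → k ≠ v → y k = x k
  · rw [Gate.toMatrix_two _ h]
    by_cases hyx : y = x
    · subst hyx; simp
    · have : (y w, y v) ≠ (x w, x v) := by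
        intro h'
        rw [Prod.mk.injEq] at h'
        apply hyx
        funext k
        by_cases hk : k = w
        · rw [hk, h'.1]
        · by_cases hk' : k = v
          · rw [hk', h'.2]
          · exact h k hk hk'
      simp only
      rw [Matrix.diagonal_apply_ne _ hyx]
      exact Matrix.diagonal_apply_ne _ this
  · rw [Gate.toMatrix_two_eq_zero _ h, Matrix.diagonal_apply_ne]
    rintro rfl
    exact h fun _ _ _ => rfl

theorem toMatrix_phaseRow (w : W) (θ : ℝ) {l : List W} (hw : w ∉ l) :
    Circuit.toMatrix (phaseRow w θ l) =
      Matrix.diagonal fun x => cis (θ * ((x w).toNat * val l x)) := by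
  induction l generalizing θ with
  | nil => simp [phaseRow, Circuit.toMatrix, val, cis_zero]
  | cons v l ih =>
    rw [List.mem_cons, not_or] at hw
    rw [phaseRow, Circuit.toMatrix_append, ih _ hw.2, toMatrix_cphase hw.1,
      Matrix.diagonal_mul_diagonal]
    congr 1
    funext x
    rw [← cis_add]
    congr 1
    simp only [val]
    push_cast
    ring

theorem toMatrix_bphase (θ : ℝ) {l l' : List W} (hl : l.Disjoint l') :
    Circuit.toMatrix (bphase θ l l') =
      Matrix.diagonal fun x => cis (θ * (val l x * val l' x)) := by
  induction l generalizing θ with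
  | nil => simp [bphase, Circuit.toMatrix, val, cis_zero]
  | cons w l ih =>
    rw [List.disjoint_cons_left] at hl
    rw [bphase, Circuit.toMatrix_append, ih _ hl.2, toMatrix_phaseRow _ _ hl.1,
      Matrix.diagonal_mul_diagonal]
    congr 1
    funext x
    rw [← cis_add]
    congr 1
    simp only [val]
    push_cast
    ring

theorem toMatrix_lphase (θ : ℝ) (l : List W) :
    Circuit.toMatrix (lphase θ l) = Matrix.diagonal fun x => cis (θ * val l x) := by
  induction l generalizing θ with
  | nil => simp [lphase, Circuit.toMatrix, val, cis_zero]
  | cons w l ih =>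
    simp only [lphase, Circuit.toMatrix]
    rw [ih, toMatrix_phaseGate, Matrix.diagonal_mul_diagonal]
    congr 1
    funext x
    rw [← cis_add]
    congr 1
    simp only [val]
    push_cast
    ring

theorem run_of_diagonal {C : Circuit W} {d : (W → Bool) → ℂ}
    (hC : Circuit.toMatrix C = Matrix.diagonal d) (v : (W → Bool) → ℂ) :
    run C v = fun y => d y * v y := by
  funext y
  rw [run, hC, Matrix.mulVec_diagonal]

theorem run_ket_of_diagonal {C : Circuit W} {d : (W → Bool) → ℂ}
    (hC : Circuit.toMatrix C = Matrix.diagonal d) (x : W → Bool) :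
    run C (ket x) = d x • ket x := by
  rw [run_of_diagonal hC]
  funext y
  by_cases h : y = x
  · subst h; simp
  · simp [ket_apply, h]

/-! ### The quantum Fourier transform of order `2 ^ m` -/

/-- The Hadamard gate. -/
noncomputable def hadamard (w : W) : Gate W :=
  .one w ⟨Matrix.of fun a b => ((√2)⁻¹ : ℝ) * cis (Real.pi * (a.toNat * b.toNat)), by
    have hs : (((√2)⁻¹ : ℝ) : ℂ) * ((√2)⁻¹ : ℝ) = 1 / 2 := by
      rw [← Complex.ofReal_mul, ← mul_inv, Real.mul_self_sqrt (by norm_num)]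
      norm_num
    have hpi : cis Real.pi = -1 := by simp [cis]
    have hpi' : cis (-Real.pi) = -1 := by
      rw [← star_cis, hpi]; simp
    rw [Matrix.mem_unitaryGroup_iff', Matrix.star_eq_conjTranspose]
    ext a b
    rw [Matrix.mul_apply]
    have key : ∀ j : Bool, (Matrix.of fun a b : Bool =>
        (((√2)⁻¹ : ℝ) : ℂ) * cis (Real.pi * (a.toNat * b.toNat)))ᴴ a j *
        (Matrix.of fun a b : Bool =>
        (((√2)⁻¹ : ℝ) : ℂ) * cis (Real.pi * (a.toNat * b.toNat))) j b =
        1 / 2 * (cis (-(Real.pi * (j.toNat * a.toNat))) * cis (Real.pi * (j.toNat * b.toNat))) := by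
      intro j
      rw [← hs, Matrix.conjTranspose_apply, Matrix.of_apply, Matrix.of_apply, star_mul, star_cis]
      simp only [RCLike.star_def, Complex.conj_ofReal]
      ring
    simp only [key, Fintype.sum_bool]
    cases a <;> cases b <;> simp [cis_zero, hpi, hpi'] <;> norm_num⟩

/-- The quantum Fourier transform of order `2 ^ l.length` on the register `l`; the result is
written on the reversed register. -/
noncomputable def qftCircuit : List W → Circuit W
  | [] => []
  | w :: l => qftCircuit l ++
      (phaseRow w (2 * Real.pi / 2 ^ (l.length + 1)) l.reverse ++ [hadamard w])

theorem length_qftCircuit_le {W : Type} (l : List W) : (qftCircuit l).length ≤ l.length ^ 2 := by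
  induction l with
  | nil => simp [qftCircuit]
  | cons w l ih =>
    have h := length_phaseRow_le w (2 * Real.pi / 2 ^ (l.length + 1)) l.reverse
    simp only [qftCircuit, List.length_append, List.length_cons, List.length_nil,
      List.length_reverse] at h ⊢
    nlinarith

theorem toMatrix_qftCircuit_cons {w : W} {l : List W} (hw : w ∉ l) (y x : W → Bool) :
    Circuit.toMatrix (qftCircuit (w :: l)) y x = ∑ z, (hadamard w).toMatrix y z *
      (cis (2 * Real.pi / 2 ^ (l.length + 1) * ((z w).toNat * val l.reverse z)) *
        Circuit.toMatrix (qftCircuit l) z x) := by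
  rw [qftCircuit, Circuit.toMatrix_append, Circuit.toMatrix_append, Circuit.toMatrix_singleton,
    toMatrix_phaseRow _ _ (by simpa using hw), Matrix.mul_assoc, Matrix.mul_apply]
  simp only [Matrix.diagonal_mul]

theorem toMatrix_qftCircuit_eq_zero {l : List W} (hl : l.Nodup) {y x : W → Bool}
    (h : ¬ ∀ k, k ∉ l → y k = x k) : Circuit.toMatrix (qftCircuit l) y x = 0 := by
  induction l generalizing y x with
  | nil =>
    exact Matrix.one_apply_ne (fun h' => h (fun k _ => by rw [h']))
  | cons w l ih =>
    rw [List.nodup_cons] at hl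
    rw [toMatrix_qftCircuit_cons hl.1]
    apply Finset.sum_eq_zero
    intro z _
    by_cases hz : ∀ k, k ≠ w → y k = z k
    · rw [ih hl.2, mul_zero, mul_zero]
      intro hz'
      apply h
      intro k hk
      rw [List.mem_cons, not_or] at hk
      rw [hz k hk.1, hz' k hk.2]
    · rw [hadamard, Gate.toMatrix_one_eq_zero _ hz, zero_mul]

/-- Put `m = l.length` for the tail `l`. With input `x_w + 2 X` and reversed output `Y + 2 ^ m y_w`,
the product is `2 X Y + x_w Y + 2 ^ m x_w y_w` modulo `2 ^ (m + 1)`. The three terms are the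
recursive transform, the row of controlled phases and the Hadamard gate. Reading the output in
reversed order makes swaps unnecessary. -/
theorem toMatrix_qftCircuit {l : List W} (hl : l.Nodup) {y x : W → Bool}
    (h : ∀ k, k ∉ l → y k = x k) :
    Circuit.toMatrix (qftCircuit l) y x = (((√2)⁻¹ ^ l.length : ℝ) : ℂ) *
      cis (2 * Real.pi * (val l x * val l.reverse y) / 2 ^ l.length) := by
  induction l generalizing y x with
  | nil =>
    have : y = x := funext fun k => h k (by simp)
    subst this
    simp [qftCircuit, Circuit.toMatrix, val, cis_zero]
  | cons w l ih =>
    rw [List.nodup_cons] at hl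
    rw [toMatrix_qftCircuit_cons hl.1]
    have hz0 : ∀ k, k ∉ l → Function.update y w (x w) k = x k := by
      intro k hk
      by_cases hkw : k = w
      · subst hkw; simp
      · rw [Function.update_of_ne hkw]
        exact h k (by simp [hk, hkw])
    have hrev : val l.reverse (Function.update y w (x w)) = val l.reverse y := by
      apply val_congr
      intro w' hw'
      rw [Function.update_of_ne]
      rintro rfl
      exact hl.1 (by simpa using hw')
    -- The only intermediate state that contributes: `l` already holds its output bits, while `w`
    -- still holds its input bit.
    rw [Finset.sum_eq_single (Function.update y w (x w))]
    · rw [ih hl.2 hz0, hadamard, Gate.toMatrix_one _ (by intro k hk; simp [hk])]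
      simp only [Matrix.of_apply, Function.update_self, hrev, List.reverse_cons, val_append,
        val, List.length_cons, List.length_reverse, mul_zero, add_zero]
      rw [pow_succ (√2)⁻¹, Complex.ofReal_mul]
      have e : cis (2 * Real.pi * (((x w).toNat + 2 * val l x : ℕ) *
          (val l.reverse y + 2 ^ l.length * (y w).toNat : ℕ)) / 2 ^ (l.length + 1)) =
          cis (Real.pi * ((y w).toNat * (x w).toNat)) *
          (cis (2 * Real.pi / 2 ^ (l.length + 1) * ((x w).toNat * val l.reverse y)) *
          cis (2 * Real.pi * (val l x * val l.reverse y) / 2 ^ l.length)) := by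
        rw [← cis_add, ← cis_add]
        -- The cross term `2 X * 2 ^ m y_w` is a whole number of turns.
        apply cis_eq_of_sub_eq (val l x * (y w).toNat : ℕ)
        push_cast
        rw [pow_succ]
        field_simp
        ring
      rw [e]
      ring
    · intro z _ hz
      by_cases hzy : ∀ k, k ≠ w → y k = z k
      · rw [toMatrix_qftCircuit_eq_zero hl.2, mul_zero, mul_zero]
        intro h'
        apply hz
        funext k
        by_cases hkw : k = w
        · subst hkw
          simp [h' k hl.1]
        · rw [Function.update_of_ne hkw, hzy k hkw]
      · rw [hadamard, Gate.toMatrix_one_eq_zero _ hzy, zero_mul]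
    · simp

/-! ### Addition in the Fourier basis -/

/-- Addition of `c · val l' x` to the register `l`, modulo `2 ^ l.length`. -/
noncomputable def addReg (c : ℤ) (l l' : List W) : Circuit W :=
  qftCircuit l ++ (bphase (2 * Real.pi * c / 2 ^ l.length) l.reverse l' ++ (qftCircuit l).inv)

/-- Addition of the constant `c` to the register `l`, modulo `2 ^ l.length`. -/
noncomputable def addConst (c : ℤ) (l : List W) : Circuit W :=
  qftCircuit l ++ (lphase (2 * Real.pi * c / 2 ^ l.length) l.reverse ++ (qftCircuit l).inv)

theorem length_addReg_le {W : Type} (c : ℤ) (l l' : List W) :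
    (addReg c l l').length ≤ 2 * l.length ^ 2 + l.length * l'.length := by
  have h1 := length_qftCircuit_le l
  have h2 := length_bphase_le (2 * Real.pi * c / 2 ^ l.length) l.reverse l'
  simp only [addReg, List.length_append, Circuit.length_inv, List.length_reverse] at h2 ⊢
  omega

theorem length_addConst_le {W : Type} (c : ℤ) (l : List W) :
    (addConst c l).length ≤ 2 * l.length ^ 2 + l.length := by
  have h1 := length_qftCircuit_le l
  have h2 := length_lphase (2 * Real.pi * c / 2 ^ l.length) l.reverse
  simp only [addConst, List.length_append, Circuit.length_inv, List.length_reverse] at h2 ⊢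
  omega

theorem run_conj_diagonal {C D : Circuit W} {d : (W → Bool) → ℂ}
    (hD : Circuit.toMatrix D = Matrix.diagonal d) {x x' : W → Bool}
    (h : ∀ y, d y * run C (ket x) y = run C (ket x') y) :
    run (C ++ (D ++ C.inv)) (ket x) = ket x' := by
  rw [run_append, run_append, run_of_diagonal hD, funext h, run_inv_run]

/-- The shift theorem: translation by `s` multiplies the Fourier coefficient at `t` by a phase that
does not involve `X`. The phases have period `2 ^ m`, so a congruence suffices. -/
theorem cis_shift {m : ℕ} {X X' : ℕ} {s : ℤ} (h : (X' : ℤ) ≡ X + s [ZMOD 2 ^ m]) (t : ℕ) :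
    cis (2 * Real.pi * s / 2 ^ m * t) * cis (2 * Real.pi * (X * t) / 2 ^ m) =
      cis (2 * Real.pi * (X' * t) / 2 ^ m) := by
  rw [← cis_add]
  obtain ⟨k, hk⟩ := h.dvd
  have hk' : (X : ℝ) + s - X' = 2 ^ m * k := by exact_mod_cast hk
  apply cis_eq_of_sub_eq (k * t)
  push_cast
  have : (X : ℝ) = 2 ^ m * k + X' - s := by linarith
  rw [this]
  field_simp
  ring

/-- Addition in the Fourier basis. The diagonal `d` is constrained only on states that agree with
`x` off `l`, so that the shift may be read from other registers. -/
theorem run_qft_shift {l : List W} (hl : l.Nodup) {x x' : W → Bool}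
    (hx : ∀ k, k ∉ l → x' k = x k) {d : (W → Bool) → ℂ} {s : ℤ}
    (hv : (val l x' : ℤ) ≡ val l x + s [ZMOD 2 ^ l.length])
    (hd : ∀ y, (∀ k, k ∉ l → y k = x k) →
      d y = cis (2 * Real.pi * s / 2 ^ l.length * val l.reverse y)) (y : W → Bool) :
    d y * run (qftCircuit l) (ket x) y = run (qftCircuit l) (ket x') y := by
  rw [run_ket_apply, run_ket_apply]
  by_cases h : ∀ k, k ∉ l → y k = x k
  · rw [toMatrix_qftCircuit hl h,
      toMatrix_qftCircuit hl (fun k hk => (h k hk).trans (hx k hk).symm), hd y h, ← cis_shift hv]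
    ring
  · rw [toMatrix_qftCircuit_eq_zero hl h, mul_zero, toMatrix_qftCircuit_eq_zero hl]
    exact fun h' => h (fun k hk => (h' k hk).trans (hx k hk))

theorem run_addReg {c : ℤ} {l l' : List W} (hl : l.Nodup) (hll' : l.Disjoint l')
    {x x' : W → Bool} (hx : ∀ k, k ∉ l → x' k = x k)
    (hv : (val l x' : ℤ) ≡ val l x + c * val l' x [ZMOD 2 ^ l.length]) :
    run (addReg c l l') (ket x) = ket x' := by
  apply run_conj_diagonal (toMatrix_bphase _ (by simpa [List.disjoint_left] using hll'))
  apply run_qft_shift hl hx hv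
  intro y hy
  have : val l' y = val l' x := val_congr fun w hw => hy w fun hw' => hll' hw' hw
  rw [this]
  congr 1
  push_cast
  ring

theorem run_addConst {c : ℤ} {l : List W} (hl : l.Nodup)
    {x x' : W → Bool} (hx : ∀ k, k ∉ l → x' k = x k)
    (hv : (val l x' : ℤ) ≡ val l x + c [ZMOD 2 ^ l.length]) :
    run (addConst c l) (ket x) = ket x' :=
  run_conj_diagonal (toMatrix_lphase _ _) (run_qft_shift hl hx hv fun _ _ => rfl)

end Registers

/-! ### Register files -/

section RegisterFile

variable {ι : Type} {size : ι → ℕ}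

/-- The basis state of a register file in which register `r` holds `f r`. -/
def cfg (f : ι → ℕ) : (Σ r, Fin (size r)) → Bool := fun w => (f w.1).testBit w.2

/-- The wires of the register `r`. -/
def reg (size : ι → ℕ) (r : ι) : List (Σ r, Fin (size r)) :=
  (List.finRange (size r)).map (Sigma.mk r)

/-- The wires of several registers, read as one register. -/
def regs (size : ι → ℕ) (L : List ι) : List (Σ r, Fin (size r)) := L.flatMap (reg size)

theorem length_reg (r : ι) : (reg size r).length = size r := by simp [reg]

theorem mem_reg {r : ι} {w : Σ r, Fin (size r)} : w ∈ reg size r ↔ w.1 = r := by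
  obtain ⟨s, i⟩ := w
  constructor
  · intro h
    simp only [reg, List.mem_map] at h
    obtain ⟨j, -, hj⟩ := h
    exact (congrArg Sigma.fst hj).symm
  · rintro rfl
    simp [reg]

theorem nodup_reg (r : ι) : (reg size r).Nodup :=
  (List.nodup_finRange _).map sigma_mk_injective

theorem mem_regs {L : List ι} {w : Σ r, Fin (size r)} : w ∈ regs size L ↔ w.1 ∈ L := by
  simp [regs, mem_reg]

theorem nodup_regs {L : List ι} (hL : L.Nodup) : (regs size L).Nodup := by
  rw [regs, List.nodup_flatMap]
  refine ⟨fun r _ => nodup_reg r, hL.imp ?_⟩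
  intro a b hab
  rw [Function.onFun, List.disjoint_left]
  intro w hw hw'
  rw [mem_reg] at hw hw'
  exact hab (hw.symm.trans hw')

theorem disjoint_regs {L L' : List ι} (h : ∀ r ∈ L, r ∉ L') :
    (regs size L).Disjoint (regs size L') := by
  rw [List.disjoint_left]
  intro w hw hw'
  rw [mem_regs] at hw hw'
  exact h _ hw hw'

theorem length_regs (L : List ι) : (regs size L).length = (L.map size).sum := by
  simp [regs, List.length_flatMap, length_reg]

theorem regs_singleton (r : ι) : regs size [r] = reg size r := by simp [regs]

theorem regs_cons (r : ι) (L : List ι) : regs size (r :: L) = reg size r ++ regs size L := by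
  simp [regs]

theorem val_reg_cfg (f : ι → ℕ) (r : ι) : val (reg size r) (cfg f) = f r % 2 ^ size r := by
  conv_rhs => rw [← length_reg (size := size) r]
  apply val_of_testBit
  intro i hi
  have : (reg size r)[i] = ⟨r, ⟨i, by simpa [length_reg] using hi⟩⟩ := by simp [reg]
  rw [this, cfg]

theorem val_regs_cons_cfg (f : ι → ℕ) (r : ι) (L : List ι) :
    val (regs size (r :: L)) (cfg f) =
      f r % 2 ^ size r + 2 ^ size r * val (regs size L) (cfg f) := by
  rw [regs_cons, val_append, val_reg_cfg, length_reg]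

theorem val_regs_nil (x : (Σ r, Fin (size r)) → Bool) : val (regs size []) x = 0 := rfl

theorem cfg_agree {f f' : ι → ℕ} {L : List ι} (h : ∀ r, r ∉ L → f' r = f r) :
    ∀ k : Σ r, Fin (size r), k ∉ regs size L → cfg f' k = cfg f k := by
  intro k hk
  rw [mem_regs] at hk
  simp [cfg, h _ hk]

theorem cfg_val (z : (Σ r, Fin (size r)) → Bool) : cfg (fun r => val (reg size r) z) = z := by
  funext ⟨r, i⟩
  have : val (reg size r) (cfg fun r => val (reg size r) z) = val (reg size r) z := by
    rw [val_reg_cfg, Nat.mod_eq_of_lt]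
    exact (val_lt _ _).trans_eq (by rw [length_reg])
  exact eq_of_val_eq this _ (mem_reg.2 rfl)

theorem cfg_eq_iff {f f' : ι → ℕ} (hf : ∀ r, f r < 2 ^ size r) (hf' : ∀ r, f' r < 2 ^ size r) :
    (cfg f : (Σ r, Fin (size r)) → Bool) = cfg f' ↔ f = f' := by
  constructor
  · intro h
    funext r
    rw [← Nat.mod_eq_of_lt (hf r), ← Nat.mod_eq_of_lt (hf' r), ← val_reg_cfg, ← val_reg_cfg, h]
  · rintro rfl; rfl

variable [Fintype ι] [DecidableEq ι]

theorem run_addReg_cfg {c : ℤ} {L : List ι} {l' : List (Σ r, Fin (size r))} (hL : L.Nodup)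
    (hLl' : (regs size L).Disjoint l') {f f' : ι → ℕ} (hf : ∀ r, r ∉ L → f' r = f r)
    (hv : (val (regs size L) (cfg f') : ℤ) ≡ val (regs size L) (cfg f) + c * val l' (cfg f)
      [ZMOD 2 ^ (L.map size).sum]) :
    run (addReg c (regs size L) l') (ket (cfg f)) = ket (cfg f') := by
  apply run_addReg (nodup_regs hL) hLl' (cfg_agree hf)
  rw [length_regs]
  exact hv

theorem run_addConst_cfg {c : ℤ} {L : List ι} (hL : L.Nodup)
    {f f' : ι → ℕ} (hf : ∀ r, r ∉ L → f' r = f r)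
    (hv : (val (regs size L) (cfg f') : ℤ) ≡ val (regs size L) (cfg f) + c
      [ZMOD 2 ^ (L.map size).sum]) :
    run (addConst c (regs size L)) (ket (cfg f)) = ket (cfg f') := by
  apply run_addConst (nodup_regs hL) (cfg_agree hf)
  rw [length_regs]
  exact hv

/-- All phases are trivial at `0`, and the reversed output order is invisible in a uniform
superposition. -/
theorem run_qft_zero (f : ι → ℕ) (r : ι) (hr : f r = 0) :
    run (qftCircuit (reg size r)) (ket (cfg f)) = ∑ v ∈ Finset.range (2 ^ size r),
      (((√2)⁻¹ ^ size r : ℝ) : ℂ) • ket (cfg (Function.update f r v)) := by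
  funext y
  rw [run_ket_apply, Finset.sum_apply]
  simp only [Pi.smul_apply, smul_eq_mul, ket_apply]
  have hval : val (reg size r) (cfg f) = 0 := by rw [val_reg_cfg, hr, Nat.zero_mod]
  by_cases h : ∀ k, k ∉ reg size r → y k = cfg f k
  · rw [toMatrix_qftCircuit (nodup_reg r) h, length_reg, hval,
      Finset.sum_eq_single (val (reg size r) y)]
    · have : y = cfg (Function.update f r (val (reg size r) y)) := by
        funext ⟨s, i⟩
        by_cases hs : s = r
        · subst hs
          have : val (reg size s) y =
              val (reg size s) (cfg (Function.update f s (val (reg size s) y))) := by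
            rw [val_reg_cfg, Function.update_self, Nat.mod_eq_of_lt]
            exact (val_lt _ _).trans_eq (by rw [length_reg])
          exact eq_of_val_eq this _ (mem_reg.2 rfl)
        · rw [h _ (by simpa [mem_reg] using hs)]
          simp [cfg, hs]
      rw [if_pos this]
      simp [cis_zero]
    · intro v hv hne
      rw [if_neg, mul_zero]
      rintro rfl
      rw [Finset.mem_range] at hv
      apply hne
      rw [val_reg_cfg, Function.update_self, Nat.mod_eq_of_lt hv]
    · intro hn
      exact absurd (Finset.mem_range.2 ((val_lt _ _).trans_eq (by rw [length_reg]))) hn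
  · rw [toMatrix_qftCircuit_eq_zero (nodup_reg r) h]
    symm
    apply Finset.sum_eq_zero
    intro v _
    rw [if_neg, mul_zero]
    rintro rfl
    apply h
    rintro ⟨s, i⟩ hk
    rw [mem_reg] at hk
    simp only at hk
    simp [cfg, hk]

end RegisterFile

/-- The registers of the circuit for the Fourier transform of order `N`. -/
inductive Reg : Type
  | X | B | V | Y | K | T | P | S | A | F
  deriving DecidableEq

instance : Fintype Reg := ⟨{.X, .B, .V, .Y, .K, .T, .P, .S, .A, .F}, by intro r; cases r <;> decide⟩

/-! ### The classical part of the Fourier transform of order `N` -/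

/-- The numbers of qubits of the registers. -/
def rsize (ℓ : ℕ) : Reg → ℕ
  | .X => ℓ
  | .B => ℓ + 1
  | .V => ℓ
  | .Y => ℓ + 1
  | .K => ℓ
  | .T => 4
  | .P => ℓ + 4
  | .S => ℓ + 4
  | .A => 1
  | .F => 1

/-- The contents of the registers. -/
def st (x b v y k t p s a f : ℕ) : Reg → ℕ
  | .X => x
  | .B => b
  | .V => v
  | .Y => y
  | .K => k
  | .T => t
  | .P => p
  | .S => s
  | .A => a
  | .F => f

/-- The basis state with the given contents of the registers. -/
noncomputable def ketSt (ℓ x b v y k t p s a f : ℕ) : ((Σ r, Fin (rsize ℓ r)) → Bool) → ℂ :=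
  ket (cfg (st x b v y k t p s a f))

/-- An integer near `v · 2 ^ (ℓ + 4) / N`, modulo `2 ^ (ℓ + 4)`. -/
def approxMul (ℓ N v : ℕ) : ℕ := 2 ^ (ℓ + 4 + (ℓ + 4)) / N * v / 2 ^ (ℓ + 4) % 2 ^ (ℓ + 4)

/-- The integer nearest to `k · N / 2 ^ (ℓ + 4)`. -/
def roundBack (ℓ N k : ℕ) : ℕ := (N * k + 2 ^ (ℓ + 3)) / 2 ^ (ℓ + 4) % 2 ^ (ℓ + 4)

/-- What remains of `v` after subtracting the number recovered from `approxMul ℓ N v`. -/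
def residue (ℓ N v : ℕ) : ℕ :=
  -- The term `2 ^ (ℓ + 4)` vanishes modulo `2 ^ ℓ`; it keeps the subtraction of natural numbers
  -- from truncating.
  (v + (2 ^ (ℓ + 4) - roundBack ℓ N (approxMul ℓ N v))) % 2 ^ ℓ

/-- Move the content of `X` to the register `R`. -/
noncomputable def moveCircuit (ℓ : ℕ) (R : Reg) : Circuit (Σ r, Fin (rsize ℓ r)) :=
  addReg 1 (regs (rsize ℓ) [R]) (regs (rsize ℓ) [.X]) ++
    addReg (-1) (regs (rsize ℓ) [.X]) (regs (rsize ℓ) [R])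

/-- Replace `v` by `approxMul ℓ N v`. -/
noncomputable def approxCircuit (ℓ N : ℕ) : Circuit (Σ r, Fin (rsize ℓ r)) :=
  -- `S` is the high half of `[P, S]`, so after a multiplication into `[P, S]` it holds the quotient
  -- by `2 ^ (ℓ + 4)`. This is copied to `[T, K]` and the product is erased. Then `[T, K]` is
  -- multiplied by `N`, half of `2 ^ (ℓ + 4)` is added for rounding, the quotient in `S` is
  -- subtracted from `V`, and the work is erased again.
  addReg (2 ^ (ℓ + 4 + (ℓ + 4)) / N : ℕ) (regs (rsize ℓ) [.P, .S]) (regs (rsize ℓ) [.V]) ++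
  (addReg 1 (regs (rsize ℓ) [.T, .K]) (regs (rsize ℓ) [.S]) ++
  (addReg (-(2 ^ (ℓ + 4 + (ℓ + 4)) / N : ℕ)) (regs (rsize ℓ) [.P, .S]) (regs (rsize ℓ) [.V]) ++
  (addReg N (regs (rsize ℓ) [.P, .S]) (regs (rsize ℓ) [.T, .K]) ++
  (addConst (2 ^ (ℓ + 3)) (regs (rsize ℓ) [.P, .S]) ++
  (addReg (-1) (regs (rsize ℓ) [.V]) (regs (rsize ℓ) [.S]) ++
  (addConst (-2 ^ (ℓ + 3)) (regs (rsize ℓ) [.P, .S]) ++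
  addReg (-N) (regs (rsize ℓ) [.P, .S]) (regs (rsize ℓ) [.T, .K])))))))

theorem val_PS (ℓ x b v y k t p a f : ℕ) :
    val (regs (rsize ℓ) [.P, .S]) (cfg (st x b v y k t (p % 2 ^ (ℓ + 4))
      (p / 2 ^ (ℓ + 4) % 2 ^ (ℓ + 4)) a f)) = p % 2 ^ (ℓ + 4 + (ℓ + 4)) := by
  simp only [val_regs_cons_cfg, val_regs_nil]
  simp only [st, rsize, Nat.mod_mod, mul_zero, add_zero]
  rw [pow_add _ (ℓ + 4), Nat.mod_mul]

theorem val_PS_zero (ℓ x b v y k t a f : ℕ) :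
    val (regs (rsize ℓ) [.P, .S]) (cfg (st x b v y k t 0 0 a f)) = 0 := by
  simp only [val_regs_cons_cfg, val_regs_nil]
  simp [st]

theorem val_TK (ℓ x b v y k p s a f : ℕ) :
    val (regs (rsize ℓ) [.T, .K]) (cfg (st x b v y (k / 16) (k % 16) p s a f)) =
      k % 2 ^ (ℓ + 4) := by
  simp only [val_regs_cons_cfg, val_regs_nil]
  simp only [st, rsize, mul_zero, add_zero]
  rw [pow_add _ ℓ, mul_comm (2 ^ ℓ), Nat.mod_mul]
  norm_num

theorem val_one_reg (ℓ x b v y k t p s a f : ℕ) (R : Reg) :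
    val (regs (rsize ℓ) [R]) (cfg (st x b v y k t p s a f)) =
      st x b v y k t p s a f R % 2 ^ rsize ℓ R := by
  rw [regs_singleton, val_reg_cfg]

theorem run_moveCircuit_B (ℓ x a f : ℕ) (hx : x < 2 ^ ℓ) :
    run (moveCircuit ℓ .B) (ketSt ℓ x 0 0 0 0 0 0 0 a f) = ketSt ℓ 0 x 0 0 0 0 0 0 a f := by
  rw [moveCircuit, run_append]
  have h1 : run (addReg 1 (regs (rsize ℓ) [.B]) (regs (rsize ℓ) [.X]))
      (ketSt ℓ x 0 0 0 0 0 0 0 a f) = ketSt ℓ x x 0 0 0 0 0 0 a f := by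
    apply run_addReg_cfg (by decide) (disjoint_regs (by decide))
    · intro r hr; cases r <;> first | rfl | exact absurd (by decide) hr
    · simp only [val_one_reg]
      simp [st, rsize, Nat.mod_eq_of_lt hx, Int.ModEq]
  rw [h1]
  apply run_addReg_cfg (by decide) (disjoint_regs (by decide))
  · intro r hr; cases r <;> first | rfl | exact absurd (by decide) hr
  · have hx' : x < 2 ^ (ℓ + 1) := hx.trans (Nat.pow_lt_pow_right (by norm_num) (by simp))
    simp only [val_one_reg]
    simp [st, rsize, Nat.mod_eq_of_lt hx, Nat.mod_eq_of_lt hx']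

theorem run_moveCircuit_Y (ℓ x a f : ℕ) (hx : x < 2 ^ ℓ) :
    run (moveCircuit ℓ .Y) (ketSt ℓ x 0 0 0 0 0 0 0 a f) = ketSt ℓ 0 0 0 x 0 0 0 0 a f := by
  rw [moveCircuit, run_append]
  have h1 : run (addReg 1 (regs (rsize ℓ) [.Y]) (regs (rsize ℓ) [.X]))
      (ketSt ℓ x 0 0 0 0 0 0 0 a f) = ketSt ℓ x 0 0 x 0 0 0 0 a f := by
    apply run_addReg_cfg (by decide) (disjoint_regs (by decide))
    · intro r hr; cases r <;> first | rfl | exact absurd (by decide) hr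
    · simp only [val_one_reg]
      simp [st, rsize, Nat.mod_eq_of_lt hx, Int.ModEq]
  rw [h1]
  apply run_addReg_cfg (by decide) (disjoint_regs (by decide))
  · intro r hr; cases r <;> first | rfl | exact absurd (by decide) hr
  · have hx' : x < 2 ^ (ℓ + 1) := hx.trans (Nat.pow_lt_pow_right (by norm_num) (by simp))
    simp only [val_one_reg]
    simp [st, rsize, Nat.mod_eq_of_lt hx, Nat.mod_eq_of_lt hx']

theorem run_approxCircuit (ℓ N b v y a f : ℕ) (hv : v < 2 ^ ℓ) :
    run (approxCircuit ℓ N) (ketSt ℓ 0 b v y 0 0 0 0 a f) =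
      ketSt ℓ 0 b (residue ℓ N v) y (approxMul ℓ N v / 16) (approxMul ℓ N v % 16) 0 0 a f := by
  set c := 2 ^ (ℓ + 4 + (ℓ + 4)) / N with hc
  set k := approxMul ℓ N v with hk
  have hk_lt : k < 2 ^ (ℓ + 4) := Nat.mod_lt _ (by positivity)
  set q := N * k + 2 ^ (ℓ + 3) with hq
  have hsum : ([Reg.P, Reg.S].map (rsize ℓ)).sum = ℓ + 4 + (ℓ + 4) := by simp [rsize]
  have hsumTK : ([Reg.T, Reg.K].map (rsize ℓ)).sum = ℓ + 4 := by simp [rsize]; ring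
  have hsumV : ([Reg.V].map (rsize ℓ)).sum = ℓ := by simp [rsize]
  have hkv : c * v / 2 ^ (ℓ + 4) % 2 ^ (ℓ + 4) = k := rfl
  have hVval : ∀ x b y k t p s a f, val (regs (rsize ℓ) [.V]) (cfg (st x b v y k t p s a f)) = v := by
    intros
    simp only [val_one_reg]
    simp [st, rsize, Nat.mod_eq_of_lt hv]
  have hPS : ∀ x b y k' t a f, val (regs (rsize ℓ) [.P, .S])
      (cfg (st x b v y k' t (c * v % 2 ^ (ℓ + 4)) k a f)) =
        (c * v) % 2 ^ (ℓ + 4 + (ℓ + 4)) := by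
    intros
    rw [← hkv, val_PS]
  have hTKval : ∀ x b v y p s a f, val (regs (rsize ℓ) [.T, .K])
      (cfg (st x b v y (k / 16) (k % 16) p s a f)) = k := by
    intros
    rw [val_TK, Nat.mod_eq_of_lt hk_lt]
  have h1 : run (addReg c (regs (rsize ℓ) [.P, .S]) (regs (rsize ℓ) [.V]))
      (ketSt ℓ 0 b v y 0 0 0 0 a f) =
      ketSt ℓ 0 b v y 0 0 ((c * v) % 2 ^ (ℓ + 4)) k a f := by
    apply run_addReg_cfg (by decide) (disjoint_regs (by decide))
    · intro r hr; cases r <;> first | rfl | exact absurd (by decide) hr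
    · rw [hPS, val_PS_zero, hVval, hsum]
      push_cast
      rw [zero_add]
      exact Int.mod_modEq _ _
  have h2 : run (addReg 1 (regs (rsize ℓ) [.T, .K]) (regs (rsize ℓ) [.S]))
      (ketSt ℓ 0 b v y 0 0 ((c * v) % 2 ^ (ℓ + 4)) k a f) =
      ketSt ℓ 0 b v y (k / 16) (k % 16) ((c * v) % 2 ^ (ℓ + 4)) k a f := by
    apply run_addReg_cfg (by decide) (disjoint_regs (by decide))
    · intro r hr; cases r <;> first | rfl | exact absurd (by decide) hr
    · rw [hTKval]
      simp only [val_regs_cons_cfg, val_regs_nil]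
      simp [st, rsize, Nat.mod_eq_of_lt hk_lt]
  have h3 : run (addReg (-(c : ℤ)) (regs (rsize ℓ) [.P, .S]) (regs (rsize ℓ) [.V]))
      (ketSt ℓ 0 b v y (k / 16) (k % 16) ((c * v) % 2 ^ (ℓ + 4)) k a f) =
      ketSt ℓ 0 b v y (k / 16) (k % 16) 0 0 a f := by
    apply run_addReg_cfg (by decide) (disjoint_regs (by decide))
    · intro r hr; cases r <;> first | rfl | exact absurd (by decide) hr
    · rw [hPS, val_PS_zero, hVval, hsum]
      push_cast
      have := (Int.mod_modEq ((c : ℤ) * v) (2 ^ (ℓ + 4 + (ℓ + 4)))).add_right (-c * v)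
      simpa using this.symm
  have h4 : run (addReg N (regs (rsize ℓ) [.P, .S]) (regs (rsize ℓ) [.T, .K]))
      (ketSt ℓ 0 b v y (k / 16) (k % 16) 0 0 a f) =
      ketSt ℓ 0 b v y (k / 16) (k % 16) (N * k % 2 ^ (ℓ + 4))
        (N * k / 2 ^ (ℓ + 4) % 2 ^ (ℓ + 4)) a f := by
    apply run_addReg_cfg (by decide) (disjoint_regs (by decide))
    · intro r hr; cases r <;> first | rfl | exact absurd (by decide) hr
    · rw [val_PS, val_PS_zero, hTKval, hsum]
      push_cast
      rw [zero_add]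
      exact Int.mod_modEq _ _
  have h5 : run (addConst (2 ^ (ℓ + 3)) (regs (rsize ℓ) [.P, .S]))
      (ketSt ℓ 0 b v y (k / 16) (k % 16) (N * k % 2 ^ (ℓ + 4))
        (N * k / 2 ^ (ℓ + 4) % 2 ^ (ℓ + 4)) a f) =
      ketSt ℓ 0 b v y (k / 16) (k % 16) (q % 2 ^ (ℓ + 4))
        (q / 2 ^ (ℓ + 4) % 2 ^ (ℓ + 4)) a f := by
    apply run_addConst_cfg (by decide)
    · intro r hr; cases r <;> first | rfl | exact absurd (by decide) hr
    · rw [val_PS, val_PS, hsum, hq]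
      push_cast
      exact (Int.mod_modEq _ _).trans ((Int.mod_modEq _ _).symm.add_right _)
  have h6 : run (addReg (-1) (regs (rsize ℓ) [.V]) (regs (rsize ℓ) [.S]))
      (ketSt ℓ 0 b v y (k / 16) (k % 16) (q % 2 ^ (ℓ + 4))
        (q / 2 ^ (ℓ + 4) % 2 ^ (ℓ + 4)) a f) =
      ketSt ℓ 0 b (residue ℓ N v) y (k / 16) (k % 16) (q % 2 ^ (ℓ + 4))
        (q / 2 ^ (ℓ + 4) % 2 ^ (ℓ + 4)) a f := by
    apply run_addReg_cfg (by decide) (disjoint_regs (by decide))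
    · intro r hr; cases r <;> first | rfl | exact absurd (by decide) hr
    · rw [hVval, hsumV]
      simp only [val_one_reg]
      simp only [st, rsize, Nat.mod_mod]
      have hr : q / 2 ^ (ℓ + 4) % 2 ^ (ℓ + 4) = roundBack ℓ N k := rfl
      have hr_lt : roundBack ℓ N k < 2 ^ (ℓ + 4) := Nat.mod_lt _ (by positivity)
      rw [hr, residue, ← hk, Nat.mod_mod]
      push_cast [hr_lt.le]
      refine (Int.mod_modEq _ _).trans ?_
      apply Int.ModEq.add_left
      rw [Int.modEq_iff_dvd]
      exact ⟨-16, by ring⟩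
  have h7 : run (addConst (-2 ^ (ℓ + 3)) (regs (rsize ℓ) [.P, .S]))
      (ketSt ℓ 0 b (residue ℓ N v) y (k / 16) (k % 16) (q % 2 ^ (ℓ + 4))
        (q / 2 ^ (ℓ + 4) % 2 ^ (ℓ + 4)) a f) =
      ketSt ℓ 0 b (residue ℓ N v) y (k / 16) (k % 16) (N * k % 2 ^ (ℓ + 4))
        (N * k / 2 ^ (ℓ + 4) % 2 ^ (ℓ + 4)) a f := by
    apply run_addConst_cfg (by decide)
    · intro r hr; cases r <;> first | rfl | exact absurd (by decide) hr
    · rw [val_PS, val_PS, hsum, hq]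
      push_cast
      refine (Int.mod_modEq _ _).trans ?_
      have := (Int.mod_modEq ((N : ℤ) * k + 2 ^ (ℓ + 3)) (2 ^ (ℓ + 4 + (ℓ + 4)))).symm.add_right
        (-2 ^ (ℓ + 3))
      simpa using this
  have h8 : run (addReg (-N) (regs (rsize ℓ) [.P, .S]) (regs (rsize ℓ) [.T, .K]))
      (ketSt ℓ 0 b (residue ℓ N v) y (k / 16) (k % 16) (N * k % 2 ^ (ℓ + 4))
        (N * k / 2 ^ (ℓ + 4) % 2 ^ (ℓ + 4)) a f) =
      ketSt ℓ 0 b (residue ℓ N v) y (k / 16) (k % 16) 0 0 a f := by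
    apply run_addReg_cfg (by decide) (disjoint_regs (by decide))
    · intro r hr; cases r <;> first | rfl | exact absurd (by decide) hr
    · rw [val_PS, val_PS_zero, hTKval, hsum]
      push_cast
      have := (Int.mod_modEq ((N : ℤ) * k) (2 ^ (ℓ + 4 + (ℓ + 4)))).add_right (-N * k)
      simpa using this.symm
  simp only [approxCircuit, run_append]
  rw [← hc, h1, h2, h3, h4, h5, h6, h7, h8]

/-! ### A block encoding of the Fourier transform of order `N` -/

/-- The number that the register `K` holds in reversed bit order. -/
def revVal (ℓ κ : ℕ) : ℕ := val (reg (rsize ℓ) .K).reverse (cfg (st 0 0 0 0 κ 0 0 0 0 0))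

theorem revVal_lt (ℓ κ : ℕ) : revVal ℓ κ < 2 ^ ℓ := by
  have := val_lt (reg (rsize ℓ) .K).reverse (cfg (st 0 0 0 0 κ 0 0 0 0 0))
  rwa [List.length_reverse, length_reg] at this

theorem val_K_reverse (ℓ x b v y κ t p s a f : ℕ) :
    val (reg (rsize ℓ) .K).reverse (cfg (st x b v y κ t p s a f)) = revVal ℓ κ := by
  apply val_congr
  rintro ⟨r, i⟩ hw
  rw [List.mem_reverse, mem_reg] at hw
  simp only at hw
  subst hw
  rfl

/-- The circuit that maps `|x⟩` to a superposition over `v` and `w` of states holding `x + v`, `w`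
and an approximation of `v · 2 ^ (ℓ + 4) / N`. -/
noncomputable def prepCircuit (ℓ N : ℕ) : Circuit (Σ r, Fin (rsize ℓ r)) :=
  moveCircuit ℓ .B ++ (qftCircuit (reg (rsize ℓ) .V) ++ (qftCircuit (reg (rsize ℓ) .Y) ++
  (bphase (2 * Real.pi / N) (regs (rsize ℓ) [.B]) (regs (rsize ℓ) [.Y]) ++
  (addReg 1 (regs (rsize ℓ) [.B]) (regs (rsize ℓ) [.V]) ++ approxCircuit ℓ N))))

/-- The circuit that maps `|y⟩` to a superposition over `b` and `u` of states holding `b`, `y + u`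
and `u`. -/
noncomputable def testCircuit (ℓ N : ℕ) : Circuit (Σ r, Fin (rsize ℓ r)) :=
  moveCircuit ℓ .Y ++ (qftCircuit (reg (rsize ℓ) .B) ++ (qftCircuit (reg (rsize ℓ) .K) ++
  (bphase (2 * Real.pi / N) (regs (rsize ℓ) [.B]) (reg (rsize ℓ) .K).reverse ++
  addReg 1 (regs (rsize ℓ) [.Y]) (reg (rsize ℓ) .K).reverse)))

/-- A circuit that implements a multiple of the Fourier transform of order `N` when all registers
but `X` are projected to zero. -/
noncomputable def blockCircuit (ℓ N : ℕ) : Circuit (Σ r, Fin (rsize ℓ r)) :=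
  prepCircuit ℓ N ++ (qftCircuit (regs (rsize ℓ) [.T, .K]) ++ (testCircuit ℓ N).inv)

theorem run_qft_ketSt_V (ℓ x b y k t p s a f : ℕ) :
    run (qftCircuit (reg (rsize ℓ) .V)) (ketSt ℓ x b 0 y k t p s a f) =
      ∑ v ∈ Finset.range (2 ^ ℓ),
        (((√2)⁻¹ ^ ℓ : ℝ) : ℂ) • ketSt ℓ x b v y k t p s a f := by
  rw [ketSt, run_qft_zero _ _ (by rfl)]
  apply Finset.sum_congr rfl
  intro v _
  congr 3
  funext r
  cases r <;> rfl

theorem run_qft_ketSt_Y (ℓ x b v k t p s a f : ℕ) :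
    run (qftCircuit (reg (rsize ℓ) .Y)) (ketSt ℓ x b v 0 k t p s a f) =
      ∑ y ∈ Finset.range (2 ^ (ℓ + 1)),
        (((√2)⁻¹ ^ (ℓ + 1) : ℝ) : ℂ) • ketSt ℓ x b v y k t p s a f := by
  rw [ketSt, run_qft_zero _ _ (by rfl)]
  apply Finset.sum_congr rfl
  intro v _
  congr 3
  funext r
  cases r <;> rfl

theorem run_qft_ketSt_B (ℓ x v y k t p s a f : ℕ) :
    run (qftCircuit (reg (rsize ℓ) .B)) (ketSt ℓ x 0 v y k t p s a f) =
      ∑ b ∈ Finset.range (2 ^ (ℓ + 1)),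
        (((√2)⁻¹ ^ (ℓ + 1) : ℝ) : ℂ) • ketSt ℓ x b v y k t p s a f := by
  rw [ketSt, run_qft_zero _ _ (by rfl)]
  apply Finset.sum_congr rfl
  intro v _
  congr 3
  funext r
  cases r <;> rfl

theorem run_qft_ketSt_K (ℓ x b v y t p s a f : ℕ) :
    run (qftCircuit (reg (rsize ℓ) .K)) (ketSt ℓ x b v y 0 t p s a f) =
      ∑ k ∈ Finset.range (2 ^ ℓ),
        (((√2)⁻¹ ^ ℓ : ℝ) : ℂ) • ketSt ℓ x b v y k t p s a f := by
  rw [ketSt, run_qft_zero _ _ (by rfl)]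
  apply Finset.sum_congr rfl
  intro v _
  congr 3
  funext r
  cases r <;> rfl

theorem run_prepCircuit (ℓ N x a f : ℕ) (hx : x < 2 ^ ℓ) :
    run (prepCircuit ℓ N) (ketSt ℓ x 0 0 0 0 0 0 0 a f) =
      ∑ v ∈ Finset.range (2 ^ ℓ), ∑ w ∈ Finset.range (2 ^ (ℓ + 1)),
        ((((√2)⁻¹ ^ (2 * ℓ + 1) : ℝ) : ℂ) * cis (2 * Real.pi / N * (x * w))) •
          ketSt ℓ 0 (x + v) (residue ℓ N v) w (approxMul ℓ N v / 16) (approxMul ℓ N v % 16)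
            0 0 a f := by
  have hx' : x < 2 ^ (ℓ + 1) := hx.trans (Nat.pow_lt_pow_right (by norm_num) (by simp))
  simp only [prepCircuit, run_append]
  rw [run_moveCircuit_B ℓ x a f hx, run_qft_ketSt_V]
  simp only [run_sum, run_smul]
  apply Finset.sum_congr rfl
  intro v hv
  rw [Finset.mem_range] at hv
  rw [run_qft_ketSt_Y]
  simp only [run_sum, run_smul, Finset.smul_sum]
  apply Finset.sum_congr rfl
  intro w hw
  rw [Finset.mem_range] at hw
  have h1 : run (bphase (2 * Real.pi / N) (regs (rsize ℓ) [.B]) (regs (rsize ℓ) [.Y]))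
      (ketSt ℓ 0 x v w 0 0 0 0 a f) =
      cis (2 * Real.pi / N * (x * w)) • ketSt ℓ 0 x v w 0 0 0 0 a f := by
    rw [ketSt, run_ket_of_diagonal (toMatrix_bphase _ (disjoint_regs (by decide))), val_one_reg,
      val_one_reg]
    simp only [st, rsize]
    rw [Nat.mod_eq_of_lt hx', Nat.mod_eq_of_lt hw]
  have h2 : run (addReg 1 (regs (rsize ℓ) [.B]) (regs (rsize ℓ) [.V]))
      (ketSt ℓ 0 x v w 0 0 0 0 a f) = ketSt ℓ 0 (x + v) v w 0 0 0 0 a f := by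
    apply run_addReg_cfg (by decide) (disjoint_regs (by decide))
    · intro r hr; cases r <;> first | rfl | exact absurd (by decide) hr
    · simp only [val_one_reg]
      simp [st, rsize, Nat.mod_eq_of_lt hv, Int.ModEq]
  rw [h1]
  simp only [run_smul]
  rw [h2, run_approxCircuit ℓ N _ v w a f hv, smul_smul, smul_smul, ← mul_assoc,
    ← Complex.ofReal_mul]
  congr 3
  ring

theorem run_testCircuit (ℓ N y a f : ℕ) (hy : y < 2 ^ ℓ) :
    run (testCircuit ℓ N) (ketSt ℓ y 0 0 0 0 0 0 0 a f) =
      ∑ b ∈ Finset.range (2 ^ (ℓ + 1)), ∑ κ ∈ Finset.range (2 ^ ℓ),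
        ((((√2)⁻¹ ^ (2 * ℓ + 1) : ℝ) : ℂ) * cis (2 * Real.pi / N * (b * revVal ℓ κ))) •
          ketSt ℓ 0 b 0 (y + revVal ℓ κ) κ 0 0 0 a f := by
  have hdis : ∀ R : Reg, R ≠ .K → (regs (rsize ℓ) [R]).Disjoint (reg (rsize ℓ) .K).reverse := by
    intro R hR
    rw [List.disjoint_left]
    intro w hw hw'
    rw [List.mem_reverse, mem_reg] at hw'
    rw [mem_regs, List.mem_singleton] at hw
    exact hR (hw.symm.trans hw')
  simp only [testCircuit, run_append]
  rw [run_moveCircuit_Y ℓ y a f hy, run_qft_ketSt_B]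
  simp only [run_sum, run_smul]
  apply Finset.sum_congr rfl
  intro b hb
  rw [Finset.mem_range] at hb
  rw [run_qft_ketSt_K]
  simp only [run_sum, run_smul, Finset.smul_sum]
  apply Finset.sum_congr rfl
  intro κ hκ
  rw [Finset.mem_range] at hκ
  have h1 : run (bphase (2 * Real.pi / N) (regs (rsize ℓ) [.B]) (reg (rsize ℓ) .K).reverse)
      (ketSt ℓ 0 b 0 y κ 0 0 0 a f) =
      cis (2 * Real.pi / N * (b * revVal ℓ κ)) • ketSt ℓ 0 b 0 y κ 0 0 0 a f := by
    rw [ketSt, run_ket_of_diagonal (toMatrix_bphase _ (hdis _ (by decide))), val_one_reg,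
      val_K_reverse]
    simp only [st, rsize]
    rw [Nat.mod_eq_of_lt hb]
  have h2 : run (addReg 1 (regs (rsize ℓ) [.Y]) (reg (rsize ℓ) .K).reverse)
      (ketSt ℓ 0 b 0 y κ 0 0 0 a f) = ketSt ℓ 0 b 0 (y + revVal ℓ κ) κ 0 0 0 a f := by
    apply run_addReg_cfg (by decide) (hdis _ (by decide))
    · intro r hr; cases r <;> first | rfl | exact absurd (by decide) hr
    · simp only [val_one_reg, val_K_reverse]
      simp [st, rsize, Int.ModEq]
  rw [h1]
  simp only [run_smul]
  rw [h2, smul_smul, smul_smul, ← mul_assoc, ← Complex.ofReal_mul]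
  congr 3
  ring

/-- The correlation between `|v⟩ ↦ ∑ e^{2πiuk/2^(ℓ+4)}|u⟩`, for `k` the rounding of
`v · 2 ^ (ℓ + 4) / N`, and the Fourier transform of order `N`. -/
noncomputable def correlation (ℓ N : ℕ) : ℂ :=
  ∑ κ ∈ Finset.range (2 ^ ℓ), ∑ v ∈ Finset.range (2 ^ ℓ),
    if residue ℓ N v = 0 then
      cis (2 * Real.pi * revVal ℓ κ * (approxMul ℓ N v / 2 ^ (ℓ + 4) - v / N)) else 0

/-- The output is read in reversed order, so `T = 0` says that its four most significant bits vanish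
and the output is `revVal ℓ κ < 2 ^ ℓ`. The other registers are untouched and must agree; in
particular the residue left in `V` must be zero. -/
theorem qft_TK_entry (ℓ b y κ a f b' v y' k a' f' : ℕ) (hb : b < 2 ^ (ℓ + 1))
    (hb' : b' < 2 ^ (ℓ + 1)) (hv : v < 2 ^ ℓ) (hy : y < 2 ^ (ℓ + 1)) (hy' : y' < 2 ^ (ℓ + 1))
    (ha : a < 2) (ha' : a' < 2) (hf : f < 2) (hf' : f' < 2) (hk : k < 2 ^ (ℓ + 4)) :
    Circuit.toMatrix (qftCircuit (regs (rsize ℓ) [.T, .K]))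
      (cfg (st 0 b 0 y κ 0 0 0 a f)) (cfg (st 0 b' v y' (k / 16) (k % 16) 0 0 a' f')) =
      if b' = b ∧ y' = y ∧ v = 0 ∧ a = a' ∧ f = f' then
        (((√2)⁻¹ ^ (ℓ + 4) : ℝ) : ℂ) *
          cis (2 * Real.pi * (k * revVal ℓ κ) / 2 ^ (ℓ + 4)) else 0 := by
  split_ifs with h
  · obtain ⟨rfl, rfl, rfl, rfl, rfl⟩ := h
    have hT : val (reg (rsize ℓ) .T).reverse (cfg (st 0 b' 0 y' κ 0 0 0 a f)) = 0 := by
      rw [val_eq_zero_iff]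
      rintro ⟨r, i⟩ hw
      rw [List.mem_reverse, mem_reg] at hw
      simp only at hw
      subst hw
      simp [cfg, st]
    rw [toMatrix_qftCircuit (nodup_regs (by decide)), val_TK, Nat.mod_eq_of_lt hk, length_regs]
    · have : ([Reg.T, Reg.K].map (rsize ℓ)).sum = ℓ + 4 := by simp [rsize]; ring
      rw [this, regs_cons, List.reverse_append, val_append, hT, regs_singleton, val_K_reverse]
      simp
    · apply cfg_agree
      intro r hr; cases r <;> first | rfl | exact absurd (by decide) hr
  · apply toMatrix_qftCircuit_eq_zero (nodup_regs (by decide))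
    intro hag
    apply h
    have key : ∀ R : Reg, R ∉ [Reg.T, Reg.K] →
        st 0 b 0 y κ 0 0 0 a f R % 2 ^ rsize ℓ R =
          st 0 b' v y' (k / 16) (k % 16) 0 0 a' f' R % 2 ^ rsize ℓ R := by
      intro R hR
      rw [← val_reg_cfg, ← val_reg_cfg]
      apply val_congr
      intro w hw
      apply hag
      rw [mem_reg] at hw
      rw [mem_regs, hw]
      exact hR
    have kB := key .B (by decide)
    have kY := key .Y (by decide)
    have kV := key .V (by decide)
    have kA := key .A (by decide)
    have kF := key .F (by decide)
    simp only [st, rsize] at kB kY kV kA kF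
    rw [Nat.mod_eq_of_lt hb, Nat.mod_eq_of_lt hb'] at kB
    rw [Nat.mod_eq_of_lt hy, Nat.mod_eq_of_lt hy'] at kY
    rw [Nat.zero_mod, Nat.mod_eq_of_lt hv] at kV
    rw [pow_one, Nat.mod_eq_of_lt ha, Nat.mod_eq_of_lt ha'] at kA
    rw [pow_one, Nat.mod_eq_of_lt hf, Nat.mod_eq_of_lt hf'] at kF
    exact ⟨kB.symm, kY.symm, kV.symm, kA, kF⟩

theorem residue_lt (ℓ N v : ℕ) : residue ℓ N v < 2 ^ ℓ := Nat.mod_lt _ (by positivity)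

theorem approxMul_lt (ℓ N v : ℕ) : approxMul ℓ N v < 2 ^ (ℓ + 4) := Nat.mod_lt _ (by positivity)

theorem toMatrix_comp_inv {W : Type} [Fintype W] [DecidableEq W] (C D : Circuit W)
    (x y : W → Bool) :
    Circuit.toMatrix (C ++ D.inv) y x = ∑ z, star (run D (ket y) z) * run C (ket x) z := by
  rw [Circuit.toMatrix_append, Circuit.toMatrix_inv, Matrix.mul_apply]
  simp only [Matrix.conjTranspose_apply, run_ket_apply]

theorem star_ket_dotProduct {W : Type} [Fintype W] [DecidableEq W] (C : Circuit W)
    (x y : W → Bool) : star (ket y) ⬝ᵥ run C (ket x) = Circuit.toMatrix C y x := by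
  rw [← run_ket_apply, ket, ← Pi.single_star, star_one, single_one_dotProduct]

/-- With `u = revVal ℓ κ`, the overlap forces `b = x + v` and `w = y + u`. The phases of order `N`
combine to `x (y + u) - (x + v) u = x y - u v`, so the dependence on `x` and `y` splits off exactly,
and the rest sums to `correlation`. The exponent is `2 (2ℓ + 1) + (ℓ + 4)`, from preparation, test
and the transform between them. The qubits `A` and `F` are spectators. -/
theorem toMatrix_blockCircuit (ℓ N x y a f a' f' : ℕ) (hx : x < 2 ^ ℓ) (hy : y < 2 ^ ℓ)
    (ha : a < 2) (ha' : a' < 2) (hf : f < 2) (hf' : f' < 2) :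
    Circuit.toMatrix (blockCircuit ℓ N) (cfg (st y 0 0 0 0 0 0 0 a' f'))
      (cfg (st x 0 0 0 0 0 0 0 a f)) =
      if a' = a ∧ f' = f then
        (((√2)⁻¹ ^ (5 * ℓ + 6) : ℝ) : ℂ) * cis (2 * Real.pi / N * (x * y)) * correlation ℓ N
      else 0 := by
  rw [blockCircuit, ← List.append_assoc, toMatrix_comp_inv]
  have e1 := run_prepCircuit ℓ N x a f hx
  have e2 := run_testCircuit ℓ N y a' f' hy
  simp only [ketSt] at e1 e2
  rw [run_append, e1, e2]
  change star _ ⬝ᵥ _ = _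
  simp only [run_sum, run_smul, star_sum, star_smul, sum_dotProduct, dotProduct_sum,
    smul_dotProduct, dotProduct_smul, star_ket_dotProduct, smul_eq_mul, Finset.mul_sum]
  have step : ∀ κ ∈ Finset.range (2 ^ ℓ), ∀ v ∈ Finset.range (2 ^ ℓ),
      (∑ w ∈ Finset.range (2 ^ (ℓ + 1)), ∑ b ∈ Finset.range (2 ^ (ℓ + 1)),
        ((((√2)⁻¹ ^ (2 * ℓ + 1) : ℝ) : ℂ) * cis (2 * Real.pi / N * (x * w))) *
        (star ((((√2)⁻¹ ^ (2 * ℓ + 1) : ℝ) : ℂ) * cis (2 * Real.pi / N * (b * revVal ℓ κ))) *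
        Circuit.toMatrix (qftCircuit (regs (rsize ℓ) [.T, .K]))
          (cfg (st 0 b 0 (y + revVal ℓ κ) κ 0 0 0 a' f'))
          (cfg (st 0 (x + v) (residue ℓ N v) w (approxMul ℓ N v / 16) (approxMul ℓ N v % 16)
            0 0 a f)))) =
      if a' = a ∧ f' = f then
        (((√2)⁻¹ ^ (5 * ℓ + 6) : ℝ) : ℂ) * cis (2 * Real.pi / N * (x * y)) *
          (if residue ℓ N v = 0 then
            cis (2 * Real.pi * revVal ℓ κ * (approxMul ℓ N v / 2 ^ (ℓ + 4) - v / N)) else 0)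
      else 0 := by
    intro κ _ v hv
    rw [Finset.mem_range] at hv
    have hu := revVal_lt ℓ κ
    -- The extra qubit of `B` and of `Y` keeps both shifted values from wrapping around.
    have hxv : x + v < 2 ^ (ℓ + 1) := by rw [pow_succ]; omega
    have hyu : y + revVal ℓ κ < 2 ^ (ℓ + 1) := by rw [pow_succ]; omega
    have hent : ∀ b ∈ Finset.range (2 ^ (ℓ + 1)), ∀ w ∈ Finset.range (2 ^ (ℓ + 1)), _ :=
      fun b hb w hw => qft_TK_entry ℓ b (y + revVal ℓ κ) κ a' f' (x + v) (residue ℓ N v) w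
        (approxMul ℓ N v) a f (Finset.mem_range.1 hb) hxv (residue_lt _ _ _) hyu
        (Finset.mem_range.1 hw) ha' ha hf' hf (approxMul_lt _ _ _)
    rw [Finset.sum_eq_single (y + revVal ℓ κ), Finset.sum_eq_single (x + v)]
    · rw [hent _ (Finset.mem_range.2 hxv) _ (Finset.mem_range.2 hyu)]
      by_cases h1 : a' = a ∧ f' = f
      · by_cases h2 : residue ℓ N v = 0
        · rw [if_pos ⟨rfl, rfl, h2, h1.1, h1.2⟩, if_pos h1, if_pos h2]
          rw [star_mul, star_cis]
          simp only [RCLike.star_def, Complex.conj_ofReal]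
          have e : cis (2 * Real.pi / N * (x * y)) *
              cis (2 * Real.pi * revVal ℓ κ * (approxMul ℓ N v / 2 ^ (ℓ + 4) - v / N)) =
              cis (-(2 * Real.pi / N * ((x + v : ℕ) * revVal ℓ κ))) *
              (cis (2 * Real.pi / N * (x * (y + revVal ℓ κ : ℕ))) *
              cis (2 * Real.pi * (approxMul ℓ N v * revVal ℓ κ) / 2 ^ (ℓ + 4))) := by
            simp only [← cis_add]
            congr 1
            push_cast
            ring
          rw [mul_assoc (((√2)⁻¹ ^ (5 * ℓ + 6) : ℝ) : ℂ), e]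
          have hr : ((√2)⁻¹ ^ (5 * ℓ + 6) : ℝ) =
              (√2)⁻¹ ^ (2 * ℓ + 1) * ((√2)⁻¹ ^ (2 * ℓ + 1) * (√2)⁻¹ ^ (ℓ + 4)) := by ring
          rw [hr, Complex.ofReal_mul, Complex.ofReal_mul]
          ring
        · rw [if_neg (fun h => h2 h.2.2.1), if_pos h1, if_neg h2]
          simp
      · rw [if_neg (fun h => h1 h.2.2.2), if_neg h1]
        simp
    · intro b hb hne
      rw [hent _ hb _ (Finset.mem_range.2 hyu), if_neg (fun h => hne h.1.symm)]
      simp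
    · intro hn
      exact absurd (Finset.mem_range.2 hxv) hn
    · intro w hw hne
      apply Finset.sum_eq_zero
      intro b hb
      rw [hent _ hb _ hw, if_neg (fun h => hne h.2.1)]
      simp
    · intro hn
      exact absurd (Finset.mem_range.2 hyu) hn
  trans ∑ κ ∈ Finset.range (2 ^ ℓ), ∑ v ∈ Finset.range (2 ^ ℓ), if a' = a ∧ f' = f then
        (((√2)⁻¹ ^ (5 * ℓ + 6) : ℝ) : ℂ) * cis (2 * Real.pi / N * (x * y)) *
          (if residue ℓ N v = 0 then
            cis (2 * Real.pi * revVal ℓ κ * (approxMul ℓ N v / 2 ^ (ℓ + 4) - v / N)) else 0)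
      else 0
  · rw [Finset.sum_comm (s := Finset.range (2 ^ ℓ)) (t := Finset.range (2 ^ ℓ))]
    apply Finset.sum_congr rfl
    intro v hv
    rw [← Finset.sum_congr rfl fun κ hκ => step κ hκ v hv]
    symm
    rw [Finset.sum_comm]
    apply Finset.sum_congr rfl
    intro w _
    exact Finset.sum_comm
  · split_ifs
    · simp only [correlation, Finset.mul_sum]
    · simp

/-! ### A lower bound for the correlation -/

/-- Two truncations: rounding `M ^ 2 / N` down costs at most `v / M`, and rounding the final
quotient down costs less than `1`. Hence `M v / N - v / M - 1 < k ≤ M v / N`, here with denominators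
cleared. -/
theorem approx_bounds {ℓ N v : ℕ} (hN : 0 < N) :
    let M := 2 ^ (ℓ + 4)
    let k := 2 ^ (ℓ + 4 + (ℓ + 4)) / N * v / 2 ^ (ℓ + 4)
    N * k ≤ M * v ∧ M * (M * v) < N * k * M + N * v + N * M := by
  intro M k
  have hM : 0 < M := by positivity
  set c := 2 ^ (ℓ + 4 + (ℓ + 4)) / N with hc
  have hMM : 2 ^ (ℓ + 4 + (ℓ + 4)) = M * M := pow_add _ _ _
  have h1 : N * c ≤ M * M := by rw [hc, hMM]; exact Nat.mul_div_le _ _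
  have h2 : M * M < N * (c + 1) := by rw [hc, hMM]; exact Nat.lt_mul_div_succ _ hN
  have h3 : M * k ≤ c * v := Nat.mul_div_le _ _
  have h4 : c * v < M * (k + 1) := Nat.lt_mul_div_succ _ hM
  constructor
  · apply Nat.le_of_mul_le_mul_left _ hM
    calc M * (N * k) = N * (M * k) := by ring
      _ ≤ N * (c * v) := Nat.mul_le_mul_left _ h3
      _ = (N * c) * v := by ring
      _ ≤ (M * M) * v := Nat.mul_le_mul_right _ h1
      _ = M * (M * v) := by ring
  · calc M * (M * v) = (M * M) * v := by ring
      _ ≤ (N * (c + 1)) * v := Nat.mul_le_mul_right _ h2.le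
      _ = N * (c * v) + N * v := by ring
      _ < N * (M * (k + 1)) + N * v := by
        have := Nat.mul_lt_mul_of_pos_left h4 hN
        omega
      _ = N * k * M + N * v + N * M := by ring

/-- For `v < N` the value `k` does not wrap around, and `M v - N k` is below `2 * 2 ^ ℓ`, well under
`M / 2 = 8 * 2 ^ ℓ`. Rounding `N k / M` to the nearest integer therefore returns `v`, and `V` is
cleared. -/
theorem residue_eq_zero {ℓ N v : ℕ} (hN : N < 2 ^ ℓ) (hv : v < N) : residue ℓ N v = 0 := by
  obtain ⟨h1, h2⟩ := approx_bounds (ℓ := ℓ) (N := N) (v := v) (by omega)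
  set M := 2 ^ (ℓ + 4) with hM
  set k := 2 ^ (ℓ + 4 + (ℓ + 4)) / N * v / 2 ^ (ℓ + 4) with hk
  have hM16 : M = 16 * 2 ^ ℓ := by rw [hM, pow_add]; ring
  have hM3 : 2 ^ (ℓ + 3) = 8 * 2 ^ ℓ := by rw [pow_add]; ring
  have hkM : k < M := by
    by_contra h
    push Not at h
    have : N * M ≤ M * v := (Nat.mul_le_mul_left _ h).trans h1
    have : M * N ≤ M * v := by linarith
    have := Nat.le_of_mul_le_mul_left this (by positivity)
    omega
  have ha : approxMul ℓ N v = k := Nat.mod_eq_of_lt hkM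
  have hlow : M * v ≤ N * k + 2 ^ (ℓ + 3) := by
    by_contra h
    push Not at h
    have h5 : (N * k + 2 ^ (ℓ + 3)) * M ≤ M * v * M := Nat.mul_le_mul_right _ h.le
    have h6 : N * v ≤ 2 ^ ℓ * M := Nat.mul_le_mul hN.le (by omega)
    have h7 : N * M ≤ 2 ^ ℓ * M := Nat.mul_le_mul_right _ hN.le
    have h8 : 0 < 2 ^ ℓ * M := by positivity
    rw [hM3] at h5
    have : (N * k + 8 * 2 ^ ℓ) * M = N * k * M + 8 * (2 ^ ℓ * M) := by ring
    have : M * v * M = M * (M * v) := by ring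
    omega
  have hr : (N * k + 2 ^ (ℓ + 3)) / M = v := by
    rw [Nat.div_eq_iff (by positivity)]
    constructor
    · linarith
    · have : v * M = M * v := by ring
      omega
  have hb : roundBack ℓ N k = v := by
    rw [roundBack, ← hM, hr]
    exact Nat.mod_eq_of_lt (by omega)
  rw [residue, ha, hb, ← hM, hM16]
  have : v + (16 * 2 ^ ℓ - v) = 16 * 2 ^ ℓ := by omega
  rw [this, Nat.mul_mod_left]

/-- The error of `k / M` is at most `2 / M = 1 / (8 * 2 ^ ℓ)` and `u < 2 ^ ℓ`, so the angle is at
most `2π / 8 = π / 4`; the four additional bits of precision give this. Reducing `k` modulo `M`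
changes the angle by full turns only, so the bound also covers `v ≥ N`. -/
theorem cos_approx_ge {ℓ N u v : ℕ} (hN : 0 < N) (hu : u < 2 ^ ℓ) (hv : v < 2 ^ ℓ) :
    √2 / 2 ≤ (cis (2 * Real.pi * u * (approxMul ℓ N v / 2 ^ (ℓ + 4) - v / N))).re := by
  obtain ⟨h1, h2⟩ := approx_bounds (ℓ := ℓ) (v := v) hN
  set k := 2 ^ (ℓ + 4 + (ℓ + 4)) / N * v / 2 ^ (ℓ + 4) with hk
  have ha : approxMul ℓ N v = k % 2 ^ (ℓ + 4) := rfl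
  have hM : (0 : ℝ) < 2 ^ (ℓ + 4) := by positivity
  have hN' : (0 : ℝ) < N := by exact_mod_cast hN
  obtain ⟨q, hq⟩ : ∃ q : ℕ, k = k % 2 ^ (ℓ + 4) + 2 ^ (ℓ + 4) * q :=
    ⟨_, (Nat.mod_add_div k (2 ^ (ℓ + 4))).symm⟩
  have hmod : (k : ℝ) = ((k % 2 ^ (ℓ + 4) : ℕ) : ℝ) + 2 ^ (ℓ + 4) * (q : ℝ) := by
    exact_mod_cast hq
  have e : cis (2 * Real.pi * u * (approxMul ℓ N v / 2 ^ (ℓ + 4) - v / N)) =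
      cis (2 * Real.pi * u * (k / 2 ^ (ℓ + 4) - v / N)) := by
    apply cis_eq_of_sub_eq (-(u * q : ℤ))
    rw [hmod, ha]
    push_cast
    field_simp
    ring
  rw [e, cis_re, ← Real.cos_pi_div_four,
    ← Real.cos_abs (2 * Real.pi * u * (k / 2 ^ (ℓ + 4) - v / N))]
  have h1' : (N : ℝ) * k ≤ 2 ^ (ℓ + 4) * v := by exact_mod_cast h1
  have h2' : (2 : ℝ) ^ (ℓ + 4) * (2 ^ (ℓ + 4) * v) < N * k * 2 ^ (ℓ + 4) + N * v +
      N * 2 ^ (ℓ + 4) := by exact_mod_cast h2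
  have hM16 : (2 : ℝ) ^ (ℓ + 4) = 16 * 2 ^ ℓ := by rw [pow_add]; ring
  have hu' : (u : ℝ) ≤ 2 ^ ℓ := by exact_mod_cast hu.le
  have hv' : (v : ℝ) ≤ 2 ^ (ℓ + 4) := by
    rw [hM16]
    have : (v : ℝ) ≤ 2 ^ ℓ := by exact_mod_cast hv.le
    have : (0 : ℝ) < 2 ^ ℓ := by positivity
    linarith
  have b1 : (k : ℝ) / 2 ^ (ℓ + 4) - v / N ≤ 0 := by
    rw [sub_nonpos, div_le_div_iff₀ hM hN']
    linarith
  have b2 : -(2 / 2 ^ (ℓ + 4)) ≤ (k : ℝ) / 2 ^ (ℓ + 4) - v / N := by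
    have : (v : ℝ) / N ≤ (k + 2) / 2 ^ (ℓ + 4) := by
      rw [div_le_div_iff₀ hN' hM]
      have h3 : (N : ℝ) * v ≤ N * 2 ^ (ℓ + 4) := by gcongr
      have h4 : (2 : ℝ) ^ (ℓ + 4) * (2 ^ (ℓ + 4) * v) < 2 ^ (ℓ + 4) * (N * (k + 2)) := by
        nlinarith
      have := lt_of_mul_lt_mul_left h4 hM.le
      linarith
    rw [add_div] at this
    linarith
  apply Real.cos_le_cos_of_nonneg_of_le_pi (abs_nonneg _) (by linarith [Real.pi_pos])
  rw [abs_mul, abs_of_nonneg (by positivity : (0 : ℝ) ≤ 2 * Real.pi * u)]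
  have b3 : |(k : ℝ) / 2 ^ (ℓ + 4) - v / N| ≤ 2 / 2 ^ (ℓ + 4) := by
    rw [abs_of_nonpos b1]
    linarith
  calc 2 * Real.pi * u * |(k : ℝ) / 2 ^ (ℓ + 4) - v / N|
      ≤ 2 * Real.pi * 2 ^ ℓ * (2 / 2 ^ (ℓ + 4)) := by
        have := Real.pi_pos
        gcongr
    _ = Real.pi / 4 := by
        rw [hM16]
        field_simp
        norm_num

/-- Terms with `v < N` have zero residue and contribute at least `√2 / 2`. Whether or not the
residue vanishes for some `v ≥ N`, such terms have nonnegative real part and cannot cancel the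
others. -/
theorem correlation_re_ge {ℓ N : ℕ} (hN : 0 < N) (hNℓ : N < 2 ^ ℓ) :
    2 ^ ℓ * (N * (√2 / 2)) ≤ (correlation ℓ N).re := by
  rw [correlation, Complex.re_sum]
  have : ∀ κ ∈ Finset.range (2 ^ ℓ), (N * (√2 / 2) : ℝ) ≤
      (∑ v ∈ Finset.range (2 ^ ℓ), if residue ℓ N v = 0 then
      cis (2 * Real.pi * revVal ℓ κ * (approxMul ℓ N v / 2 ^ (ℓ + 4) - v / N)) else 0).re := by
    intro κ _
    rw [Complex.re_sum]
    have h0 : (0 : ℝ) ≤ √2 / 2 := by positivity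
    trans ∑ v ∈ Finset.range N, √2 / 2
    · simp
    · trans ∑ v ∈ Finset.range N, (if residue ℓ N v = 0 then
        cis (2 * Real.pi * revVal ℓ κ * (approxMul ℓ N v / 2 ^ (ℓ + 4) - v / N)) else 0).re
      · apply Finset.sum_le_sum
        intro v hv
        rw [Finset.mem_range] at hv
        rw [if_pos (residue_eq_zero hNℓ hv)]
        exact cos_approx_ge hN (revVal_lt _ _) (hv.trans hNℓ)
      · apply Finset.sum_le_sum_of_subset_of_nonneg
        · exact Finset.range_subset_range.2 hNℓ.le
        · intro v hv _
          rw [Finset.mem_range] at hv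
          split_ifs
          · exact h0.trans (cos_approx_ge hN (revVal_lt _ _) hv)
          · simp
  calc (2 : ℝ) ^ ℓ * (N * (√2 / 2)) = ∑ κ ∈ Finset.range (2 ^ ℓ), (N * (√2 / 2) : ℝ) := by simp
    _ ≤ _ := Finset.sum_le_sum this

/-- The factor by which `blockCircuit` attenuates the Fourier transform of order `N`. -/
noncomputable def attenuation (ℓ N : ℕ) : ℂ :=
  (((√2)⁻¹ ^ (5 * ℓ + 6) * √N : ℝ) : ℂ) * correlation ℓ N

/-- The powers of `2 ^ ℓ` cancel: the bound on the correlation gives `2 ^ (-5ℓ/2 - 3) * N ^ (3/2) *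
2 ^ ℓ / √2`, and `N ≥ 2 ^ ℓ / 2` makes this at least `2 ^ (-5)`. Uniformity in `N` is what allows a
constant number of amplification rounds. -/
theorem norm_attenuation_ge {ℓ N : ℕ} (hN : 2 ^ ℓ ≤ 2 * N) (hNℓ : N < 2 ^ ℓ) :
    1 / 32 ≤ ‖attenuation ℓ N‖ := by
  have hN0 : 0 < N := by
    have : 0 < 2 ^ ℓ := by positivity
    omega
  have hre : (attenuation ℓ N).re = (√2)⁻¹ ^ (5 * ℓ + 6) * √N * (correlation ℓ N).re := by
    rw [attenuation, Complex.re_ofReal_mul]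
  refine le_trans ?_ (Complex.re_le_norm _)
  rw [hre]
  have hs2 : √2 * √2 = 2 := Real.mul_self_sqrt (by norm_num)
  have hspos : 0 < √2 := by positivity
  have hinv2 : (√2)⁻¹ ^ 2 = (1 / 2 : ℝ) := by
    rw [inv_pow, sq, hs2]; norm_num
  have hr : (√2)⁻¹ ≤ (√2)⁻¹ ^ ℓ * √N := by
    have h1 : √2 ^ ℓ ≤ √2 * √N := by
      rw [← Real.sqrt_mul (by norm_num)]
      apply Real.le_sqrt_of_sq_le
      rw [← pow_mul, mul_comm, pow_mul, sq, hs2]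
      exact_mod_cast hN
    rw [inv_pow, inv_mul_eq_div, le_div_iff₀ (by positivity), inv_mul_le_iff₀ hspos]
    exact h1
  have h2N : (2 : ℝ) ^ ℓ ≤ 2 * N := by exact_mod_cast hN
  have hcorr := correlation_re_ge hN0 hNℓ
  have hexp : (√2)⁻¹ ^ (5 * ℓ + 6) = (√2)⁻¹ ^ ℓ * ((1 / 2 : ℝ) ^ ℓ * (1 / 2) ^ ℓ * (1 / 8)) := by
    have : (√2)⁻¹ ^ (5 * ℓ + 6) =
        (√2)⁻¹ ^ ℓ * (((√2)⁻¹ ^ 2) ^ ℓ * ((√2)⁻¹ ^ 2) ^ ℓ * ((√2)⁻¹ ^ 2) ^ 3) := by ring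
    rw [this, hinv2]
    norm_num
  calc (1 / 32 : ℝ) = (√2)⁻¹ * ((1 / 2) ^ ℓ * (1 / 2) ^ ℓ * (1 / 8)) *
        (2 ^ ℓ * (2 ^ ℓ / 2 * (√2 / 2))) := by
        have : ((1 / 2 : ℝ)) ^ ℓ * 2 ^ ℓ = 1 := by rw [← mul_pow]; norm_num
        calc (1 / 32 : ℝ) = ((√2)⁻¹ * √2) * (1 * 1 * (1 / 8)) * (1 / 2 * (1 / 2)) := by
              rw [inv_mul_cancel₀ hspos.ne']; norm_num
          _ = ((√2)⁻¹ * √2) * ((((1 / 2 : ℝ)) ^ ℓ * 2 ^ ℓ) * (((1 / 2 : ℝ)) ^ ℓ * 2 ^ ℓ) * (1 / 8)) *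
              (1 / 2 * (1 / 2)) := by rw [this]
          _ = _ := by ring
    _ ≤ ((√2)⁻¹ ^ ℓ * √N) * ((1 / 2) ^ ℓ * (1 / 2) ^ ℓ * (1 / 8)) *
        (2 ^ ℓ * (N * (√2 / 2))) := by
        gcongr
        linarith
    _ = (√2)⁻¹ ^ (5 * ℓ + 6) * √N * (2 ^ ℓ * (N * (√2 / 2))) := by rw [hexp]; ring
    _ ≤ _ := by gcongr

/-! ### Exact amplitude amplification -/

section Amplification

variable {σ I : Type*} [Fintype σ] [DecidableEq σ] [Fintype I] [DecidableEq I]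

/-- Because the compression of `U` to the range of `J` is a multiple of a unitary `G`, the span of
`U J` and `J G` is stable under the product of the two reflections, with the same coefficients for
every input. Unitarity of `G` enters through the compression of `Uᴴ`. -/
theorem amplification_step {U : Matrix σ σ ℂ} {J : Matrix σ I ℂ} {G : Matrix I I ℂ} {s : ℝ}
    (hU : Uᴴ * U = 1) (hJ : Jᴴ * J = 1) (hG : Gᴴ * G = 1) (hs : Jᴴ * U * J = (s : ℂ) • G) :
    let R := 1 - (2 : ℂ) • (J * Jᴴ)
    let Q := U * R * Uᴴ * R
    Q * (U * J) = (4 * s ^ 2 - 1 : ℂ) • (U * J) - (2 * s : ℂ) • (J * G) ∧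
      Q * (J * G) = (2 * s : ℂ) • (U * J) - J * G := by
  intro R Q
  have hU' : U * Uᴴ = 1 := mul_eq_one_comm.1 hU
  have hRa : R * (U * J) = U * J - (2 * s : ℂ) • (J * G) := by
    have : J * Jᴴ * (U * J) = (s : ℂ) • (J * G) := by
      rw [Matrix.mul_assoc, ← Matrix.mul_assoc Jᴴ, hs, Matrix.mul_smul]
    rw [Matrix.sub_mul, Matrix.one_mul, Matrix.smul_mul, this, smul_smul]
  have hRJ : R * J = -J := by
    have : J * Jᴴ * J = J := by rw [Matrix.mul_assoc, hJ, Matrix.mul_one]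
    rw [Matrix.sub_mul, Matrix.one_mul, Matrix.smul_mul, this, two_smul]
    abel
  have hs' : Jᴴ * Uᴴ * J = (s : ℂ) • Gᴴ := by
    have := congrArg Matrix.conjTranspose hs
    rw [Matrix.conjTranspose_mul, Matrix.conjTranspose_mul, Matrix.conjTranspose_conjTranspose,
      Matrix.conjTranspose_smul, ← Matrix.mul_assoc] at this
    rw [this]
    simp
  have hSa : U * R * Uᴴ * (U * J) = -(U * J) := by
    have : U * R * Uᴴ * (U * J) = U * (R * ((Uᴴ * U) * J)) := by simp only [Matrix.mul_assoc]
    rw [this, hU, Matrix.one_mul, hRJ, Matrix.mul_neg]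
  have hSb : U * R * Uᴴ * (J * G) = J * G - (2 * s : ℂ) • (U * J) := by
    have h1 : R * (Uᴴ * (J * G)) = Uᴴ * (J * G) - (2 * s : ℂ) • J := by
      have : J * Jᴴ * (Uᴴ * (J * G)) = (s : ℂ) • J := by
        have : J * Jᴴ * (Uᴴ * (J * G)) = J * ((Jᴴ * Uᴴ * J) * G) := by
          simp only [Matrix.mul_assoc]
        rw [this, hs', Matrix.smul_mul, hG, Matrix.mul_smul, Matrix.mul_one]
      rw [Matrix.sub_mul, Matrix.one_mul, Matrix.smul_mul, this, smul_smul]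
    have h2 : U * R * Uᴴ * (J * G) = U * (R * (Uᴴ * (J * G))) := by simp only [Matrix.mul_assoc]
    rw [h2, h1, Matrix.mul_sub, ← Matrix.mul_assoc, hU', Matrix.one_mul, Matrix.mul_smul]
  constructor
  · have : Q * (U * J) = U * R * Uᴴ * (R * (U * J)) := by simp only [Q, Matrix.mul_assoc]
    rw [this, hRa, Matrix.mul_sub, hSa, Matrix.mul_smul, hSb, smul_sub, smul_smul]
    module
  · have : Q * (J * G) = U * R * Uᴴ * (R * J * G) := by simp only [Q, Matrix.mul_assoc]
    rw [this, hRJ, Matrix.neg_mul, Matrix.mul_neg, hSb]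
    module

/-- Write `U J = sin θ • J G + cos θ • D`. Up to sign, `Q` rotates by `2θ` in the plane of `J G` and
`D`, so `Q ^ j` leads to `sin ((2j + 1) θ) • J G + cos ((2j + 1) θ) • D`. The formula results from
eliminating `D`, which requires `cos θ ≠ 0`. -/
theorem amplification_pow {U : Matrix σ σ ℂ} {J : Matrix σ I ℂ} {G : Matrix I I ℂ} {θ : ℝ}
    (hθ : Real.cos θ ≠ 0)
    (hU : Uᴴ * U = 1) (hJ : Jᴴ * J = 1) (hG : Gᴴ * G = 1)
    (hs : Jᴴ * U * J = (Real.sin θ : ℂ) • G) (j : ℕ) :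
    let R := 1 - (2 : ℂ) • (J * Jᴴ)
    let Q := U * R * Uᴴ * R
    Q ^ j * (U * J) = (-1 : ℂ) ^ j • (((Real.cos ((2 * j + 1) * θ) / Real.cos θ : ℝ) : ℂ) • (U * J) +
      ((Real.sin ((2 * j + 1) * θ) -
        Real.cos ((2 * j + 1) * θ) / Real.cos θ * Real.sin θ : ℝ) : ℂ) • (J * G)) := by
  intro R Q
  obtain ⟨h1, h2⟩ := amplification_step hU hJ hG hs
  induction j with
  | zero =>
    simp [hθ]
  | succ j ih =>
    rw [pow_succ', Matrix.mul_assoc, ih]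
    rw [Matrix.mul_smul, Matrix.mul_add, Matrix.mul_smul, Matrix.mul_smul]
    change (-1 : ℂ) ^ j • ((_ : ℂ) • (U * R * Uᴴ * R * (U * J)) +
      (_ : ℂ) • (U * R * Uᴴ * R * (J * G))) = _
    rw [h1, h2, pow_succ (-1 : ℂ)]
    generalize (-1 : ℂ) ^ j = e
    have hφ : (2 * ((j + 1 : ℕ) : ℝ) + 1) * θ = (2 * j + 1) * θ + 2 * θ := by push_cast; ring
    rw [hφ]
    generalize (2 * (j : ℝ) + 1) * θ = φ
    have e1 : Real.cos (φ + 2 * θ) / Real.cos θ =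
        Real.cos φ / Real.cos θ * (1 - 2 * Real.sin θ ^ 2) - 2 * Real.sin θ * Real.sin φ := by
      rw [Real.cos_add, Real.cos_two_mul', Real.sin_two_mul]
      have := Real.sin_sq_add_cos_sq θ
      field_simp
      rw [← this]
      ring
    have e2 : Real.sin (φ + 2 * θ) - Real.cos (φ + 2 * θ) / Real.cos θ * Real.sin θ =
        Real.sin φ + Real.cos φ / Real.cos θ * Real.sin θ := by
      rw [e1, Real.sin_add, Real.cos_two_mul', Real.sin_two_mul]
      have := Real.sin_sq_add_cos_sq θ
      field_simp
      linear_combination (2 * Real.sin θ * Real.cos φ + Real.cos θ * Real.sin φ) * this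
    rw [e2, e1]
    push_cast
    module

/-- Amplitude amplification: with `θ = π / 106`, after `26` rounds the attenuated operator becomes
exactly the unitary `G`. -/
theorem amplification {U : Matrix σ σ ℂ} {J : Matrix σ I ℂ} {G : Matrix I I ℂ}
    (hU : Uᴴ * U = 1) (hJ : Jᴴ * J = 1) (hG : Gᴴ * G = 1)
    (hs : Jᴴ * U * J = (Real.sin (Real.pi / 106) : ℂ) • G) :
    (U * (1 - (2 : ℂ) • (J * Jᴴ)) * Uᴴ * (1 - (2 : ℂ) • (J * Jᴴ))) ^ 26 * (U * J) = J * G := by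
  have hc : Real.cos (Real.pi / 106) ≠ 0 := by
    apply ne_of_gt
    apply Real.cos_pos_of_mem_Ioo
    constructor <;> linarith [Real.pi_pos]
  have := amplification_pow hc hU hJ hG hs 26
  simp only at this
  rw [this]
  -- Since `53 = 2 * 26 + 1`, the final angle is exactly a right angle and only the component along
  -- `J G` survives.
  have hφ : (2 * ((26 : ℕ) : ℝ) + 1) * (Real.pi / 106) = Real.pi / 2 := by push_cast; ring
  rw [hφ, Real.cos_pi_div_two, Real.sin_pi_div_two, Even.neg_one_pow (by decide)]
  simp

end Amplification

theorem Circuit.toMatrix_replicate {W : Type} [Fintype W] [DecidableEq W] (C : Circuit W)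
    (k : ℕ) : Circuit.toMatrix (List.replicate k C).flatten = Circuit.toMatrix C ^ k := by
  induction k with
  | zero => rfl
  | succ k ih =>
    rw [List.replicate_succ, List.flatten_cons, Circuit.toMatrix_append, ih, pow_succ]

/-- The amplitude amplification circuit for the circuit `U` and the reflection `R`. -/
noncomputable def amplify {W : Type} (U R : Circuit W) : Circuit W :=
  U ++ (List.replicate 26 (R ++ (U.inv ++ (R ++ U)))).flatten

theorem length_amplify {W : Type} (U R : Circuit W) :
    (amplify U R).length = 53 * U.length + 52 * R.length := by
  have h := Circuit.length_inv U
  simp only [amplify, List.length_append, List.length_flatten, List.map_replicate,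
    List.sum_replicate, smul_eq_mul, h]
  ring

/-- The states `c i` are the columns of the isometry `J`. The two conditions on `R` identify it with
`1 - 2 J Jᴴ`, and the condition on the entries of `U` is the compression hypothesis of
`amplification`. -/
theorem run_amplify {W I : Type} [Fintype W] [DecidableEq W] [Fintype I] [DecidableEq I]
    {U R : Circuit W} {c : I → (W → Bool)} (hc : Function.Injective c) {G : Matrix I I ℂ}
    (hG : Gᴴ * G = 1)
    (hs : ∀ i i', Circuit.toMatrix U (c i) (c i') = Real.sin (Real.pi / 106) * G i i')
    (hR : ∀ i, run R (ket (c i)) = -ket (c i))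
    (hR' : ∀ z, z ∉ Set.range c → run R (ket z) = ket z) (i' : I) :
    run (amplify U R) (ket (c i')) = ∑ i, G i i' • ket (c i) := by
  classical
  set J : Matrix (W → Bool) I ℂ := Matrix.of fun z i => ket (c i) z with hJdef
  have hJ : Jᴴ * J = 1 := by
    ext i j
    rw [Matrix.mul_apply]
    simp only [Matrix.conjTranspose_apply, hJdef, Matrix.of_apply, ket_apply]
    rw [Finset.sum_eq_single (c i)]
    · by_cases hij : i = j
      · subst hij; simp
      · rw [Matrix.one_apply_ne hij, if_neg (fun h => hij (hc h)), mul_zero]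
    · intro z _ hz
      simp [hz]
    · simp
  have hRm : Circuit.toMatrix R = 1 - (2 : ℂ) • (J * Jᴴ) := by
    ext y z
    rw [← run_ket_apply, Matrix.sub_apply, Matrix.smul_apply, Matrix.mul_apply]
    simp only [Matrix.conjTranspose_apply, hJdef, Matrix.of_apply, ket_apply]
    by_cases hz : z ∈ Set.range c
    · obtain ⟨i, rfl⟩ := hz
      rw [hR, Finset.sum_eq_single i]
      · by_cases hy : y = c i
        · subst hy; simp [ket_apply]; norm_num
        · rw [Matrix.one_apply_ne hy]
          simp [ket_apply, hy]
      · intro j _ hj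
        rw [if_neg (fun h : c i = c j => hj (hc h).symm), star_zero, mul_zero]
      · simp
    · rw [hR' z hz, Finset.sum_eq_zero, ket_apply]
      · simp [Matrix.one_apply]
      · intro i _
        rw [if_neg (fun h : z = c i => hz ⟨i, h.symm⟩), star_zero, mul_zero]
  have hs' : Jᴴ * Circuit.toMatrix U * J = (Real.sin (Real.pi / 106) : ℂ) • G := by
    ext i j
    have h1 : Circuit.toMatrix U * J = Matrix.of fun z i => Circuit.toMatrix U z (c i) := by
      ext z i
      rw [Matrix.of_apply, ← run_ket_apply]
      rfl
    rw [Matrix.mul_assoc, h1, Matrix.mul_apply, Finset.sum_eq_single (c i)]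
    · simp [hJdef, ket_apply, hs]
    · intro z _ hz
      simp [hJdef, ket_apply, hz]
    · simp
  have key := amplification (Circuit.conjTranspose_mul_self U) hJ hG hs'
  have hA : Circuit.toMatrix (amplify U R) * J = J * G := by
    rw [amplify, Circuit.toMatrix_append, Circuit.toMatrix_replicate, Matrix.mul_assoc, ← key]
    congr 2
    rw [Circuit.toMatrix_append, Circuit.toMatrix_append, Circuit.toMatrix_append,
      Circuit.toMatrix_inv, hRm]
  funext z
  have := congrFun (congrFun hA z) i'
  rw [Matrix.mul_apply, Matrix.mul_apply] at this
  rw [Finset.sum_apply]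
  simp only [Pi.smul_apply, smul_eq_mul]
  refine Eq.trans ?_ (this.trans ?_)
  · rfl
  · exact Finset.sum_congr rfl fun i _ => mul_comm _ _

/-! ### The Fourier transform of order `N` -/

section Reflection

variable {W : Type}

/-- Flip the sign of the basis states in which the register `l` holds a number less than `N`. The
wire `w` extends the register, so that the comparison shows in its sign bit. -/
noncomputable def reflectCircuit (N : ℕ) (l : List W) (w : W) : Circuit W :=
  [phaseGate w Real.pi] ++ (addConst (-N) (l ++ [w]) ++
    ([phaseGate w Real.pi] ++ addConst N (l ++ [w])))

theorem length_reflectCircuit_le (N : ℕ) (l : List W) (w : W) :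
    (reflectCircuit N l w).length ≤ 4 * (l.length + 1) ^ 2 + 2 * (l.length + 1) + 2 := by
  have h1 := length_addConst_le (-N) (l ++ [w])
  have h2 := length_addConst_le N (l ++ [w])
  simp only [List.length_append, List.length_cons, List.length_nil, zero_add] at h1 h2
  simp only [reflectCircuit, List.length_append, List.length_cons, List.length_nil]
  omega

variable [Fintype W] [DecidableEq W]

theorem run_phaseGate_pi (w : W) (x : W → Bool) :
    run [phaseGate w Real.pi] (ket x) = (-1 : ℂ) ^ (x w).toNat • ket x := by
  rw [run_ket_of_diagonal (d := fun x => cis (Real.pi * (x w).toNat))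
    (by rw [Circuit.toMatrix_singleton, toMatrix_phaseGate])]
  cases x w <;> simp [cis]

/-- Subtracting `N` toggles the bit `w` exactly when there is a borrow out of `l`, that is, when
`val l z < N`. The two phase gates multiply the signs of the old and the new bit, so the result does
not depend on the initial value of `w`, and the final addition restores the state. -/
theorem run_reflectCircuit {N : ℕ} {l : List W} {w : W} (hl : (l ++ [w]).Nodup)
    (hN : N ≤ 2 ^ l.length) (z : W → Bool) :
    run (reflectCircuit N l w) (ket z) = (if val l z < N then (-1 : ℂ) else 1) • ket z := by
  have hvz := val_append l [w] z
  rw [val_singleton] at hvz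
  have hlt := val_lt l z
  have hpow : (2 : ℕ) ^ (l ++ [w]).length = 2 ^ l.length + 2 ^ l.length := by
    rw [List.length_append, List.length_singleton, pow_succ, mul_two]
  have key : ∃ z' : W → Bool, (∀ k, k ∉ l ++ [w] → z' k = z k) ∧
      (val (l ++ [w]) z' : ℤ) ≡ val (l ++ [w]) z + (-N : ℤ) [ZMOD 2 ^ (l ++ [w]).length] ∧
      (-1 : ℂ) ^ ((z' w).toNat) * (-1) ^ ((z w).toNat) =
        if val l z < N then (-1 : ℂ) else 1 := by
    -- The state after the subtraction is built from its value `v`, whose top bit is `v / 2 ^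
    -- l.length`.
    have aux : ∀ v : ℕ, v < 2 ^ (l ++ [w]).length →
        ((v : ℤ) ≡ val (l ++ [w]) z + (-N : ℤ) [ZMOD 2 ^ (l ++ [w]).length]) →
        (-1 : ℂ) ^ (v / 2 ^ l.length) * (-1) ^ ((z w).toNat) =
          (if val l z < N then (-1 : ℂ) else 1) → ∃ z' : W → Bool,
          (∀ k, k ∉ l ++ [w] → z' k = z k) ∧
          (val (l ++ [w]) z' : ℤ) ≡ val (l ++ [w]) z + (-N : ℤ) [ZMOD 2 ^ (l ++ [w]).length] ∧
          (-1 : ℂ) ^ ((z' w).toNat) * (-1) ^ ((z w).toNat) =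
            if val l z < N then (-1 : ℂ) else 1 := by
      intro v hv h1 h2
      obtain ⟨z', hz', hval⟩ := exists_val_eq hl z hv
      refine ⟨z', hz', hval ▸ h1, ?_⟩
      rw [← h2, ← hval, val_append, val_singleton, Nat.add_mul_div_left _ _ (by positivity),
        Nat.div_eq_of_lt (val_lt l z'), zero_add]
    by_cases hz : val l z < N
    · cases hw : z w
      · simp only [hw, Bool.toNat_false, mul_zero, add_zero] at hvz aux ⊢
        apply aux (val l z + 2 ^ (l ++ [w]).length - N)
        · omega
        · rw [hvz]
          apply (Int.modEq_iff_dvd).2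
          refine ⟨-1, ?_⟩
          rw [Nat.cast_sub (by omega)]
          push_cast
          ring
        · rw [if_pos hz]
          have : (val l z + 2 ^ (l ++ [w]).length - N) / 2 ^ l.length = 1 := by
            apply Nat.div_eq_of_lt_le <;> omega
          rw [this]
          simp
      · simp only [hw, Bool.toNat_true, mul_one] at hvz aux ⊢
        apply aux (val l z + 2 ^ l.length - N)
        · omega
        · rw [hvz]
          refine Int.modEq_iff_dvd.2 ⟨0, ?_⟩
          rw [Nat.cast_sub (by omega)]
          push_cast
          ring
        · rw [if_pos hz, Nat.div_eq_of_lt (by omega)]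
          simp
    · apply aux (val l z + 2 ^ l.length * (z w).toNat - N)
      · cases hw : z w <;> simp <;> omega
      · rw [hvz]
        refine Int.modEq_iff_dvd.2 ⟨0, ?_⟩
        rw [Nat.cast_sub (by omega)]
        push_cast
        ring
      · rw [if_neg hz]
        have : val l z + 2 ^ l.length * (z w).toNat - N =
            (val l z - N) + 2 ^ l.length * (z w).toNat := by omega
        rw [this, Nat.add_mul_div_left _ _ (by positivity), Nat.div_eq_of_lt (by omega), zero_add,
          ← mul_pow]
        simp
  obtain ⟨z', hz', hval, hsign⟩ := key
  rw [reflectCircuit, run_append, run_append, run_append, run_phaseGate_pi, run_smul,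
    run_addConst hl hz' hval, run_smul, run_phaseGate_pi, run_smul, run_smul,
    run_addConst (x' := z) hl (fun k hk => (hz' k hk).symm), smul_smul, mul_comm, hsign]
  have h := (hval.add_right N).symm
  rwa [neg_add_cancel_right] at h

end Reflection

/-! ### Lowering an amplitude with an ancilla -/

section Rotation

variable {W : Type}

/-- A single-qubit gate whose upper left entry is `γ`. -/
noncomputable def rotationGate (w : W) (γ : ℂ) (hγ : ‖γ‖ ≤ 1) : Gate W :=
  .one w ⟨Matrix.of fun b c => match b, c with
    | false, false => γ
    | true, false => (Real.sqrt (1 - ‖γ‖ ^ 2) : ℂ)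
    | false, true => -(Real.sqrt (1 - ‖γ‖ ^ 2) : ℂ)
    | true, true => star γ, by
    have h : ((Real.sqrt (1 - ‖γ‖ ^ 2) : ℝ) : ℂ) * (Real.sqrt (1 - ‖γ‖ ^ 2) : ℝ) =
        1 - (‖γ‖ : ℂ) ^ 2 := by
      rw [← Complex.ofReal_mul, Real.mul_self_sqrt]
      · push_cast; ring
      · have := norm_nonneg γ
        nlinarith
    have h' : star γ * γ = (‖γ‖ : ℂ) ^ 2 := Complex.conj_mul' γ
    rw [Complex.star_def] at h'
    rw [Matrix.mem_unitaryGroup_iff', Matrix.star_eq_conjTranspose]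
    ext b c
    rw [Matrix.mul_apply, Fintype.sum_bool]
    cases b <;> cases c <;> simp only [Matrix.conjTranspose_apply, Matrix.of_apply,
      Matrix.one_apply, Complex.star_def, Complex.conj_ofReal, map_neg, Complex.conj_conj,
      if_true, reduceCtorEq, if_false]
    · linear_combination h + h'
    · ring
    · ring
    · linear_combination h + h'⟩

variable [Fintype W] [DecidableEq W]

/-- The gate sends `|0⟩` to `γ|0⟩` plus a multiple of `|1⟩`, and by `hy` the second branch does not
reach `y`. -/
theorem toMatrix_rotationGate_cons {w : W} {γ : ℂ} (hγ : ‖γ‖ ≤ 1) (C : Circuit W) {x y : W → Bool}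
    (hx : x w = false)
    (hy : Circuit.toMatrix C y (Function.update x w true) = 0) :
    Circuit.toMatrix (rotationGate w γ hγ :: C) y x = γ * Circuit.toMatrix C y x := by
  rw [Circuit.toMatrix, Matrix.mul_apply, rotationGate]
  generalize hU : (⟨_, _⟩ : Matrix.unitaryGroup Bool ℂ) = U
  rw [sum_agree_one w x _ (fun z => Circuit.toMatrix C y z * U.1 (z w) (x w))]
  · have hx' : Function.update x w false = x := by rw [← hx, Function.update_eq_self]
    rw [Fintype.sum_bool, hy, zero_mul, zero_add, hx', hx, mul_comm, ← hU]
    rfl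
  · intro z hz
    rw [Gate.toMatrix_one _ hz]
  · intro z hz
    rw [Gate.toMatrix_one_eq_zero _ hz, mul_zero]

end Rotation

/-- The matrix of the Fourier transform of order `N`. -/
noncomputable def fourierMatrix (N : ℕ) [NeZero N] : Matrix (ZMod N) (ZMod N) ℂ :=
  Matrix.of fun y x => ((√N : ℝ) : ℂ)⁻¹ * ZMod.stdAddChar (x * y)

theorem stdAddChar_natCast {N : ℕ} [NeZero N] (k : ℕ) :
    ZMod.stdAddChar (k : ZMod N) = cis (2 * Real.pi / N * k) := by
  have h := ZMod.stdAddChar_coe (N := N) (k : ℤ)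
  simp only [Int.cast_natCast] at h
  rw [h, cis]
  congr 1
  push_cast
  ring

theorem stdAddChar_mul_eq_cis {N : ℕ} [NeZero N] (x y : ZMod N) :
    ZMod.stdAddChar (x * y) = cis (2 * Real.pi / N * (x.val * y.val)) := by
  have h := stdAddChar_natCast (N := N) (x.val * y.val)
  push_cast at h
  simpa using h

theorem star_stdAddChar {N : ℕ} [NeZero N] (x : ZMod N) :
    star (ZMod.stdAddChar x) = ZMod.stdAddChar (-x) := by
  rw [AddChar.map_neg_eq_conj]
  rfl

theorem fourierMatrix_unitary (N : ℕ) [NeZero N] :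
    (fourierMatrix N)ᴴ * fourierMatrix N = 1 := by
  have hN : (N : ℂ) ≠ 0 := NeZero.ne _
  have hs : ((√N : ℝ) : ℂ)⁻¹ * ((√N : ℝ) : ℂ)⁻¹ = (N : ℂ)⁻¹ := by
    rw [← mul_inv, ← Complex.ofReal_mul, Real.mul_self_sqrt (by positivity)]
    simp
  ext x x'
  rw [Matrix.mul_apply]
  have : ∀ y, (fourierMatrix N)ᴴ x y * fourierMatrix N y x' =
      (N : ℂ)⁻¹ * ZMod.stdAddChar (y * (x' - x)) := by
    intro y
    simp only [Matrix.conjTranspose_apply, fourierMatrix, Matrix.of_apply, star_mul',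
      star_stdAddChar]
    rw [show y * (x' - x) = -(x * y) + x' * y by ring, AddChar.map_add_eq_mul, ← hs]
    simp only [Complex.star_def, map_inv₀, Complex.conj_ofReal]
    ring
  rw [Finset.sum_congr rfl fun y _ => this y, ← Finset.mul_sum,
    AddChar.sum_mulShift _ (ZMod.isPrimitive_stdAddChar N), ZMod.card]
  by_cases h : x = x'
  · subst h
    simp [hN]
  · rw [Matrix.one_apply_ne h, if_neg (sub_ne_zero.2 (Ne.symm h)), Nat.cast_zero, mul_zero]

/-- The wires of a Fourier transform circuit. -/
abbrev FWires (ℓ : ℕ) : Type := Σ r, Fin (rsize ℓ r)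

/-- The wire of the flag. -/
def flagWire (ℓ : ℕ) : FWires ℓ := ⟨.F, (0 : Fin 1)⟩

/-- The wire of the rotation. -/
def rotationWire (ℓ : ℕ) : FWires ℓ := ⟨.A, (0 : Fin 1)⟩

/-- The basis state that holds `x` in the register `X` and the flag `f`. -/
def fstate (ℓ x f : ℕ) : FWires ℓ → Bool := cfg (st x 0 0 0 0 0 0 0 0 f)

theorem fstate_injective {ℓ x f x' f' : ℕ} (hx : x < 2 ^ ℓ) (hx' : x' < 2 ^ ℓ) (hf : f < 2)
    (hf' : f' < 2) (h : fstate ℓ x f = fstate ℓ x' f') : x = x' ∧ f = f' := by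
  rw [fstate, fstate, cfg_eq_iff] at h
  · exact ⟨congrFun h .X, congrFun h .F⟩
  · intro r
    cases r <;> simp [st, rsize, hx, hf]
  · intro r
    cases r <;> simp [st, rsize, hx', hf']

/-- The reflection about the basis states that hold a number less than `N` in the register `X`
and zero in all the other registers but the flag. -/
noncomputable def fourierReflect (ℓ N : ℕ) : Circuit (FWires ℓ) :=
  reflectCircuit N (regs (rsize ℓ) [.X, .B, .V, .Y, .K, .T, .P, .S, .A]) (flagWire ℓ)

theorem run_fourierReflect {ℓ N : ℕ} (hN : N < 2 ^ ℓ) (z : FWires ℓ → Bool) :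
    run (fourierReflect ℓ N) (ket z) =
      (if val (regs (rsize ℓ) [.X, .B, .V, .Y, .K, .T, .P, .S, .A]) z < N then (-1 : ℂ) else 1) •
        ket z := by
  apply run_reflectCircuit
  · have h : [flagWire ℓ] = regs (rsize ℓ) [.F] := by
      rw [regs_singleton]
      rfl
    rw [h, regs, regs, ← List.flatMap_append]
    exact nodup_regs (by decide)
  · apply hN.le.trans
    rw [length_regs]
    apply Nat.pow_le_pow_right (by norm_num)
    simp only [List.map_cons, List.sum_cons, rsize]
    omega

/-- `X` supplies the least significant bits, so any other nonzero bit makes the number at least `2 ^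
ℓ > N`. One comparison tests both that `X` is below `N` and that the work space is clean. -/
theorem val_lt_iff_fstate {ℓ N : ℕ} (hN : N < 2 ^ ℓ) (z : FWires ℓ → Bool) :
    val (regs (rsize ℓ) [.X, .B, .V, .Y, .K, .T, .P, .S, .A]) z < N ↔
      ∃ x < N, ∃ f < 2, fstate ℓ x f = z := by
  rw [regs_cons, val_append, length_reg]
  constructor
  · intro h
    have h0 : val (regs (rsize ℓ) [.B, .V, .Y, .K, .T, .P, .S, .A]) z = 0 := by
      by_contra h0
      have h1 : 1 ≤ val (regs (rsize ℓ) [.B, .V, .Y, .K, .T, .P, .S, .A]) z :=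
        Nat.one_le_iff_ne_zero.2 h0
      have h2 := Nat.mul_le_mul_left (2 ^ ℓ) h1
      change _ + 2 ^ ℓ * _ < N at h
      omega
    rw [h0, mul_zero, add_zero] at h
    rw [val_eq_zero_iff] at h0
    refine ⟨_, h, val (reg (rsize ℓ) .F) z, ?_, ?_⟩
    · exact (val_lt _ _).trans_eq (by rw [length_reg]; rfl)
    · conv_rhs => rw [← cfg_val z]
      rw [fstate]
      congr 1
      funext r
      have hr : r ≠ .X → r ≠ .F → 0 = val (reg (rsize ℓ) r) z := by
        intro h1 h2
        symm
        rw [val_eq_zero_iff]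
        intro w hw
        apply h0
        rw [mem_regs, mem_reg.1 hw]
        revert h1 h2
        cases r <;> decide
      cases r <;> first | rfl | exact hr (by decide) (by decide)
  · rintro ⟨x, hx, f, hf, rfl⟩
    have h0 : val (regs (rsize ℓ) [.B, .V, .Y, .K, .T, .P, .S, .A]) (fstate ℓ x f) = 0 := by
      rw [val_eq_zero_iff]
      rintro ⟨r, i⟩ hw
      rw [mem_regs] at hw
      cases r <;> simp [fstate, cfg, st] at hw ⊢
    rw [h0, mul_zero, add_zero, fstate, val_reg_cfg]
    exact (Nat.mod_le _ _).trans_lt hx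

/-! ### Gate counts and the exact Fourier transform of order `N` -/

theorem length_addReg_le_of_le {W : Type} {T : ℕ} (c : ℤ) {l l' : List W} (hl : l.length ≤ T)
    (hl' : l'.length ≤ T) : (addReg c l l').length ≤ 3 * T ^ 2 := by
  have h1 := length_addReg_le c l l'
  have h2 := Nat.mul_le_mul hl hl
  have h3 := Nat.mul_le_mul hl hl'
  nlinarith

theorem length_addConst_le_of_le {W : Type} {T : ℕ} (c : ℤ) {l : List W} (hl : l.length ≤ T) :
    (addConst c l).length ≤ 3 * T ^ 2 := by
  have h1 := length_addConst_le c l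
  have h2 := Nat.mul_le_mul hl hl
  have h3 := Nat.le_self_pow two_ne_zero l.length
  nlinarith

theorem length_qftCircuit_le_of_le {W : Type} {T : ℕ} {l : List W} (hl : l.length ≤ T) :
    (qftCircuit l).length ≤ T ^ 2 :=
  (length_qftCircuit_le l).trans (Nat.pow_le_pow_left hl 2)

theorem length_bphase_le_of_le {W : Type} {T : ℕ} (θ : ℝ) {l l' : List W} (hl : l.length ≤ T)
    (hl' : l'.length ≤ T) : (bphase θ l l').length ≤ T ^ 2 :=
  (length_bphase_le θ l l').trans ((Nat.mul_le_mul hl hl').trans_eq (sq T).symm)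

/-- `7 * ℓ + 16` is the total number of wires, hence bounds every register. The factor is `36 + 1 +
12`: preparation, transform, test. -/
theorem length_blockCircuit_le (ℓ N : ℕ) :
    (blockCircuit ℓ N).length ≤ 49 * (7 * ℓ + 16) ^ 2 := by
  have h1 : ∀ r, (reg (rsize ℓ) r).length ≤ 7 * ℓ + 16 := by
    intro r
    rw [length_reg]
    cases r <;> simp only [rsize] <;> omega
  have h2 : ∀ r, (reg (rsize ℓ) r).reverse.length ≤ 7 * ℓ + 16 := by
    intro r
    rw [List.length_reverse]
    exact h1 r
  have h3 : ∀ r, (regs (rsize ℓ) [r]).length ≤ 7 * ℓ + 16 := by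
    intro r
    rw [regs_singleton]
    exact h1 r
  have h4 : (regs (rsize ℓ) [.T, .K]).length ≤ 7 * ℓ + 16 := by
    rw [length_regs]
    simp only [List.map_cons, List.map_nil, List.sum_cons, List.sum_nil, rsize]
    omega
  have h5 : (regs (rsize ℓ) [.P, .S]).length ≤ 7 * ℓ + 16 := by
    rw [length_regs]
    simp only [List.map_cons, List.map_nil, List.sum_cons, List.sum_nil, rsize]
    omega
  have hm : ∀ R, (moveCircuit ℓ R).length ≤ 6 * (7 * ℓ + 16) ^ 2 := by
    intro R
    have e1 := length_addReg_le_of_le 1 (h3 R) (h3 .X)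
    have e2 := length_addReg_le_of_le (-1) (h3 .X) (h3 R)
    rw [moveCircuit, List.length_append]
    omega
  have ha : (approxCircuit ℓ N).length ≤ 24 * (7 * ℓ + 16) ^ 2 := by
    have e1 := length_addReg_le_of_le (2 ^ (ℓ + 4 + (ℓ + 4)) / N : ℕ) h5 (h3 .V)
    have e2 := length_addReg_le_of_le 1 h4 (h3 .S)
    have e3 := length_addReg_le_of_le (-(2 ^ (ℓ + 4 + (ℓ + 4)) / N : ℕ)) h5 (h3 .V)
    have e4 := length_addReg_le_of_le N h5 h4
    have e5 := length_addConst_le_of_le (2 ^ (ℓ + 3)) h5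
    have e6 := length_addReg_le_of_le (-1) (h3 .V) (h3 .S)
    have e7 := length_addConst_le_of_le (-2 ^ (ℓ + 3)) h5
    have e8 := length_addReg_le_of_le (-N) h5 h4
    simp only [approxCircuit, List.length_append]
    omega
  have hp : (prepCircuit ℓ N).length ≤ 36 * (7 * ℓ + 16) ^ 2 := by
    have e1 := hm .B
    have e2 := length_qftCircuit_le_of_le (h1 .V)
    have e3 := length_qftCircuit_le_of_le (h1 .Y)
    have e4 := length_bphase_le_of_le (2 * Real.pi / N) (h3 .B) (h3 .Y)
    have e5 := length_addReg_le_of_le 1 (h3 .B) (h3 .V)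
    simp only [prepCircuit, List.length_append]
    omega
  have ht : (testCircuit ℓ N).length ≤ 12 * (7 * ℓ + 16) ^ 2 := by
    have e1 := hm .Y
    have e2 := length_qftCircuit_le_of_le (h1 .B)
    have e3 := length_qftCircuit_le_of_le (h1 .K)
    have e4 := length_bphase_le_of_le (2 * Real.pi / N) (h3 .B) (h2 .K)
    have e5 := length_addReg_le_of_le 1 (h3 .Y) (h2 .K)
    simp only [testCircuit, List.length_append]
    omega
  have e := length_qftCircuit_le_of_le h4
  simp only [blockCircuit, List.length_append, Circuit.length_inv]
  omega

/-- The rotation that makes the amplitude of `blockCircuit` equal to `sin (π / 106)`. -/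
noncomputable def rotationAmplitude (ℓ N : ℕ) : ℂ := Real.sin (Real.pi / 106) / attenuation ℓ N

theorem norm_rotationAmplitude_le {ℓ N : ℕ} (hN : 2 ^ ℓ ≤ 2 * N) (hNℓ : N < 2 ^ ℓ) :
    ‖rotationAmplitude ℓ N‖ ≤ 1 := by
  have h1 := norm_attenuation_ge hN hNℓ
  have hpi := Real.pi_pos
  -- From `π < 3.15`: the target amplitude lies below the guaranteed one, so the rotation is
  -- possible.
  have h2 : Real.sin (Real.pi / 106) ≤ 1 / 32 :=
    (Real.sin_le (by positivity)).trans (by linarith [Real.pi_lt_d2])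
  have h3 : 0 ≤ Real.sin (Real.pi / 106) :=
    Real.sin_nonneg_of_nonneg_of_le_pi (by positivity) (by linarith)
  rw [rotationAmplitude, norm_div, Complex.norm_real, Real.norm_of_nonneg h3,
    div_le_one (by linarith)]
  linarith

/-- The circuit of the Fourier transform of order `N`. -/
noncomputable def fourierCircuit {ℓ N : ℕ} (hN : 2 ^ ℓ ≤ 2 * N) (hNℓ : N < 2 ^ ℓ) :
    Circuit (FWires ℓ) :=
  amplify (rotationGate (rotationWire ℓ) (rotationAmplitude ℓ N) (norm_rotationAmplitude_le hN hNℓ) ::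
    blockCircuit ℓ N) (fourierReflect ℓ N)

/-- The reflection uses the flag as its sign bit and ignores its value, so the encoded states must
include both values. The amplified unitary is therefore the Fourier matrix tensored with the
identity on the flag. -/
theorem run_fourierCircuit {ℓ N : ℕ} [NeZero N] (hN : 2 ^ ℓ ≤ 2 * N) (hNℓ : N < 2 ^ ℓ)
    (x : ZMod N) (f : Fin 2) :
    run (fourierCircuit hN hNℓ) (ket (fstate ℓ x.val f)) =
      ∑ y : ZMod N, fourierMatrix N y x • ket (fstate ℓ y.val f) := by
  have hlt : ∀ x : ZMod N, x.val < 2 ^ ℓ := fun x => (ZMod.val_lt x).trans hNℓ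
  have hN0 : (0 : ℝ) < N := by exact_mod_cast NeZero.pos N
  have key := run_amplify
    (U := rotationGate (rotationWire ℓ) (rotationAmplitude ℓ N) (norm_rotationAmplitude_le hN hNℓ) ::
      blockCircuit ℓ N) (R := fourierReflect ℓ N)
    (c := fun i : ZMod N × Fin 2 => fstate ℓ i.1.val i.2)
    (G := Matrix.kronecker (fourierMatrix N) (1 : Matrix (Fin 2) (Fin 2) ℂ)) ?_ ?_ ?_ ?_ ?_ (x, f)
  · rw [fourierCircuit, key, Fintype.sum_prod_type]
    apply Finset.sum_congr rfl
    intro y _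
    rw [Finset.sum_eq_single f]
    · simp [Matrix.kronecker]
    · intro g _ hg
      simp [Matrix.kronecker, Matrix.one_apply_ne hg]
    · simp
  · rintro ⟨x, f⟩ ⟨x', f'⟩ h
    obtain ⟨h1, h2⟩ := fstate_injective (hlt _) (hlt _) f.2 f'.2 h
    exact Prod.ext (ZMod.val_injective N h1) (Fin.ext h2)
  · rw [Matrix.kronecker, Matrix.conjTranspose_kronecker, ← Matrix.mul_kronecker_mul,
      fourierMatrix_unitary, Matrix.conjTranspose_one, Matrix.one_mul, Matrix.one_kronecker_one]
  · rintro ⟨y, f'⟩ ⟨x, f⟩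
    have hupd : Function.update (fstate ℓ x.val f) (rotationWire ℓ) true =
        cfg (st x.val 0 0 0 0 0 0 0 1 f) := by
      funext ⟨r, i⟩
      cases r
      case A =>
        have : i = (0 : Fin 1) := Subsingleton.elim (α := Fin 1) _ _
        subst this
        refine (Function.update_self (β := fun _ => Bool) (rotationWire ℓ) true _).trans ?_
        simp [cfg, st]
      all_goals rfl
    have hentry := toMatrix_blockCircuit ℓ N x.val y.val 0 f 0 f' (hlt x) (hlt y) (by norm_num)
      (by norm_num) f.2 f'.2
    -- The block circuit leaves `A` alone, so the branch `A = 1` of the rotation has no amplitude to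
    -- return to `A = 0`.
    have hentry' := toMatrix_blockCircuit ℓ N x.val y.val 1 f 0 f' (hlt x) (hlt y) (by norm_num)
      (by norm_num) f.2 f'.2
    simp only [zero_ne_one, false_and, if_false] at hentry'
    rw [toMatrix_rotationGate_cons (norm_rotationAmplitude_le hN hNℓ) _ (by simp [fstate, cfg, st, rotationWire])
      (by rw [hupd]; exact hentry'), fstate, fstate, hentry]
    by_cases hf : f' = f
    · subst hf
      have hatt : attenuation ℓ N ≠ 0 := by
        have := norm_attenuation_ge hN hNℓ
        rw [← norm_pos_iff]
        linarith
      have hs : ((√N : ℝ) : ℂ) ≠ 0 := by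
        exact_mod_cast (Real.sqrt_pos.2 hN0).ne'
      have hcorr : (((√2)⁻¹ ^ (5 * ℓ + 6) : ℝ) : ℂ) * correlation ℓ N =
          attenuation ℓ N * ((√N : ℝ) : ℂ)⁻¹ := by
        rw [attenuation, Complex.ofReal_mul]
        field_simp
      simp only [true_and, if_true, Matrix.kronecker, Matrix.kroneckerMap_apply,
        Matrix.one_apply_eq, mul_one, fourierMatrix, Matrix.of_apply, stdAddChar_mul_eq_cis]
      rw [mul_right_comm, hcorr, rotationAmplitude]
      field_simp
    · rw [if_neg (fun h => hf (Fin.ext h.2))]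
      simp [Matrix.kronecker, Matrix.one_apply_ne hf]
  · rintro ⟨x, f⟩
    rw [run_fourierReflect hNℓ, if_pos ((val_lt_iff_fstate hNℓ _).2
      ⟨_, ZMod.val_lt x, f, f.2, rfl⟩), neg_one_smul]
  · intro z hz
    rw [run_fourierReflect hNℓ, if_neg, one_smul]
    intro h
    obtain ⟨x, hx, f, hf, rfl⟩ := (val_lt_iff_fstate hNℓ _).1 h
    exact hz ⟨((x : ZMod N), ⟨f, hf⟩), by simp [ZMod.val_cast_of_lt hx]⟩

theorem length_fourierCircuit_le {ℓ N : ℕ} (hN : 2 ^ ℓ ≤ 2 * N) (hNℓ : N < 2 ^ ℓ) :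
    (fourierCircuit hN hNℓ).length ≤ 3100 * (7 * ℓ + 16) ^ 2 := by
  have h1 := length_blockCircuit_le ℓ N
  have h2 : (fourierReflect ℓ N).length ≤ 4 * (7 * ℓ + 16) ^ 2 + 2 * (7 * ℓ + 16) + 2 := by
    apply (length_reflectCircuit_le _ _ _).trans_eq
    have : (regs (rsize ℓ) [.X, .B, .V, .Y, .K, .T, .P, .S, .A]).length + 1 = 7 * ℓ + 16 := by
      rw [length_regs]
      simp only [List.map_cons, List.map_nil, List.sum_cons, List.sum_nil, rsize]
      omega
    rw [this]
  rw [fourierCircuit, length_amplify, List.length_cons]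
  nlinarith

/-! ### Arithmetic modulo `N` on several registers -/

theorem run_map {V W T : Type} [Fintype V] [DecidableEq V] [Fintype W] [DecidableEq W] [Fintype T]
    (f : V ↪ W) {C : Circuit V} {x : W → Bool} {a : T → ℂ} {z : T → V → Bool} {z' : T → W → Bool}
    (hC : run C (ket (x ∘ f)) = ∑ t, a t • ket (z t))
    (hz : ∀ t k, k ∉ Set.range f → z' t k = x k) (hz' : ∀ t, z' t ∘ f = z t) :
    run (C.map f) (ket x) = ∑ t, a t • ket (z' t) := by
  funext y
  rw [run_ket_apply, Finset.sum_apply]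
  by_cases h : ∀ k, k ∉ Set.range f → y k = x k
  · rw [Circuit.toMatrix_map f C h, ← run_ket_apply, hC, Finset.sum_apply]
    apply Finset.sum_congr rfl
    intro t _
    have : y ∘ f = z t ↔ y = z' t := by
      constructor
      · intro hy
        funext k
        by_cases hk : k ∈ Set.range f
        · obtain ⟨i, rfl⟩ := hk
          exact (congrFun hy i).trans (congrFun (hz' t) i).symm
        · rw [h k hk, hz t k hk]
      · rintro rfl
        exact hz' t
    simp only [Pi.smul_apply, ket_apply, this]
  · rw [Circuit.toMatrix_map_eq_zero f C h, Finset.sum_eq_zero]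
    intro t _
    have : y ≠ z' t := by
      rintro rfl
      exact h fun k hk => hz t k hk
    simp [ket_apply, this]

section Arithmetic

variable {ι : Type} {ℓ N : ℕ}

/-- Registers labelled by `ι`, and the work space of a Fourier transform circuit. -/
abbrev AWires (ι : Type) (ℓ : ℕ) : Type := (ι × Fin ℓ) ⊕ FWires ℓ

/-- The basis state that holds the residues `v`, with a clean work space. -/
def enc (ℓ : ℕ) (v : ι → ZMod N) : AWires ι ℓ → Bool :=
  Sum.elim (fun p => (v p.1).val.testBit p.2) fun _ => false

/-- The wires of a Fourier transform of the register `i`. -/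
def fourierWires (ℓ : ℕ) (i : ι) : FWires ℓ ↪ AWires ι ℓ where
  toFun
    -- All registers share one work space, whose own `X` wires stay idle.
    | ⟨.X, k⟩ => .inl (i, k)
    | w => .inr w
  inj' := by
    rintro ⟨r, k⟩ ⟨s, m⟩ h
    cases r <;> cases s <;> simp at h ⊢ <;> first | exact h | exact (Prod.ext_iff.1 h).2

theorem enc_comp_fourierWires (v : ι → ZMod N) (i : ι) :
    enc ℓ v ∘ fourierWires ℓ i = fstate ℓ (v i).val 0 := by
  funext ⟨r, k⟩
  cases r <;> first | rfl | exact (Nat.zero_testBit _).symm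

/-- The wires of the register `i`. -/
def wiresOf (ℓ : ℕ) (i : ι) : List (AWires ι ℓ) := (List.finRange ℓ).map fun k => .inl (i, k)

theorem length_wiresOf (i : ι) : (wiresOf ℓ i).length = ℓ := by simp [wiresOf]

theorem disjoint_wiresOf {i j : ι} (hij : i ≠ j) : (wiresOf ℓ i).Disjoint (wiresOf ℓ j) := by
  rw [List.disjoint_left]
  intro w h1 h2
  simp only [wiresOf, List.mem_map] at h1 h2
  obtain ⟨k, -, rfl⟩ := h1
  obtain ⟨m, -, h⟩ := h2
  simp only [Sum.inl.injEq, Prod.mk.injEq] at h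
  exact hij h.1.symm

variable [NeZero N]

theorem val_wiresOf_enc (hNℓ : N < 2 ^ ℓ) (v : ι → ZMod N) (i : ι) :
    val (wiresOf ℓ i) (enc ℓ v) = (v i).val := by
  rw [val_of_testBit (v := (v i).val), length_wiresOf, Nat.mod_eq_of_lt]
  · exact (ZMod.val_lt _).trans hNℓ
  · intro k hk
    simp [wiresOf, enc]

/-- The Fourier transform of order `N` of the register `i`. -/
noncomputable def fourierAt (hN : 2 ^ ℓ ≤ 2 * N) (hNℓ : N < 2 ^ ℓ) (i : ι) :
    Circuit (AWires ι ℓ) :=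
  (fourierCircuit hN hNℓ).map (fourierWires ℓ i)

/-- Add `c` times the register `j` to the register `i`, modulo `N`. -/
noncomputable def addMod (hN : 2 ^ ℓ ≤ 2 * N) (hNℓ : N < 2 ^ ℓ) (i j : ι) (c : ZMod N) :
    Circuit (AWires ι ℓ) :=
  fourierAt hN hNℓ i ++ (bphase (2 * Real.pi / N * c.val) (wiresOf ℓ i) (wiresOf ℓ j) ++
    (fourierAt hN hNℓ i).inv)

theorem length_addMod_le (hN : 2 ^ ℓ ≤ 2 * N) (hNℓ : N < 2 ^ ℓ) (i j : ι) (c : ZMod N) :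
    (addMod hN hNℓ i j c).length ≤ 6201 * (7 * ℓ + 16) ^ 2 := by
  have h1 := length_fourierCircuit_le hN hNℓ
  have h2 := length_bphase_le_of_le (T := 7 * ℓ + 16) (2 * Real.pi / N * c.val)
    (l := wiresOf ℓ i) (l' := wiresOf ℓ j) (by rw [length_wiresOf]; omega)
    (by rw [length_wiresOf]; omega)
  simp only [addMod, fourierAt, List.length_append, Circuit.length_inv, Circuit.length_map]
  omega

variable [Fintype ι] [DecidableEq ι] (hN : 2 ^ ℓ ≤ 2 * N) (hNℓ : N < 2 ^ ℓ)

theorem run_fourierAt (i : ι) (v : ι → ZMod N) :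
    run (fourierAt hN hNℓ i) (ket (enc ℓ v)) =
      ∑ t, fourierMatrix N t (v i) • ket (enc ℓ (Function.update v i t)) := by
  have h := run_fourierCircuit hN hNℓ (v i) 0
  refine run_map (fourierWires ℓ i) (z := fun t : ZMod N => fstate ℓ t.val 0) ?_ ?_ ?_
  · rw [enc_comp_fourierWires]
    exact h
  · rintro t (⟨j, k⟩ | w) hk
    · have : j ≠ i := by
        rintro rfl
        exact hk ⟨⟨.X, k⟩, rfl⟩
      simp [enc, this]
    · rfl
  · intro t
    rw [enc_comp_fourierWires, Function.update_self]

/-- Running the forward transform on the claimed result gives the basis state back, by unitarity of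
`fourierMatrix`. -/
theorem run_fourierAt_inv (i : ι) (v : ι → ZMod N) :
    run (fourierAt hN hNℓ i).inv (ket (enc ℓ v)) =
      ∑ t, star (fourierMatrix N (v i) t) • ket (enc ℓ (Function.update v i t)) := by
  rw [← run_inv_run (fourierAt hN hNℓ i)
    (∑ t, star (fourierMatrix N (v i) t) • ket (enc ℓ (Function.update v i t)))]
  congr 1
  rw [run_sum]
  simp only [run_smul, run_fourierAt, Function.update_self, Function.update_idem, Finset.smul_sum,
    smul_smul]
  rw [Finset.sum_comm]
  have h : ∀ s, ∑ t, (star (fourierMatrix N (v i) t) * fourierMatrix N s t) •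
      ket (enc ℓ (Function.update v i s)) =
      (1 : Matrix _ _ ℂ) s (v i) • ket (enc ℓ (Function.update v i s)) := by
    intro s
    rw [← Finset.sum_smul, ← mul_eq_one_comm.1 (fourierMatrix_unitary N), Matrix.mul_apply]
    simp only [Matrix.conjTranspose_apply, mul_comm]
  rw [Finset.sum_congr rfl fun s _ => h s, Finset.sum_eq_single (v i)]
  · simp
  · intro s _ hs
    rw [Matrix.one_apply_ne hs, zero_smul]
  · simp

/-- The shift theorem of order `N`: adding `c * v j` multiplies the coefficient at `t` by `e^{2πi c
t v_j / N}`, which is a product of controlled phases. -/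
theorem run_addMod {i j : ι} (hij : i ≠ j) (c : ZMod N) (v : ι → ZMod N) :
    run (addMod hN hNℓ i j c) (ket (enc ℓ v)) =
      ket (enc ℓ (Function.update v i (v i + c * v j))) := by
  apply run_conj_diagonal (toMatrix_bphase _ (disjoint_wiresOf hij))
  intro y
  simp only [run_fourierAt, Function.update_self, Function.update_idem, Finset.sum_apply,
    Finset.mul_sum, Pi.smul_apply, smul_eq_mul, ket_apply]
  apply Finset.sum_congr rfl
  intro t _
  split_ifs with h
  · subst h
    rw [val_wiresOf_enc hNℓ, val_wiresOf_enc hNℓ, Function.update_self,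
      Function.update_of_ne hij.symm]
    have hc := stdAddChar_natCast (N := N) (c.val * (t.val * (v j).val))
    push_cast at hc
    simp only [ZMod.natCast_val, ZMod.cast_id', id_eq] at hc
    have h2 : (2 * Real.pi / N * c.val * (t.val * (v j).val) : ℝ) =
        2 * Real.pi / N * (c.val * (t.val * (v j).val)) := by ring
    rw [h2, ZMod.natCast_val, ZMod.natCast_val, ZMod.natCast_val, ← hc]
    simp only [fourierMatrix, Matrix.of_apply]
    rw [show (v i + c * v j) * t = v i * t + c * (t * v j) by ring, AddChar.map_add_eq_mul]
    ring
  · simp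

/-- The circuit of the linear map `v ↦ v + C v`, for a matrix `C` whose targets are not sources. -/
noncomputable def linearCircuit (C : Matrix ι ι (ZMod N)) : Circuit (AWires ι ℓ) :=
  (Finset.univ : Finset ι).toList.flatMap fun i =>
    (Finset.univ.erase i).toList.flatMap fun j => addMod hN hNℓ i j (C i j)

theorem length_flatMap_le {α β : Type*} (l : List α) (f : α → List β) {m : ℕ}
    (h : ∀ a ∈ l, (f a).length ≤ m) : (l.flatMap f).length ≤ l.length * m := by
  induction l with
  | nil => simp
  | cons a l ih =>
    have h1 := h a (by simp)
    have h2 := ih fun b hb => h b (by simp [hb])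
    simp only [List.flatMap_cons, List.length_append, List.length_cons, add_mul, one_mul]
    omega

theorem length_linearCircuit_le (C : Matrix ι ι (ZMod N)) :
    (linearCircuit hN hNℓ C).length ≤
      Fintype.card ι * (Fintype.card ι * (6201 * (7 * ℓ + 16) ^ 2)) := by
  have h : ∀ i : ι, ((Finset.univ.erase i).toList.flatMap fun j =>
      addMod hN hNℓ i j (C i j)).length ≤ Fintype.card ι * (6201 * (7 * ℓ + 16) ^ 2) := by
    intro i
    apply (length_flatMap_le _ _ fun j _ => length_addMod_le hN hNℓ i j (C i j)).trans
    apply Nat.mul_le_mul_right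
    rw [Finset.length_toList]
    exact Finset.card_le_univ _
  apply (length_flatMap_le _ _ fun i _ => h i).trans_eq
  rw [Finset.length_toList, Finset.card_univ]

theorem run_addMod_list {i : ι} (c : ι → ZMod N) (l : List ι) (hi : i ∉ l) (v : ι → ZMod N) :
    run (l.flatMap fun j => addMod hN hNℓ i j (c j)) (ket (enc ℓ v)) =
      ket (enc ℓ (Function.update v i (v i + (l.map fun j => c j * v j).sum))) := by
  induction l generalizing v with
  | nil => simp [run_nil]
  | cons j l ih =>
    have hij : i ≠ j := fun h => hi (by simp [h])
    have hil : i ∉ l := fun h => hi (by simp [h])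
    rw [List.flatMap_cons, run_append, run_addMod hN hNℓ hij, ih hil, Function.update_self,
      Function.update_idem, List.map_cons, List.sum_cons, add_assoc]
    congr 6
    apply List.map_congr_left
    intro k hk
    rw [Function.update_of_ne]
    rintro rfl
    exact hil hk

/-- By `hC`, a register read with a nonzero coefficient is never changed, so every addition sees the
original values and the order is immaterial. The case `i = j` forces a zero diagonal. -/
theorem run_linearCircuit {C : Matrix ι ι (ZMod N)}
    (hC : ∀ i j, C i j = 0 ∨ ∀ k, C j k = 0) (v : ι → ZMod N) :
    run (linearCircuit hN hNℓ C) (ket (enc ℓ v)) = ket (enc ℓ (v + C *ᵥ v)) := by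
  have key : ∀ l : List ι, l.Nodup → ∀ u : ι → ZMod N, (∀ i ∈ l, u i = v i) →
      (∀ i, (∀ k, C i k = 0) → u i = v i) →
      run (l.flatMap fun i => (Finset.univ.erase i).toList.flatMap fun j =>
        addMod hN hNℓ i j (C i j)) (ket (enc ℓ u)) =
      ket (enc ℓ fun i => if i ∈ l then v i + (C *ᵥ v) i else u i) := by
    intro l
    induction l with
    | nil => intro _ u _ _; simp [run_nil]
    | cons i l ih =>
      intro hl u hu hu'
      rw [List.nodup_cons] at hl
      have hsum : u i + ((Finset.univ.erase i).toList.map fun j => C i j * u j).sum =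
          v i + (C *ᵥ v) i := by
        rw [hu i (by simp), Finset.sum_map_toList, Matrix.mulVec, dotProduct]
        congr 1
        have hii : C i i = 0 := (hC i i).elim id fun h => h i
        rw [← Finset.add_sum_erase _ _ (Finset.mem_univ i), hii, zero_mul, zero_add]
        apply Finset.sum_congr rfl
        intro j _
        rcases hC i j with h | h
        · rw [h, zero_mul, zero_mul]
        · rw [hu' j h]
      rw [List.flatMap_cons, run_append, run_addMod_list hN hNℓ _ _ (by simp), hsum, ih hl.2]
      · congr 2
        funext k
        by_cases hk : k = i
        · subst hk
          simp [hl.1]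
        · simp [hk]
      · intro k hk
        rw [Function.update_of_ne, hu k (by simp [hk])]
        rintro rfl
        exact hl.1 hk
      · intro k hk
        by_cases hki : k = i
        · subst hki
          have : (C *ᵥ v) k = 0 := by simp [Matrix.mulVec, dotProduct, hk]
          rw [Function.update_self, this, add_zero]
        · rw [Function.update_of_ne hki, hu' k hk]
  rw [linearCircuit, key _ (Finset.nodup_toList _) v (fun _ _ => rfl) fun _ _ => rfl]
  congr 2
  funext i
  simp

/-- The inverse Fourier transforms of order `N` of the registers in a list. -/
noncomputable def invFourierList (l : List ι) : Circuit (AWires ι ℓ) :=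
  l.flatMap fun i => (fourierAt hN hNℓ i).inv

theorem length_invFourierList_le (l : List ι) :
    (invFourierList hN hNℓ l).length ≤ l.length * (3100 * (7 * ℓ + 16) ^ 2) := by
  apply length_flatMap_le
  intro i _
  rw [Circuit.length_inv, fourierAt, Circuit.length_map]
  exact length_fourierCircuit_le hN hNℓ

theorem run_invFourierList {l : List ι} (hl : l.Nodup) (v : ι → ZMod N) :
    run (invFourierList hN hNℓ l) (ket (enc ℓ v)) =
      ∑ w : ι → ZMod N with ∀ i, i ∉ l → w i = v i,
        (l.map fun i => star (fourierMatrix N (v i) (w i))).prod • ket (enc ℓ w) := by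
  induction l generalizing v with
  | nil =>
    have : (Finset.univ.filter fun w : ι → ZMod N => ∀ i, i ∉ ([] : List ι) → w i = v i) = {v} := by
      ext w
      simp [funext_iff]
    rw [this]
    simp [invFourierList, run_nil]
  | cons i l ih =>
    rw [List.nodup_cons] at hl
    have ih' := ih hl.2
    rw [invFourierList] at ih' ⊢
    -- Register `i` is transformed first and, as `i ∉ l`, keeps its new value; the final states are
    -- grouped by that value.
    rw [List.flatMap_cons, run_append, run_fourierAt_inv, run_sum,
      ← Finset.sum_fiberwise _ fun w : ι → ZMod N => w i]
    apply Finset.sum_congr rfl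
    intro t _
    rw [run_smul, ih', Finset.smul_sum, Finset.filter_filter]
    have : (Finset.univ.filter fun w : ι → ZMod N =>
        ∀ k, k ∉ l → w k = Function.update v i t k) =
        Finset.univ.filter fun w : ι → ZMod N => (∀ k, k ∉ i :: l → w k = v k) ∧ w i = t := by
      ext w
      simp only [Finset.mem_filter, Finset.mem_univ, true_and, List.mem_cons, not_or]
      constructor
      · intro h
        refine ⟨fun k hk => ?_, ?_⟩
        · rw [h k hk.2, Function.update_of_ne hk.1]
        · rw [h i hl.1, Function.update_self]
      · rintro ⟨h1, h2⟩ k hk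
        by_cases hki : k = i
        · subst hki
          rw [h2, Function.update_self]
        · rw [Function.update_of_ne hki, h1 k ⟨hki, hk⟩]
    rw [this]
    apply Finset.sum_congr rfl
    intro w hw
    simp only [Finset.mem_filter, Finset.mem_univ, true_and] at hw
    rw [smul_smul, List.map_cons, List.prod_cons, hw.2]
    congr 3
    apply List.map_congr_left
    intro k hk
    rw [Function.update_of_ne]
    rintro rfl
    exact hl.1 hk

theorem run_invFourierList_of_mem_iff {l : List ι} (hl : l.Nodup) (v : ι → ZMod N)
    {S : Finset (ι → ZMod N)} (hS : ∀ w, w ∈ S ↔ ∀ i, i ∉ l → w i = v i) :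
    run (invFourierList hN hNℓ l) (ket (enc ℓ v)) =
      ∑ w ∈ S, (l.map fun i => star (fourierMatrix N (v i) (w i))).prod • ket (enc ℓ w) := by
  rw [run_invFourierList hN hNℓ hl]
  apply Finset.sum_congr _ fun _ _ => rfl
  ext w
  rw [Finset.mem_filter, hS]
  exact and_iff_right (Finset.mem_univ _)

end Arithmetic

/-! ### The group `L_N` -/

section Lattice

variable {n N : ℕ} [NeZero n] {B : Matrix (Fin n) (Fin n) ℤ}

theorem IsSysNF.det_eq (hB : IsSysNF B) : B.det = B 0 0 := by
  rw [Matrix.det_of_isUpperTriangular, Finset.prod_eq_single 0]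
  · intro i _ hi
    exact hB.diag i hi
  · simp
  · intro i j hij
    exact hB.offDiag i j (Fin.pos_iff_ne_zero.1 ((Fin.zero_le j).trans_lt hij)) (ne_of_gt hij)

/-- The linear functional `x ↦ b₂ x₂ + ⋯ + bₙ xₙ`. -/
noncomputable def tailForm (B : Matrix (Fin n) (Fin n) ℤ) (N : ℕ) :
    (Fin n → ZMod N) →ₗ[ZMod N] ZMod N :=
  ∑ j ∈ Finset.univ.erase 0, (B 0 j : ZMod N) • LinearMap.proj j

theorem tailForm_apply (x : Fin n → ZMod N) :
    tailForm B N x = ∑ j ∈ Finset.univ.erase 0, (B 0 j : ZMod N) * x j := by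
  simp [tailForm]

/-- The first column of `B` vanishes modulo `N`. The other columns leave the tail free and determine
the first coordinate from it. -/
theorem mem_latticeMod_iff_tailForm (hB : IsSysNF B) (hdet : B.det = N) (x : Fin n → ZMod N) :
    x ∈ latticeMod B N ↔ x 0 = tailForm B N x := by
  have hlat : lattice B = LinearMap.range B.mulVecLin := (Matrix.range_mulVecLin B).symm
  have h00 : B 0 0 = N := hB.det_eq.symm.trans hdet
  have hrow : ∀ (c : Fin n → ℤ) i, i ≠ 0 → (B *ᵥ c) i = c i := by
    intro c i hi
    rw [Matrix.mulVec, dotProduct, Finset.sum_eq_single i]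
    · rw [hB.diag i hi, one_mul]
    · intro j _ hj
      rw [hB.offDiag i j hi (Ne.symm hj), zero_mul]
    · simp
  have hrow0 : ∀ c : Fin n → ℤ,
      (B *ᵥ c) 0 = N * c 0 + ∑ j ∈ Finset.univ.erase 0, B 0 j * c j := by
    intro c
    rw [Matrix.mulVec, dotProduct, ← Finset.add_sum_erase _ _ (Finset.mem_univ 0), h00]
  rw [tailForm_apply]
  constructor
  · rintro ⟨v, hv, rfl⟩
    have hv' : v ∈ lattice B := hv
    rw [hlat] at hv'
    obtain ⟨c, rfl⟩ := hv'
    simp only [AddMonoidHom.compLeft_apply, Function.comp_apply, Int.coe_castAddHom,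
      Matrix.mulVecLin_apply]
    rw [hrow0]
    push_cast
    rw [ZMod.natCast_self, zero_mul, zero_add]
    apply Finset.sum_congr rfl
    intro j hj
    rw [hrow c j (Finset.ne_of_mem_erase hj)]
  · intro hx
    choose c hc using fun i => ZMod.intCast_surjective (x i)
    refine ⟨B *ᵥ c, ?_, ?_⟩
    · change _ ∈ lattice B
      rw [hlat]
      exact ⟨c, rfl⟩
    · funext i
      simp only [AddMonoidHom.compLeft_apply, Function.comp_apply, Int.coe_castAddHom]
      by_cases hi : i = 0
      · subst hi
        rw [hrow0, hx]
        push_cast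
        rw [ZMod.natCast_self, zero_mul, zero_add]
        simp only [hc]
      · rw [hrow c i hi, hc]

/-- The coefficients of the dual pairing on `L_N`: `⟨x, z⟩ = ∑_{i > 1} (x_i + b_i x_1) z_i`. -/
noncomputable def dualCoord (B : Matrix (Fin n) (Fin n) ℤ) (N : ℕ) :
    (Fin n → ZMod N) →ₗ[ZMod N] (Fin n → ZMod N) :=
  LinearMap.pi fun i =>
    if i = 0 then 0 else LinearMap.proj i + (B 0 i : ZMod N) • LinearMap.proj 0

theorem dualCoord_zero (x : Fin n → ZMod N) : dualCoord B N x 0 = 0 := by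
  simp [dualCoord]

theorem dualCoord_apply (x : Fin n → ZMod N) {i : Fin n} (hi : i ≠ 0) :
    dualCoord B N x i = x i + B 0 i * x 0 := by
  simp [dualCoord, hi]

/-- The inverse of `dualCoord` on `L_N`, when `d` is the inverse of `b₂² + ⋯ + bₙ² + 1`. -/
noncomputable def dualCoordInv (B : Matrix (Fin n) (Fin n) ℤ) (N : ℕ) (d : ZMod N) :
    (Fin n → ZMod N) →ₗ[ZMod N] (Fin n → ZMod N) :=
  LinearMap.pi fun i =>
    if i = 0 then d • tailForm B N
    else LinearMap.proj i - ((B 0 i : ZMod N) * d) • tailForm B N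

/-- On `L_N` the part `∑ b i * x i` equals `x 0`, which supplies the `+ 1`. -/
theorem tailForm_dualCoord (hB : IsSysNF B) (hdet : B.det = N) {x : Fin n → ZMod N}
    (hx : x ∈ latticeMod B N) :
    tailForm B N (dualCoord B N x) =
      ((∑ i ∈ Finset.univ.erase 0, B 0 i ^ 2 + 1 : ℤ) : ZMod N) * x 0 := by
  rw [mem_latticeMod_iff_tailForm hB hdet] at hx
  push_cast
  rw [add_mul, one_mul, Finset.sum_mul]
  refine Eq.trans ?_ (congrArg (_ + ·) hx.symm)
  rw [tailForm_apply, tailForm_apply, ← Finset.sum_add_distrib]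
  apply Finset.sum_congr rfl
  intro j hj
  rw [dualCoord_apply _ (Finset.ne_of_mem_erase hj)]
  ring

/-- Multiplying by `d` recovers `x 0`; subtracting `b i * x 0` then recovers the tail. This is where
invertibility of `∑ b i ^ 2 + 1` is needed. -/
theorem dualCoordInv_dualCoord (hB : IsSysNF B) (hdet : B.det = N) {d : ZMod N}
    (hd : d * ((∑ i ∈ Finset.univ.erase 0, B 0 i ^ 2 + 1 : ℤ) : ZMod N) = 1)
    {x : Fin n → ZMod N} (hx : x ∈ latticeMod B N) :
    dualCoordInv B N d (dualCoord B N x) = x := by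
  have h : d * tailForm B N (dualCoord B N x) = x 0 := by
    rw [tailForm_dualCoord hB hdet hx, ← mul_assoc, hd, one_mul]
  funext i
  by_cases hi : i = 0
  · subst hi
    simpa [dualCoordInv] using h
  · simp only [dualCoordInv, LinearMap.pi_apply, if_neg hi, LinearMap.sub_apply,
      LinearMap.proj_apply, LinearMap.smul_apply, smul_eq_mul, mul_assoc, h, dualCoord_apply x hi]
    ring

theorem IsSysNF.exists_inverse (hB : IsSysNF B) (hdet : B.det = N) :
    ∃ d : ZMod N, d * ((∑ i ∈ Finset.univ.erase 0, B 0 i ^ 2 + 1 : ℤ) : ZMod N) = 1 := by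
  obtain ⟨u, v, h⟩ := hB.coprime
  rw [← hB.det_eq, hdet] at h
  refine ⟨u, ?_⟩
  have := congrArg (Int.cast : ℤ → ZMod N) h
  push_cast at this ⊢
  rwa [ZMod.natCast_self, mul_zero, add_zero] at this

/-- The point of `L_N` with the given coordinates other than the first. -/
noncomputable def latticePoint (B : Matrix (Fin n) (Fin n) ℤ) (N : ℕ) :
    (Fin n → ZMod N) →ₗ[ZMod N] (Fin n → ZMod N) :=
  LinearMap.pi fun i => if i = 0 then tailForm B N else LinearMap.proj i

theorem latticePoint_zero (x : Fin n → ZMod N) : latticePoint B N x 0 = tailForm B N x := by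
  simp [latticePoint]

theorem latticePoint_apply (x : Fin n → ZMod N) {i : Fin n} (hi : i ≠ 0) :
    latticePoint B N x i = x i := by
  simp [latticePoint, hi]

theorem tailForm_congr {x y : Fin n → ZMod N} (h : ∀ i, i ≠ 0 → x i = y i) :
    tailForm B N x = tailForm B N y := by
  rw [tailForm_apply, tailForm_apply]
  exact Finset.sum_congr rfl fun j hj => by rw [h j (Finset.ne_of_mem_erase hj)]

theorem latticePoint_mem (hB : IsSysNF B) (hdet : B.det = N) (x : Fin n → ZMod N) :
    latticePoint B N x ∈ latticeMod B N := by
  rw [mem_latticeMod_iff_tailForm hB hdet, latticePoint_zero]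
  exact tailForm_congr fun i hi => (latticePoint_apply x hi).symm

theorem eq_latticePoint (hB : IsSysNF B) (hdet : B.det = N) {x y : Fin n → ZMod N}
    (hy : y ∈ latticeMod B N) (h : ∀ i, i ≠ 0 → x i = y i) : latticePoint B N x = y := by
  rw [mem_latticeMod_iff_tailForm hB hdet] at hy
  funext i
  by_cases hi : i = 0
  · subst hi
    rw [latticePoint_zero, hy]
    exact tailForm_congr h
  · rw [latticePoint_apply x hi, h i hi]

/-- The projection that sets the first coordinate to zero. -/
noncomputable def tailProj (n N : ℕ) [NeZero n] : (Fin n → ZMod N) →ₗ[ZMod N] (Fin n → ZMod N) :=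
  LinearMap.pi fun i => if i = 0 then 0 else LinearMap.proj i

theorem tailProj_zero (x : Fin n → ZMod N) : tailProj n N x 0 = 0 := by
  simp [tailProj]

theorem tailProj_apply (x : Fin n → ZMod N) {i : Fin n} (hi : i ≠ 0) :
    tailProj n N x i = x i := by
  simp [tailProj, hi]

theorem card_latticeMod [NeZero N] (hB : IsSysNF B) (hdet : B.det = N) :
    Fintype.card (latticeMod B N) = N ^ (n - 1) := by
  classical
  have e : latticeMod B N ≃ ({i : Fin n // i ≠ 0} → ZMod N) :=
    { toFun := fun x i => x.1 i
      invFun := fun y => ⟨latticePoint B N fun i => if h : i ≠ 0 then y ⟨i, h⟩ else 0,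
        latticePoint_mem hB hdet _⟩
      left_inv := fun x => Subtype.ext (eq_latticePoint hB hdet x.2 fun i hi => by simp [hi])
      right_inv := fun y => by
        funext i
        have := i.2
        simp [latticePoint_apply _ i.2, this] }
  rw [Fintype.card_congr e, Fintype.card_fun, ZMod.card]
  congr 1
  rw [Fintype.card_subtype_compl, Fintype.card_fin]
  simp

/-- Eliminating the first coordinate of the lattice point leaves a sum over its free tail, so the
Fourier kernel factors over coordinates. -/
theorem dotProduct_latticePoint (x z : Fin n → ZMod N) :
    x ⬝ᵥ latticePoint B N z = ∑ i ∈ Finset.univ.erase 0, dualCoord B N x i * z i := by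
  rw [dotProduct, ← Finset.add_sum_erase _ _ (Finset.mem_univ 0), latticePoint_zero,
    tailForm_apply, Finset.mul_sum, ← Finset.sum_add_distrib]
  apply Finset.sum_congr rfl
  intro i hi
  have hi' := Finset.ne_of_mem_erase hi
  rw [latticePoint_apply z hi', dualCoord_apply x hi']
  ring

/-- Nondegeneracy: pairing with the lattice point whose tail is a unit vector isolates one dual
coordinate, and the dual coordinates determine `x`. -/
theorem eq_zero_of_dotProduct_eq_zero (hB : IsSysNF B) (hdet : B.det = N) {x : Fin n → ZMod N}
    (hx : x ∈ latticeMod B N) (h : ∀ z ∈ latticeMod B N, x ⬝ᵥ z = 0) : x = 0 := by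
  obtain ⟨d, hd⟩ := hB.exists_inverse hdet
  have : dualCoord B N x = 0 := by
    funext i
    by_cases hi : i = 0
    · subst hi
      exact dualCoord_zero x
    · have h1 := h _ (latticePoint_mem hB hdet (Pi.single i 1))
      rw [dotProduct_latticePoint, Finset.sum_eq_single i] at h1
      · simpa using h1
      · intro j _ hj
        simp [hj]
      · simp [hi]
  rw [← dualCoordInv_dualCoord hB hdet hd hx, this, map_zero]

/-! ### Characters of `L_N`, unitarity and the lattice DFT -/

theorem phase_eq {m : ℕ} [NeZero N] (x z : Fin m → ZMod N) :
    phase x z = ZMod.stdAddChar (-(x ⬝ᵥ z)) := by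
  have h := stdAddChar_natCast (N := N) (∑ i, (x i).val * (z i).val)
  have h1 : ((∑ i, (x i).val * (z i).val : ℕ) : ZMod N) = x ⬝ᵥ z := by
    push_cast
    simp [dotProduct]
  rw [h1] at h
  rw [← star_stdAddChar, h, star_cis, phase, cis]
  congr 1
  push_cast
  ring

/-- The character `z ↦ e^{2πi⟨x,z⟩/N}` of `L_N`. -/
noncomputable def dotChar {m : ℕ} {B : Matrix (Fin m) (Fin m) ℤ} [NeZero N] (x : latticeMod B N) : AddChar (latticeMod B N) ℂ where
  toFun z := ZMod.stdAddChar (x.1 ⬝ᵥ z.1)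
  map_zero_eq_one' := by simp
  map_add_eq_mul' z z' := by
    rw [AddSubgroup.coe_add, dotProduct_add, AddChar.map_add_eq_mul]

theorem dotChar_apply {m : ℕ} {B : Matrix (Fin m) (Fin m) ℤ} [NeZero N] (x z : latticeMod B N) :
    dotChar x z = ZMod.stdAddChar (x.1 ⬝ᵥ z.1) := rfl

theorem dotChar_eq_one_iff [NeZero N] (hB : IsSysNF B) (hdet : B.det = N) (x : latticeMod B N) :
    dotChar x = 1 ↔ x = 0 := by
  constructor
  · intro h
    apply Subtype.ext
    apply eq_zero_of_dotProduct_eq_zero hB hdet x.2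
    intro z hz
    have h1 := DFunLike.congr_fun h ⟨z, hz⟩
    rw [dotChar_apply, AddChar.one_apply] at h1
    apply ZMod.injective_stdAddChar
    rw [h1, AddChar.map_zero_eq_one]
  · rintro rfl
    ext z
    simp [dotChar_apply]

theorem sum_stdAddChar_dotProduct [NeZero N] (hB : IsSysNF B) (hdet : B.det = N)
    (x : latticeMod B N) :
    ∑ z : latticeMod B N, ZMod.stdAddChar (x.1 ⬝ᵥ z.1) = if x = 0 then (N : ℂ) ^ (n - 1) else 0 := by
  split_ifs with h
  · subst h
    simp [card_latticeMod hB hdet]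
  · simp only [← dotChar_apply]
    apply AddChar.sum_eq_zero_of_ne_one
    exact fun h' => h ((dotChar_eq_one_iff hB hdet x).1 h')

/-- Orthogonality of characters: an entry of the Gram matrix is the normalised sum over `L_N` of the
character attached to `x - x'`. -/
theorem qft_mem_unitaryGroup [NeZero N] (hB : IsSysNF B) (hdet : B.det = N) :
    qft B N ∈ Matrix.unitaryGroup (latticeMod B N) ℂ := by
  have hN : (N : ℂ) ≠ 0 := NeZero.ne _
  have hs : (1 / ((√((N : ℝ) ^ (n - 1)) : ℝ) : ℂ)) * (1 / ((√((N : ℝ) ^ (n - 1)) : ℝ) : ℂ)) =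
      ((N : ℂ) ^ (n - 1))⁻¹ := by
    rw [div_mul_div_comm, one_mul, ← Complex.ofReal_mul, Real.mul_self_sqrt (by positivity)]
    simp
  rw [Matrix.mem_unitaryGroup_iff', Matrix.star_eq_conjTranspose]
  ext x x'
  rw [Matrix.mul_apply]
  have : ∀ z, (qft B N)ᴴ x z * qft B N z x' =
      ((N : ℂ) ^ (n - 1))⁻¹ * ZMod.stdAddChar ((x - x').1 ⬝ᵥ z.1) := by
    intro z
    simp only [Matrix.conjTranspose_apply, qft, Matrix.of_apply, star_mul', phase_eq,
      star_stdAddChar, neg_neg]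
    rw [AddSubgroup.coe_sub, sub_dotProduct, sub_eq_add_neg, AddChar.map_add_eq_mul, ← hs]
    simp only [Complex.star_def, map_div₀, map_one, Complex.conj_ofReal]
    ring
  rw [Finset.sum_congr rfl fun z _ => this z, ← Finset.mul_sum,
    sum_stdAddChar_dotProduct hB hdet]
  by_cases h : x = x'
  · subst h
    simp [hN]
  · rw [Matrix.one_apply_ne h, if_neg (sub_ne_zero.2 h), mul_zero]

/-- Irreducible complex representations of an abelian group are one-dimensional, hence given by
characters. An intertwiner between two lines commutes with scalars, so equivalent characters are
equal. -/
theorem isFourierTransform_of_bijective {G ι : Type*} [AddCommGroup G] {χ : ι → AddChar G ℂ}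
    (hχ : Function.Bijective χ) : IsFourierTransform χ where
  irreducible i :=
    { exists_pair_ne := ⟨⊥, ⊤, fun h => bot_ne_top (α := Submodule ℂ ℂ)
        (congrArg Subrepresentation.toSubmodule h)⟩
      eq_bot_or_eq_top := fun σ => (eq_bot_or_eq_top σ.toSubmodule).imp
        (fun h => Subrepresentation.toSubmodule_injective h)
        (fun h => Subrepresentation.toSubmodule_injective h) }
  inequivalent := by
    rintro i j ⟨φ⟩
    apply hχ.1
    ext g
    have h1 := Representation.IntertwiningMap.isIntertwining _ _ φ.toIntertwiningMap
      (Multiplicative.ofAdd g) 1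
    have h2 : φ.toLinearEquiv 1 ≠ 0 := by simp
    have h3 : φ.toLinearEquiv (χ i g • 1) = χ j g • φ.toLinearEquiv 1 := h1
    rw [map_smul] at h3
    exact smul_left_injective ℂ h2 h3
  complete := by
    intro V _ _ _ ρ hρ
    have hdim : Module.finrank ℂ V = 1 :=
      Representation.IsIrreducible.finrank_eq_one_of_isMulCommutative ρ
    let e : V ≃ₗ[ℂ] ℂ := LinearEquiv.ofFinrankEq V ℂ (by rw [hdim, Module.finrank_self])
    have he : ∀ v, v = e v • e.symm 1 := by
      intro v
      rw [← map_smul, smul_eq_mul, mul_one, e.symm_apply_apply]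
    let ψ : AddChar G ℂ :=
      { toFun := fun g => e (ρ (Multiplicative.ofAdd g) (e.symm 1))
        map_zero_eq_one' := by simp
        map_add_eq_mul' := fun g h => by
          rw [ofAdd_add, map_mul, Module.End.mul_apply]
          conv_lhs => rw [he (ρ (Multiplicative.ofAdd h) (e.symm 1))]
          rw [map_smul, map_smul, smul_eq_mul, mul_comm] }
    obtain ⟨i, hi⟩ := hχ.2 ψ
    refine ⟨i, ⟨Representation.Equiv.mk e fun g => ?_⟩⟩
    rw [hi]
    ext v
    change e (ρ g v) = e (ρ g (e.symm 1)) • e v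
    conv_lhs => rw [he v]
    rw [map_smul, map_smul, smul_eq_mul, smul_eq_mul, mul_comm]

/-- Injectivity is nondegeneracy of the pairing; surjectivity follows because a finite abelian group
has as many characters as elements. The sign in `-x` matches that of `phase`. -/
theorem hasLatticeDFT [NeZero N] (hB : IsSysNF B) (hdet : B.det = N) : HasLatticeDFT B N := by
  refine ⟨fun x => dotChar (-x), isFourierTransform_of_bijective ?_, fun x z => ?_⟩
  · rw [Fintype.bijective_iff_injective_and_card, AddChar.card_eq]
    refine ⟨fun x y h => ?_, rfl⟩
    have h1 : dotChar (y - x) = 1 := by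
      ext z
      have h2 := DFunLike.congr_fun h z
      simp only [dotChar_apply, AddSubgroup.coe_neg, neg_dotProduct] at h2
      rw [dotChar_apply, AddSubgroup.coe_sub, sub_dotProduct, sub_eq_add_neg,
        AddChar.map_add_eq_mul, h2, ← AddChar.map_add_eq_mul, add_neg_cancel,
        AddChar.map_zero_eq_one, AddChar.one_apply]
    rw [dotChar_eq_one_iff hB hdet] at h1
    exact (sub_eq_zero.1 h1).symm
  · rw [dotChar_apply, phase_eq, AddSubgroup.coe_neg, neg_dotProduct]

end Lattice

/-! ### The circuit of the quantum Fourier transform on `L_N` -/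

section LatticeCircuit

theorem run_map_ket {V W : Type} [Fintype V] [DecidableEq V] [Fintype W] [DecidableEq W]
    (f : V ≃ W) {T : Type} [Fintype T] {C : Circuit V} {x : W → Bool} {a : T → ℂ}
    {z : T → W → Bool}
    (hC : run C (ket (x ∘ f)) = ∑ t, a t • ket (z t ∘ f)) :
    run (C.map f.toEmbedding) (ket x) = ∑ t, a t • ket (z t) := by
  refine run_map f.toEmbedding hC ?_ fun _ => rfl
  intro t k hk
  exact absurd ⟨f.symm k, f.apply_symm_apply k⟩ hk

variable {n N ℓ : ℕ} [NeZero n] [NeZero N] {B : Matrix (Fin n) (Fin n) ℤ}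

/-- The circuit of `(x, y) ↦ (x, y + g x)`. -/
noncomputable def lowerCircuit (hN : 2 ^ ℓ ≤ 2 * N) (hNℓ : N < 2 ^ ℓ)
    (g : (Fin n → ZMod N) →ₗ[ZMod N] (Fin n → ZMod N)) : Circuit (AWires (Fin n ⊕ Fin n) ℓ) :=
  linearCircuit hN hNℓ (Matrix.fromBlocks 0 0 (LinearMap.toMatrix' g) 0)

/-- The circuit of `(x, y) ↦ (x + g y, y)`. -/
noncomputable def upperCircuit (hN : 2 ^ ℓ ≤ 2 * N) (hNℓ : N < 2 ^ ℓ)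
    (g : (Fin n → ZMod N) →ₗ[ZMod N] (Fin n → ZMod N)) : Circuit (AWires (Fin n ⊕ Fin n) ℓ) :=
  linearCircuit hN hNℓ (Matrix.fromBlocks 0 (LinearMap.toMatrix' g) 0 0)

variable (hN : 2 ^ ℓ ≤ 2 * N) (hNℓ : N < 2 ^ ℓ)

theorem run_lowerCircuit (g : (Fin n → ZMod N) →ₗ[ZMod N] (Fin n → ZMod N))
    (x y : Fin n → ZMod N) :
    run (lowerCircuit hN hNℓ g) (ket (enc ℓ (Sum.elim x y))) =
      ket (enc ℓ (Sum.elim x (y + g x))) := by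
  rw [lowerCircuit, run_linearCircuit]
  · congr 2
    rw [Matrix.fromBlocks_mulVec]
    funext i
    cases i <;> simp [LinearMap.toMatrix'_mulVec]
  · rintro (i | i) (j | j)
    · simp
    · simp
    · right
      rintro (k | k) <;> simp
    · simp

theorem run_upperCircuit (g : (Fin n → ZMod N) →ₗ[ZMod N] (Fin n → ZMod N))
    (x y : Fin n → ZMod N) :
    run (upperCircuit hN hNℓ g) (ket (enc ℓ (Sum.elim x y))) =
      ket (enc ℓ (Sum.elim (x + g y) y)) := by
  rw [upperCircuit, run_linearCircuit]
  · congr 2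
    rw [Matrix.fromBlocks_mulVec]
    funext i
    cases i <;> simp [LinearMap.toMatrix'_mulVec]
  · rintro (i | i) (j | j)
    · simp
    · right
      rintro (k | k) <;> simp
    · simp
    · simp

/-- The labels of the registers for the coordinates of the dual pairing. -/
noncomputable def tailLabels (n : ℕ) [NeZero n] : List (Fin n ⊕ Fin n) :=
  (Finset.univ.erase (0 : Fin n)).toList.map Sum.inr

theorem nodup_tailLabels : (tailLabels n).Nodup :=
  (Finset.nodup_toList _).map Sum.inr_injective

theorem mem_tailLabels {i : Fin n ⊕ Fin n} : i ∈ tailLabels n ↔ ∃ j, j ≠ 0 ∧ i = Sum.inr j := by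
  simp only [tailLabels, List.mem_map, Finset.mem_toList, Finset.mem_erase, Finset.mem_univ,
    and_true]
  exact exists_congr fun j => and_congr_right fun _ => eq_comm

/-- The circuit of the quantum Fourier transform on `L_N`. -/
noncomputable def latticeCircuit (B : Matrix (Fin n) (Fin n) ℤ) (d : ZMod N) :
    Circuit (AWires (Fin n ⊕ Fin n) ℓ) :=
  -- With `h = dualCoord B N x`, the state runs through `(x, 0)`, `(x, h)`, `(0, h)`, then
  -- superpositions of `(0, tail z)`, `(z, tail z)` and `(z, 0)`.
  lowerCircuit hN hNℓ (dualCoord B N) ++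
    (upperCircuit hN hNℓ (-dualCoordInv B N d) ++
      (invFourierList hN hNℓ (tailLabels n) ++
        (upperCircuit hN hNℓ (latticePoint B N) ++
          lowerCircuit hN hNℓ (-tailProj n N))))

theorem map_sum_eq_prod {A ι : Type*} [AddCommMonoid A] (ψ : AddChar A ℂ) (s : Finset ι)
    (f : ι → A) : ψ (∑ i ∈ s, f i) = ∏ i ∈ s, ψ (f i) := by
  classical
  induction s using Finset.induction_on with
  | empty => simp
  | insert a s ha ih =>
    rw [Finset.sum_insert ha, Finset.prod_insert ha, AddChar.map_add_eq_mul, ih]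

/-- The `n - 1` normalisations multiply to `N ^ (-(n - 1) / 2)`, and by `dotProduct_latticePoint`
the phases add up to `-⟨x, z⟩`. The minus sign is the reason for inverse transforms. -/
theorem prod_fourierMatrix (hB : IsSysNF B) (hdet : B.det = N) (x z : latticeMod B N) :
    ((tailLabels n).map fun i => star (fourierMatrix N
      (Sum.elim (0 : Fin n → ZMod N) (dualCoord B N x.1) i)
      (Sum.elim (0 : Fin n → ZMod N) (tailProj n N z.1) i))).prod = qft B N z x := by
  rw [tailLabels, List.map_map, Finset.prod_map_toList]
  have h : ∀ i ∈ Finset.univ.erase (0 : Fin n), ((fun i => star (fourierMatrix N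
      (Sum.elim (0 : Fin n → ZMod N) (dualCoord B N x.1) i)
      (Sum.elim (0 : Fin n → ZMod N) (tailProj n N z.1) i))) ∘ Sum.inr) i =
      ((√N : ℝ) : ℂ)⁻¹ * ZMod.stdAddChar (-(dualCoord B N x.1 i * z.1 i)) := by
    intro i hi
    rw [Function.comp_apply, Sum.elim_inr, Sum.elim_inr,
      tailProj_apply _ (Finset.ne_of_mem_erase hi), fourierMatrix, Matrix.of_apply, star_mul',
      star_stdAddChar, mul_comm (z.1 i)]
    simp
  have hz := eq_latticePoint hB hdet z.2 (fun i _ => rfl : ∀ i, i ≠ 0 → z.1 i = z.1 i)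
  have hdot := dotProduct_latticePoint (B := B) x.1 z.1
  rw [hz] at hdot
  have hsqrt : √((N : ℝ) ^ (n - 1)) = √N ^ (n - 1) := by
    rw [Real.sqrt_eq_iff_eq_sq (by positivity) (by positivity), ← pow_mul, mul_comm, pow_mul,
      Real.sq_sqrt (by positivity)]
  rw [Finset.prod_congr rfl h, Finset.prod_mul_distrib, Finset.prod_const,
    Finset.card_erase_of_mem (Finset.mem_univ _), Finset.card_univ, Fintype.card_fin,
    ← map_sum_eq_prod, Finset.sum_neg_distrib, ← hdot, qft, Matrix.of_apply, phase_eq,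
    hsqrt]
  simp

theorem run_latticeCircuit (hB : IsSysNF B) (hdet : B.det = N) {d : ZMod N}
    (hd : d * ((∑ i ∈ Finset.univ.erase 0, B 0 i ^ 2 + 1 : ℤ) : ZMod N) = 1)
    (x : latticeMod B N) :
    run (latticeCircuit hN hNℓ B d) (ket (enc ℓ (Sum.elim x.1 0))) =
      ∑ z : latticeMod B N, qft B N z x • ket (enc ℓ (Sum.elim z.1 0)) := by
  have hx : x.1 + (-dualCoordInv B N d) (dualCoord B N x.1) = 0 := by
    rw [LinearMap.neg_apply, dualCoordInv_dualCoord hB hdet hd x.2, add_neg_cancel]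
  obtain ⟨S, hS⟩ : ∃ S : Finset (Fin n ⊕ Fin n → ZMod N), ∀ w, w ∈ S ↔
      ∀ i, i ∉ tailLabels n → w i = Sum.elim (0 : Fin n → ZMod N) (dualCoord B N x.1) i :=
    ⟨(Set.toFinite {w | _}).toFinset, fun w => Set.Finite.mem_toFinset _⟩
  rw [latticeCircuit, run_append, run_append, run_append, run_append, run_lowerCircuit,
    run_upperCircuit, zero_add, hx, run_invFourierList_of_mem_iff hN hNℓ nodup_tailLabels _ hS, run_sum, run_sum]
  symm
  -- The states reached vanish on the first half and at coordinate `0` of the second, so they are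
  -- exactly the tails of points of `L_N`.
  refine Finset.sum_bij' (fun z _ => Sum.elim 0 (tailProj n N z.1))
    (fun w _ => ⟨latticePoint B N (w ∘ Sum.inr), latticePoint_mem hB hdet _⟩) ?_ ?_ ?_ ?_ ?_
  · intro z _
    refine (hS _).2 ?_
    rintro (i | i) hi
    · rfl
    · have : i = 0 := by
        by_contra h
        exact hi (mem_tailLabels.2 ⟨i, h, rfl⟩)
      subst this
      rw [Sum.elim_inr, Sum.elim_inr, tailProj_zero, dualCoord_zero]
  · intro w _
    exact Finset.mem_univ _
  · intro z _
    exact Subtype.ext (eq_latticePoint hB hdet z.2 fun i hi => tailProj_apply _ hi)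
  · intro w hw
    rw [hS] at hw
    funext i
    rcases i with i | i
    · have h := hw (Sum.inl i) (by simp [mem_tailLabels])
      exact h.symm
    · rw [Sum.elim_inr]
      by_cases hi : i = 0
      · subst hi
        have h := hw (Sum.inr 0) (by simp [mem_tailLabels])
        rw [h, tailProj_zero, Sum.elim_inr, dualCoord_zero]
      · rw [tailProj_apply _ hi]
        exact latticePoint_apply _ hi
  · intro z _
    have h1 : (0 : Fin n → ZMod N) + latticePoint B N (tailProj n N z.1) = z.1 := by
      rw [zero_add]
      exact eq_latticePoint hB hdet z.2 fun i hi => tailProj_apply _ hi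
    have h2 : tailProj n N z.1 + (-tailProj n N) z.1 = 0 := by
      rw [LinearMap.neg_apply, add_neg_cancel]
    rw [run_smul, run_smul, run_upperCircuit, h1, run_lowerCircuit, h2,
      prod_fourierMatrix hB hdet]

/-- Four linear circuits on `2n` registers and one list of transforms: `(4 * 24804 + 3100) * 529 <
60000000`, where `529 = 23 ^ 2` and `7 ℓ + 16 ≤ 23 (n + ℓ)` because `n ≥ 1`. -/
theorem length_latticeCircuit_le (B : Matrix (Fin n) (Fin n) ℤ) (d : ZMod N) :
    (latticeCircuit hN hNℓ B d).length ≤ 60000000 * (n + ℓ) ^ 4 := by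
  have hlin : ∀ C : Matrix (Fin n ⊕ Fin n) (Fin n ⊕ Fin n) (ZMod N),
      (linearCircuit hN hNℓ C).length ≤ 24804 * (n ^ 2 * (7 * ℓ + 16) ^ 2) := by
    intro C
    apply (length_linearCircuit_le hN hNℓ C).trans_eq
    rw [Fintype.card_sum, Fintype.card_fin]
    ring
  have h1 := hlin (Matrix.fromBlocks 0 0 (LinearMap.toMatrix' (dualCoord B N)) 0)
  have h2 := hlin (Matrix.fromBlocks 0 (LinearMap.toMatrix' (-dualCoordInv B N d)) 0 0)
  have h3 := length_invFourierList_le hN hNℓ (tailLabels n)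
  have h4 := hlin (Matrix.fromBlocks 0 (LinearMap.toMatrix' (latticePoint B N)) 0 0)
  have h5 := hlin (Matrix.fromBlocks 0 0 (LinearMap.toMatrix' (-tailProj n N)) 0)
  have hn : 1 ≤ n := NeZero.one_le
  have h6 : (tailLabels n).length ≤ n ^ 2 := by
    have : (tailLabels n).length ≤ n := by
      rw [tailLabels, List.length_map, Finset.length_toList]
      exact (Finset.card_le_univ _).trans_eq (Fintype.card_fin n)
    exact this.trans (Nat.le_self_pow two_ne_zero n)
  have h7 := h3.trans (Nat.mul_le_mul_right _ h6)
  have h8 : n ^ 2 * (7 * ℓ + 16) ^ 2 ≤ 529 * (n + ℓ) ^ 4 := by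
    calc n ^ 2 * (7 * ℓ + 16) ^ 2 ≤ (n + ℓ) ^ 2 * (23 * (n + ℓ)) ^ 2 := by
          gcongr <;> omega
      _ = 529 * (n + ℓ) ^ 4 := by ring
  have h9 : n ^ 2 * (3100 * (7 * ℓ + 16) ^ 2) = 3100 * (n ^ 2 * (7 * ℓ + 16) ^ 2) := by ring
  simp only [latticeCircuit, lowerCircuit, upperCircuit, List.length_append]
  omega

theorem card_FWires (ℓ : ℕ) : Fintype.card (FWires ℓ) = 7 * ℓ + 16 := by
  rw [Fintype.card_sigma]
  simp only [Fintype.card_fin]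
  change ∑ r ∈ ({.X, .B, .V, .Y, .K, .T, .P, .S, .A, .F} : Finset Reg), rsize ℓ r = _
  simp [rsize]
  ring

/-- The placement of the registers among the qubits. -/
noncomputable def wiring (n N : ℕ) : AWires (Fin n ⊕ Fin n) (Nat.size N) ≃
    Wires n N (Fintype.card ((Fin n × Fin (Nat.size N)) ⊕ FWires (Nat.size N))) :=
  -- The first `n` registers are the given qubits; the second `n` and the work space become
  -- ancillas.
  ((Equiv.sumProdDistrib _ _ _).sumCongr (Equiv.refl _)).trans
    ((Equiv.sumAssoc _ _ _).trans ((Equiv.refl _).sumCongr (Fintype.equivFin _)))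

theorem encode_comp_wiring (x : Fin n → ZMod N) :
    encode _ x ∘ wiring n N = enc (Nat.size N) (Sum.elim x 0) := by
  funext w
  rcases w with ⟨i | i, k⟩ | w <;> simp [wiring, encode, enc]

theorem two_pow_size_le : 2 ^ Nat.size N ≤ 2 * N := by
  have hpos : 0 < Nat.size N := Nat.size_pos.2 (NeZero.pos N)
  have h : 2 ^ (Nat.size N - 1) ≤ N := Nat.lt_size.1 (by omega)
  calc 2 ^ Nat.size N = 2 * 2 ^ (Nat.size N - 1) := by
        rw [← pow_succ', Nat.sub_add_cancel hpos]
    _ ≤ 2 * N := Nat.mul_le_mul_left 2 h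

theorem exists_circuit (hB : IsSysNF B) (hdet : B.det = N) :
    ∃ (a : ℕ) (Q : Circuit (Wires n N a)), Implements Q B ∧
      a ≤ 60000000 * (n + Nat.size N) ^ 4 ∧ Q.length ≤ 60000000 * (n + Nat.size N) ^ 4 := by
  obtain ⟨d, hd⟩ := hB.exists_inverse hdet
  refine ⟨_, (latticeCircuit two_pow_size_le N.lt_size_self B d).map (wiring n N).toEmbedding,
    fun x => ?_, ?_, ?_⟩
  · refine run_map_ket (wiring n N) (z := fun z : latticeMod B N => encode _ z.1) ?_
    simp only [encode_comp_wiring]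
    exact run_latticeCircuit two_pow_size_le N.lt_size_self hB hdet hd x
  · rw [Fintype.card_sum, Fintype.card_prod, Fintype.card_fin, Fintype.card_fin, card_FWires]
    have hn : 1 ≤ n := NeZero.one_le
    generalize Nat.size N = ℓ
    have h1 : n * ℓ ≤ (n + ℓ) ^ 2 := by nlinarith
    have h2 : n + ℓ ≤ (n + ℓ) ^ 4 := Nat.le_self_pow (by norm_num) _
    have h3 : (n + ℓ) ^ 2 ≤ (n + ℓ) ^ 4 := Nat.pow_le_pow_right (by omega) (by norm_num)
    omega
  · rw [Circuit.length_map]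
    exact length_latticeCircuit_le _ _ B d

end LatticeCircuit

end LatticeDFT

open LatticeDFT
theorem theorem3 :
    ∃ p : Polynomial ℕ,
      ∀ (n N : ℕ) [NeZero n] [NeZero N] (B : Matrix (Fin n) (Fin n) ℤ),
        IsSysNF B → B.det = (N : ℤ) →
          qft B N ∈ Matrix.unitaryGroup (latticeMod B N) ℂ ∧
          (∃ (a : ℕ) (Q : Circuit (Wires n N a)),
            Implements Q B ∧
            a ≤ p.eval (n + Nat.size N) ∧
            Q.length ≤ p.eval (n + Nat.size N)) ∧
          HasLatticeDFT B N := by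
  refine ⟨Polynomial.C 60000000 * Polynomial.X ^ 4, ?_⟩
  intro n N _ _ B hB hdet
  refine ⟨qft_mem_unitaryGroup hB hdet, ?_, hasLatticeDFT hB hdet⟩
  simpa using exists_circuit hB hdet
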